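/- Let $\mathcal H$ be a complex Hilbert space and let $\{\psi_n\}_{n\in\mathbb Z}\subset\mathcal H$ be vectors of norm one whose Gram matrix $G=\{\langle\psi_n,\psi_m\rangle\}_{n,m\in\mathbb Z}$ (inner product linear in the first argument) defines a bounded operator on $\ell^2(\mathbb Z)$ and satisfies $\langle\psi_{n+1},\psi_{m+1}\rangle=\langle\psi_n,\psi_m\rangle$ for all $n,m$. Let $\varphi(k)=\sum_{n\in\mathbb Z}\langle\psi_n,\psi_0\rangle e^{ink}$ (convergence in $L^2(\mathbb T)$) be its symbol. Let $\varkappa=\{\varkappa_n\}_{n\in\mathbb Z}$ be independent, identically distributed random variables whose law $\mathbf P_0$ has compact support contained in $(0,\infty)$, and put $\varkappa_{\max}=\sup(\operatorname{supp}\mathbf P_0)$. For $N\ge 0$ let $$\mathcal P^{(N)}_\varkappa=\sum_{n=-N}^{N}\varkappa_n\langle\,\cdot\,,\psi_n\rangle\psi_n ,$$ and let $\nu^{(N)}_{\mathcal P_\varkappa}$ be the measure with a point mass $\frac1{2N+1}$ at each non-zero eigenvalue of $\mathcal P^{(N)}_\varkappa$, counted with multiplicity. The integrated density of states (IDS) measure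 $\nu=\nu_{\mathcal P_\varkappa}$ is the non-random probability measure on $\mathbb R$ to which, almost surely, the measures $\nu^{(N)}_{\mathcal P_\varkappa}$ converge weakly as $N\to\infty$. Assume that $\mathbf P_0$ is absolutely continuous with a density $\rho$ that is bounded by $\rho_{\max}<\infty$ almost everywhere. Then the IDS measure $\nu$ exists, its restriction to $\mathbb R\setminus\{0\}$ is absolutely continuous with respect to Lebesgue measure, and its density satisfies $$\frac{d\nu(\lambda)}{d\lambda}\le\frac{\rho_{\max}\,\varkappa_{\max}}{\lambda}\qquad\text{for almost every }\lambda>0 ,$$ a bound that does not depend on the symbol $\varphi$. If moreover $\varphi\neq 0$ almost everywhere on $\mathbb T$, then $\nu$ is absolutely continuous on the whole of $\mathbb R$. -/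

import Mathlib

open MeasureTheory Filter Topology
open scoped ENNReal BoundedContinuousFunction

noncomputable section

namespace RankOneSum

/-- The space `ℓ²(ℤ)`. -/
abbrev L2Z : Type := lp (fun _ : ℤ => ℂ) 2

/-- The doubly infinite matrix `A` defines a bounded operator on `ℓ²(ℤ)`: there is a bounded
operator `T` with `(T δ_m)(n) = A n m` for all `n`, `m`. -/
def IsBoundedMatrix (A : ℤ → ℤ → ℂ) : Prop :=
  ∃ T : L2Z →L[ℂ] L2Z, ∀ n m : ℤ, T (lp.single 2 m (1 : ℂ)) n = A n m

variable {H : Type*} [NormedAddCommGroup H] [InnerProductSpace ℂ H]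

/-- The entry `⟨ψ_n, ψ_m⟩` of the Gram matrix, for the convention in which the inner product is
linear in its first argument (Mathlib's `inner` is linear in the second one). -/
def gramEntry (ψ : ℤ → H) (n m : ℤ) : ℂ := inner ℂ (ψ m) (ψ n)

/-- The assumptions on the vectors: they have norm one, their Gram matrix is bounded on `ℓ²(ℤ)`
and is invariant under shifts of the indices. -/
structure IsAdmissible (ψ : ℤ → H) : Prop where
  norm_eq_one : ∀ n, ‖ψ n‖ = 1
  bounded : IsBoundedMatrix (gramEntry ψ)
  shift : ∀ n m, gramEntry ψ (n + 1) (m + 1) = gramEntry ψ n m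

/-- The symbol `φ = ∑ₙ ⟨ψ_n, ψ_0⟩ e_n`, a Fourier series converging in `L²` of the circle. The
circle is written as `ℝ / ℤ`, so that `e_n(x) = exp (2 π i n x)`, and carries its normalised
Lebesgue measure. -/
def symbol (ψ : ℤ → H) : Lp ℂ 2 (AddCircle.haarAddCircle (T := (1 : ℝ))) :=
  ∑' n : ℤ, gramEntry ψ n 0 • fourierLp (T := (1 : ℝ)) 2 n

/-- The finite rank operator `∑_{n = -N}^{N} ϰ_n ⟨·, ψ_n⟩ ψ_n`. -/
def truncated (ψ : ℤ → H) (ϰ : ℤ → ℝ) (N : ℕ) : H →L[ℂ] H :=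
  ∑ n ∈ Finset.Icc (-(N : ℤ)) (N : ℤ), (ϰ n : ℂ) • InnerProductSpace.rankOne ℂ (ψ n) (ψ n)

/-- The normalised eigenvalue counting measure of the truncated operator: a point mass
`1 / (2 N + 1)` at each non-zero eigenvalue, counted with multiplicity. (The operator is
self-adjoint, so its eigenvalues are real.) -/
def countingMeasure (ψ : ℤ → H) (ϰ : ℤ → ℝ) (N : ℕ) : Measure ℝ :=
  ((2 * N + 1 : ℕ) : ℝ≥0∞)⁻¹ •
    Measure.sum fun x : {x : ℝ // x ≠ 0} =>
      (Module.finrank ℂ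
        (Module.End.eigenspace (truncated ψ ϰ N : H →ₗ[ℂ] H) ((x : ℝ) : ℂ)) : ℝ≥0∞) •
          Measure.dirac (x : ℝ)

/-- `ν` is the integrated density of states measure: a non-random probability measure which is,
for almost every sequence `ϰ` of independent variables with law `P₀`, the weak limit of the
normalised eigenvalue counting measures. -/
structure IsIDSMeasure (ψ : ℤ → H) (P₀ : Measure ℝ) [IsProbabilityMeasure P₀] (ν : Measure ℝ) :
    Prop where
  isProbabilityMeasure : IsProbabilityMeasure ν
  tendsto : ∀ᵐ ϰ ∂(Measure.infinitePi fun _ : ℤ => P₀), ∀ f : ℝ →ᵇ ℝ,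
    Tendsto (fun N : ℕ => ∫ x, f x ∂(countingMeasure ψ ϰ N)) atTop (𝓝 (∫ x, f x ∂ν))

end RankOneSum

end

/-! The operator `truncated ψ ϰ N` is `V V*`, where `V` is the synthesis map of the vectors `√ϰ_n
ψ_n`. Its non-zero eigenvalues are therefore those of their Gram matrix `V* V`. A shift-invariant
Bessel sequence of unit vectors is linearly independent (`IsAdmissible.linearIndependent`), so all
`2N+1` Gram eigenvalues are positive. Almost surely the counting measures are thus probability
measures on one compact interval `[0, κR]`, where weak convergence amounts to convergence of
moments.

Existence. The `k`-th moment is a normalised trace of the `k`-th power of the Gram matrix. Cut the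
sites into blocks of length `L` and delete the Gram entries between blocks. Since `∑ |⟨ψ_n, ψ_0⟩|² <
∞`, this costs little in Hilbert–Schmidt norm compared with the square root of the dimension, and
traces of powers are Lipschitz in that scale (`abs_sum_gramEig_pow_sub_le`). The block traces are
bounded, independent and identically distributed, so the strong law applies. Letting `L` grow, each
moment has a non-random limit.

Density. Summing `Im (λ / (λ - z))` over the eigenvalues gives `∑ ϰ_n Im ⟨ψ_n, R(z) ψ_n⟩`. By the
rank one formula the `n`-th resolvent entry is `F / (1 + ϰ_n F)`, with `F` in the upper half plane
and independent of `ϰ_n`. Its imaginary part is a Poisson kernel in `ϰ_n`, of integral `π` whatever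
`F` is. The expectation of each term is thus at most `π ρmax κ` (`lintegral_sum_le`), uniformly in
`N` and `z`. Fatou's lemma passes this to `ν`: all Poisson integrals of `t dν(t)` are at most `π
ρmax κ`, hence `t dν(t) ≤ ρmax κ dt`.

No atom at zero. If `φ ≠ 0` almost everywhere, the functions `e_m φ` span a dense subspace of `L²`,
so `e_0` lies within `η` of a finite combination. By duality every diagonal entry of `(G + δ)⁻¹`,
for `G` any finite section of the Gram matrix, is at most `K(η) + η²/δ` (`exists_two_mul_re_le`).
After reinserting the weights, multiplying by `δ` and letting first `δ` and then `η` tend to zero,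
`ν {0} = 0`. -/

namespace RankOneSum

/-! ### Non-zero spectrum of products in either order -/

section Commute

/-- The eigenspaces of `f ∘ g` and `g ∘ f` at a non-zero scalar have the same dimension. -/
theorem finrank_eigenspace_comp_comm {K E F : Type*} [Field K] [AddCommGroup E] [Module K E]
    [AddCommGroup F] [Module K F] (f : E →ₗ[K] F) (g : F →ₗ[K] E) {μ : K} (hμ : μ ≠ 0) :
    Module.finrank K (Module.End.eigenspace (f ∘ₗ g) μ) =
      Module.finrank K (Module.End.eigenspace (g ∘ₗ f) μ) := by
  have hg : ∀ x ∈ Module.End.eigenspace (f ∘ₗ g) μ, g x ∈ Module.End.eigenspace (g ∘ₗ f) μ := by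
    intro x hx
    rw [Module.End.mem_eigenspace_iff] at hx ⊢
    simp only [LinearMap.comp_apply] at hx ⊢
    rw [hx, map_smul]
  refine LinearEquiv.finrank_eq (LinearEquiv.ofBijective (g.restrict hg) ⟨?_, ?_⟩)
  · rw [injective_iff_map_eq_zero]
    rintro ⟨x, hx⟩ h
    have h0 : g x = 0 := congrArg Subtype.val h
    rw [Module.End.mem_eigenspace_iff, LinearMap.comp_apply, h0, map_zero] at hx
    exact Subtype.ext ((smul_eq_zero.1 hx.symm).resolve_left hμ)
  · rintro ⟨y, hy⟩
    rw [Module.End.mem_eigenspace_iff, LinearMap.comp_apply] at hy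
    refine ⟨⟨μ⁻¹ • f y, ?_⟩, Subtype.ext ?_⟩
    · rw [Module.End.mem_eigenspace_iff, LinearMap.comp_apply, map_smul, hy, map_smul, map_smul,
        smul_comm]
    · change g (μ⁻¹ • f y) = y
      rw [map_smul, hy, inv_smul_smul₀ hμ]

end Commute

/-! ### Frame operators and Gram matrices of finite families -/

section Frame

variable {H : Type*} [NormedAddCommGroup H] [InnerProductSpace ℂ H]
variable {ι : Type*} [Fintype ι]

theorem inner_self_eq_ofReal_norm_sq (x : H) : inner ℂ x x = (‖x‖ : ℂ) ^ 2 :=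
  inner_self_eq_norm_sq_to_K x

/-- The operator `∑ᵢ ⟨·, v_i⟩ v_i`. -/
noncomputable def frameOp (v : ι → H) : H →L[ℂ] H := ∑ i, InnerProductSpace.rankOne ℂ (v i) (v i)

theorem frameOp_apply (v : ι → H) (h : H) : frameOp v h = ∑ i, inner ℂ (v i) h • v i := by
  simp [frameOp]

variable [DecidableEq ι]

/-- The eigenvalues of the Gram matrix of a finite family of vectors. -/
noncomputable def gramEig (v : ι → H) : ι → ℝ := (Matrix.isHermitian_gram ℂ v).eigenvalues

theorem gramEig_nonneg (v : ι → H) (i : ι) : 0 ≤ gramEig v i :=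
  (Matrix.posSemidef_gram ℂ v).eigenvalues_nonneg i

/-- With `V` the synthesis map and `W` the analysis map, the frame operator is `V W` and the Gram
matrix is `W V`, so they share their non-zero spectrum. For a Hermitian matrix, multiplicity is the
number of indices carrying the eigenvalue. -/
theorem finrank_eigenspace_frameOp (v : ι → H) {x : ℝ} (hx : x ≠ 0) :
    Module.finrank ℂ (Module.End.eigenspace (frameOp v : H →ₗ[ℂ] H) (x : ℂ)) =
      Finset.card {i | gramEig v i = x} := by
  let V : EuclideanSpace ℂ ι →ₗ[ℂ] H :=
    { toFun := fun u => ∑ i, u i • v i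
      map_add' := fun a b => by simp [add_smul, Finset.sum_add_distrib]
      map_smul' := fun c a => by simp [Finset.smul_sum, mul_smul] }
  let W : H →ₗ[ℂ] EuclideanSpace ℂ ι :=
    { toFun := fun h => WithLp.toLp 2 fun i => inner ℂ (v i) h
      map_add' := fun a b => by ext i; simp
      map_smul' := fun c a => by ext i; simp }
  have h1 : (frameOp v : H →ₗ[ℂ] H) = V ∘ₗ W := by
    ext h
    simp [V, W, frameOp_apply]
  have h2 : Matrix.toEuclideanLin (Matrix.gram ℂ v) = W ∘ₗ V := by
    refine LinearMap.ext fun u => ?_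
    ext i
    simp [V, W, Matrix.mulVec, dotProduct, mul_comm, Matrix.toLpLin_apply]
  rw [h1, finrank_eigenspace_comp_comm V W (by exact_mod_cast hx), ← h2]
  have := (Matrix.isSymmetric_toEuclideanLin_iff.mpr
    (Matrix.isHermitian_gram ℂ v)).card_filter_eigenvalues_eq finrank_euclideanSpace (x : ℂ)
  rw [← this]
  apply Finset.card_equiv (Fintype.equivOfCardEq (Fintype.card_fin _))
  intro i
  rw [Finset.mem_filter, Finset.mem_filter]
  simp [gramEig, Matrix.IsHermitian.eigenvalues, Matrix.IsHermitian.eigenvalues₀]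

/-- The eigenvalue counting measure of `frameOp v` in terms of the Gram matrix. -/
theorem sum_finrank_dirac_frameOp (v : ι → H) :
    (Measure.sum fun x : {x : ℝ // x ≠ 0} =>
      (Module.finrank ℂ
        (Module.End.eigenspace (frameOp v : H →ₗ[ℂ] H) ((x : ℝ) : ℂ)) : ℝ≥0∞) •
          Measure.dirac (x : ℝ)) =
      ∑ i, if gramEig v i = 0 then 0 else Measure.dirac (gramEig v i) := by
  ext s hs
  rw [Measure.sum_apply _ hs, Measure.finsetSum_apply]
  have h1 : ∀ x : {x : ℝ // x ≠ 0}, ((Module.finrank ℂ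
        (Module.End.eigenspace (frameOp v : H →ₗ[ℂ] H) ((x : ℝ) : ℂ)) : ℝ≥0∞) •
          Measure.dirac (x : ℝ)) s =
      ∑ i, if gramEig v i = x then Measure.dirac (x : ℝ) s else 0 := by
    intro x
    rw [finrank_eigenspace_frameOp v x.2, Measure.smul_apply, smul_eq_mul, ← Finset.sum_filter,
      Finset.sum_const, nsmul_eq_mul]
  simp_rw [h1]
  rw [Summable.tsum_finsetSum fun _ _ => ENNReal.summable]
  refine Finset.sum_congr rfl fun i _ => ?_
  split_ifs with h0
  · simp only [Measure.coe_zero, Pi.zero_apply, ENNReal.tsum_eq_zero]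
    intro x
    rw [if_neg]
    exact fun h => x.2 (h ▸ h0)
  · rw [tsum_eq_single ⟨gramEig v i, h0⟩, if_pos rfl]
    intro x hx
    rw [if_neg]
    exact fun h => hx (Subtype.ext h.symm)

/-- There are vectors `h_k` spanning the `v_i` which diagonalise `frameOp v`. -/
theorem exists_diagonalizing_family (v : ι → H) :
    ∃ (U : Matrix ι ι ℂ) (h : ι → H), U * U.conjTranspose = 1 ∧ U.conjTranspose * U = 1 ∧
      (∀ k, frameOp v (h k) = (gramEig v k : ℂ) • h k) ∧
      (∀ i, v i = ∑ k, star (U i k) • h k) ∧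
      (∀ k, h k = ∑ i, U i k • v i) ∧
      (∀ k l, inner ℂ (h k) (h l) = if k = l then (gramEig v k : ℂ) else 0) := by
  set hA := Matrix.isHermitian_gram ℂ v
  set U : Matrix ι ι ℂ := (hA.eigenvectorUnitary : Matrix ι ι ℂ)
  have hUU : U * U.conjTranspose = 1 := Unitary.coe_mul_star_self hA.eigenvectorUnitary
  have hUU' : U.conjTranspose * U = 1 := Unitary.coe_star_mul_self hA.eigenvectorUnitary
  have hGU : ∀ j, Matrix.mulVec (Matrix.gram ℂ v) (fun i => U i j) =
      (gramEig v j : ℂ) • fun i => U i j := by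
    intro j
    exact hA.mulVec_eigenvectorBasis j
  have hin : ∀ i l, inner ℂ (v i) (∑ j, U j l • v j) = (gramEig v l : ℂ) * U i l := by
    intro i l
    have := congrFun (hGU l) i
    simp only [Matrix.mulVec, dotProduct, Matrix.gram_apply, Pi.smul_apply, smul_eq_mul] at this
    rw [← this, inner_sum]
    exact Finset.sum_congr rfl fun j _ => by rw [inner_smul_right, mul_comm]
  -- The vectors are images under synthesis of the Gram eigenvectors, deliberately not normalised:
  -- their square norm is the eigenvalue, so zero eigenvalues give zero vectors and no linear
  -- independence is required.
  refine ⟨U, fun k => ∑ i, U i k • v i, hUU, hUU', ?_, ?_, fun _ => rfl, ?_⟩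
  · intro k
    rw [frameOp_apply]
    simp_rw [hin, mul_smul, Finset.smul_sum]
  · intro i
    simp_rw [Finset.smul_sum, smul_smul]
    rw [Finset.sum_comm]
    simp_rw [← Finset.sum_smul]
    have : ∀ j, ∑ k, star (U i k) * U j k = if j = i then 1 else 0 := by
      intro j
      have := congrFun (congrFun hUU j) i
      rw [Matrix.mul_apply, Matrix.one_apply] at this
      rw [← this]
      exact Finset.sum_congr rfl fun k _ => by rw [Matrix.conjTranspose_apply, mul_comm]
    simp_rw [this]
    simp
  · intro k l
    rw [sum_inner]
    simp_rw [inner_smul_left, hin]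
    have := congrFun (congrFun hUU' k) l
    rw [Matrix.mul_apply, Matrix.one_apply] at this
    simp_rw [Matrix.conjTranspose_apply] at this
    calc _ = (gramEig v l : ℂ) * ∑ i, star (U i k) * U i l := by
            rw [Finset.mul_sum]
            exact Finset.sum_congr rfl fun i _ => by
              rw [starRingEnd_apply]; ring
      _ = _ := by
            rw [this]
            split_ifs with h
            · subst h; simp
            · simp

/-- In the orthogonal family `h`, only diagonal terms survive, and the columns of `U` have norm one.
-/
theorem sum_inner_of_diagonalized (v : ι → H) (R : H →L[ℂ] H) (c : ι → ℂ) {U : Matrix ι ι ℂ}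
    {h : ι → H} (hUU' : U.conjTranspose * U = 1)
    (hv : ∀ i, v i = ∑ k, star (U i k) • h k)
    (hh : ∀ k l, inner ℂ (h k) (h l) = if k = l then (gramEig v k : ℂ) else 0)
    (hR : ∀ k, R (h k) = c k • h k) :
    ∑ i, inner ℂ (v i) (R (v i)) = ∑ k, c k * gramEig v k := by
  have h1 : ∀ i, inner ℂ (v i) (R (v i)) = ∑ k, U i k * star (U i k) * (c k * gramEig v k) := by
    intro i
    rw [hv i, map_sum, sum_inner]
    refine Finset.sum_congr rfl fun k _ => ?_
    rw [inner_sum, Finset.sum_eq_single k]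
    · rw [map_smul, hR, inner_smul_left, inner_smul_right, inner_smul_right, hh, if_pos rfl]
      simp
      ring
    · intro l _ hl
      rw [map_smul, hR, inner_smul_left, inner_smul_right, inner_smul_right, hh, if_neg hl.symm]
      simp
    · simp
  simp_rw [h1]
  rw [Finset.sum_comm]
  refine Finset.sum_congr rfl fun k _ => ?_
  rw [← Finset.sum_mul]
  have := congrFun (congrFun hUU' k) k
  rw [Matrix.mul_apply, Matrix.one_apply_eq] at this
  simp_rw [Matrix.conjTranspose_apply] at this
  simp_rw [mul_comm (U _ k)]
  rw [this, one_mul]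

/-- The trace formula for the resolvent. -/
theorem sum_inner_resolvent (v : ι → H) {z : ℂ} (hz : z.im ≠ 0) (R : H →L[ℂ] H)
    (hR : ∀ x, R (frameOp v x - z • x) = x) :
    ∑ i, inner ℂ (v i) (R (v i)) = ∑ k, (gramEig v k : ℂ) / (gramEig v k - z) := by
  obtain ⟨U, h, -, hUU', hP, hv, -, hh⟩ := exists_diagonalizing_family v
  have hne : ∀ k, (gramEig v k : ℂ) - z ≠ 0 := by
    intro k h0
    apply hz
    have := congrArg Complex.im h0
    simpa using this
  rw [sum_inner_of_diagonalized v R (fun k => ((gramEig v k : ℂ) - z)⁻¹) hUU' hv hh]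
  · exact Finset.sum_congr rfl fun k _ => by rw [div_eq_inv_mul]
  · intro k
    have := hR (h k)
    rw [hP, ← sub_smul, map_smul] at this
    nth_rw 2 [← this]
    rw [inv_smul_smul₀ (hne k)]

theorem trace_gram_pow (v : ι → H) (k : ℕ) :
    (Matrix.gram ℂ v ^ k).trace = ∑ i, (gramEig v i : ℂ) ^ k := by
  have hA := Matrix.isHermitian_gram ℂ v
  conv_lhs => rw [hA.spectral_theorem, ← map_pow, Matrix.diagonal_pow]
  rw [Unitary.conjStarAlgAut_apply, Matrix.trace_mul_comm, ← mul_assoc,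
    Unitary.coe_star_mul_self, one_mul, Matrix.trace_diagonal]
  rfl

/-- A dual bound on the diagonal of the resolvent of the Gram matrix. -/
theorem sum_inv_gramEig_add_le (v : ι → H) {δ C : ℝ} (hδ : 0 < δ)
    (hC : ∀ (x : ι → ℂ) (j : ι), 2 * (x j).re - ‖∑ i, x i • v i‖ ^ 2 - δ * ∑ i, ‖x i‖ ^ 2 ≤ C) :
    ∑ k, (gramEig v k + δ)⁻¹ ≤ Fintype.card ι * C := by
  obtain ⟨U, h, hUU, hUU', hP, hv, hhv, hh⟩ := exists_diagonalizing_family v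
  -- The left side is the diagonal entry of `(G + δ)⁻¹` at `j`, which is the supremum over `x` of
  -- the quadratic expression in `hC`.
  have key : ∀ j, ∑ k, ‖U j k‖ ^ 2 * (gramEig v k + δ)⁻¹ ≤ C := by
    intro j
    -- The maximiser is `x = (G + δ)⁻¹ e_j = U w`; these are its coordinates in the eigenbasis.
    set w : ι → ℂ := fun k => ((gramEig v k + δ)⁻¹ : ℝ) * star (U j k) with hw
    have h1 := hC (fun i => ∑ k, U i k * w k) j
    have e1 : ((∑ k, U j k * w k).re : ℝ) = ∑ k, ‖U j k‖ ^ 2 * (gramEig v k + δ)⁻¹ := by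
      rw [Complex.re_sum]
      refine Finset.sum_congr rfl fun k _ => ?_
      have : U j k * w k = ((‖U j k‖ ^ 2 * (gramEig v k + δ)⁻¹ : ℝ) : ℂ) := by
        rw [hw]
        push_cast
        rw [← Complex.mul_conj']
        simp only [RCLike.star_def]
        ring
      rw [this, Complex.ofReal_re]
    have e2 : ∑ i, (∑ k, U i k * w k) • v i = ∑ k, w k • h k := by
      simp_rw [hhv, Finset.smul_sum, Finset.sum_smul, smul_smul]
      rw [Finset.sum_comm]
      simp_rw [mul_comm]
    have e3 : ‖∑ k, w k • h k‖ ^ 2 = ∑ k, ‖w k‖ ^ 2 * gramEig v k := by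
      have : (((‖∑ k, w k • h k‖ ^ 2 : ℝ)) : ℂ) = ((∑ k, ‖w k‖ ^ 2 * gramEig v k : ℝ) : ℂ) := by
        push_cast
        rw [← inner_self_eq_ofReal_norm_sq, sum_inner]
        refine Finset.sum_congr rfl fun k _ => ?_
        rw [inner_smul_left, inner_sum, Finset.sum_eq_single k]
        · rw [inner_smul_right, hh, if_pos rfl, ← Complex.mul_conj']
          ring
        · intro l _ hl
          rw [inner_smul_right, hh, if_neg hl.symm, mul_zero]
        · simp
      exact_mod_cast this
    have e4 : ∑ i, ‖∑ k, U i k * w k‖ ^ 2 = ∑ k, ‖w k‖ ^ 2 := by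
      have h2 : star (U.mulVec w) ⬝ᵥ (U.mulVec w) = star w ⬝ᵥ w := by
        rw [Matrix.star_mulVec, Matrix.dotProduct_mulVec, Matrix.vecMul_vecMul, hUU',
          Matrix.vecMul_one]
      have h3 : ∀ y : ι → ℂ, star y ⬝ᵥ y = ((∑ i, ‖y i‖ ^ 2 : ℝ) : ℂ) := by
        intro y
        push_cast
        refine Finset.sum_congr rfl fun i _ => ?_
        rw [← Complex.mul_conj', Pi.star_apply, mul_comm]
        rfl
      rw [h3, h3] at h2
      exact_mod_cast h2
    rw [e1, e2, e3, e4, Finset.mul_sum, Finset.mul_sum, ← Finset.sum_sub_distrib,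
      ← Finset.sum_sub_distrib] at h1
    refine le_trans (le_of_eq (Finset.sum_congr rfl fun k _ => ?_)) h1
    have hpos : 0 < gramEig v k + δ := by linarith [gramEig_nonneg v k]
    have hwn : ‖w k‖ = (gramEig v k + δ)⁻¹ * ‖U j k‖ := by
      simp only [hw, norm_mul, norm_star, Complex.norm_real, Real.norm_eq_abs]
      rw [abs_of_pos (inv_pos.2 hpos)]
    rw [hwn]
    field_simp
    ring
  have hcol : ∀ k, ∑ j, ‖U j k‖ ^ 2 = 1 := by
    intro k
    have := congrFun (congrFun hUU' k) k
    rw [Matrix.mul_apply, Matrix.one_apply_eq] at this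
    have h2 : ((∑ j, ‖U j k‖ ^ 2 : ℝ) : ℂ) = 1 := by
      rw [← this]
      push_cast
      refine Finset.sum_congr rfl fun i _ => ?_
      rw [← Complex.mul_conj', Matrix.conjTranspose_apply, mul_comm]
      rfl
    exact_mod_cast h2
  calc ∑ k, (gramEig v k + δ)⁻¹ = ∑ j, ∑ k, ‖U j k‖ ^ 2 * (gramEig v k + δ)⁻¹ := by
        rw [Finset.sum_comm]
        refine Finset.sum_congr rfl fun k _ => ?_
        rw [← Finset.sum_mul, hcol, one_mul]
    _ ≤ ∑ _j : ι, C := Finset.sum_le_sum fun j _ => key j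
    _ = _ := by simp

end Frame

end RankOneSum

namespace RankOneSum

/-! ### Stability of traces of powers under Hilbert–Schmidt perturbations -/

section TraceComparison

open scoped Matrix.Norms.L2Operator

variable {H : Type*} [NormedAddCommGroup H] [InnerProductSpace ℂ H]
variable {H' : Type*} [NormedAddCommGroup H'] [InnerProductSpace ℂ H']
variable {ι : Type*} [Fintype ι]

/-- The synthesis operator of the finite family `v` is bounded, with square norm at most `R`. -/
def IsBesselBound (v : ι → H) (R : ℝ) : Prop :=
  ∀ x : ι → ℂ, ‖∑ i, x i • v i‖ ^ 2 ≤ R * ∑ i, ‖x i‖ ^ 2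

variable [DecidableEq ι]

/-- For `G = V* V` and `y = G x` one has `‖y‖² = ⟨V y, V x⟩ ≤ R ‖y‖ ‖x‖`; then divide by `‖y‖`. -/
theorem l2_opNorm_gram_le {v : ι → H} {R : ℝ} (hR : 0 ≤ R) (hv : IsBesselBound v R) :
    ‖Matrix.gram ℂ v‖ ≤ R := by
  rw [Matrix.l2_opNorm_def]
  refine ContinuousLinearMap.opNorm_le_bound _ hR fun x => ?_
  set y : EuclideanSpace ℂ ι := WithLp.toLp 2 ((Matrix.gram ℂ v).mulVec x) with hy
  change ‖y‖ ≤ R * ‖x‖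
  have hs : ∀ u : EuclideanSpace ℂ ι, ‖∑ i, u i • v i‖ ≤ √R * ‖u‖ := by
    intro u
    have := hv u
    rw [← EuclideanSpace.norm_sq_eq] at this
    refine (pow_le_pow_iff_left₀ (norm_nonneg _) (by positivity) two_ne_zero).1 ?_
    rwa [mul_pow, Real.sq_sqrt hR]
  have h1 : ‖y‖ ^ 2 = ‖inner ℂ y y‖ := by
    rw [inner_self_eq_norm_sq_to_K]; simp
  have h2 : inner ℂ y y = inner ℂ (∑ i, y i • v i) (∑ i, x i • v i) := by
    rw [← Matrix.star_dotProduct_gram_mulVec, EuclideanSpace.inner_eq_star_dotProduct,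
      dotProduct_comm]
  have h3 : ‖y‖ ^ 2 ≤ (√R * ‖y‖) * (√R * ‖x‖) := by
    rw [h1, h2]
    exact (norm_inner_le_norm _ _).trans (mul_le_mul (hs y) (hs x) (norm_nonneg _) (by positivity))
  have h4 : ‖y‖ ^ 2 ≤ ‖y‖ * (R * ‖x‖) := by
    calc _ ≤ _ := h3
      _ = (√R * √R) * ‖y‖ * ‖x‖ := by ring
      _ = _ := by rw [Real.mul_self_sqrt hR]; ring
  rcases (norm_nonneg y).eq_or_lt with h0 | h0
  · rw [← h0]; positivity
  · rw [sq] at h4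
    exact le_of_mul_le_mul_left h4 h0

/-- Test the Bessel bound on the `k`-th eigenvector, whose synthesis `h k` has square norm `gramEig
v k`. -/
theorem gramEig_le {v : ι → H} {R : ℝ} (hv : IsBesselBound v R) (k : ι) : gramEig v k ≤ R := by
  obtain ⟨U, h, -, hUU', -, -, hhv, hh⟩ := exists_diagonalizing_family v
  have h1 := hv fun i => U i k
  have hcol : ∑ j, ‖U j k‖ ^ 2 = 1 := by
    have := congrFun (congrFun hUU' k) k
    rw [Matrix.mul_apply, Matrix.one_apply_eq] at this
    have h2 : ((∑ j, ‖U j k‖ ^ 2 : ℝ) : ℂ) = 1 := by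
      rw [← this]
      push_cast
      refine Finset.sum_congr rfl fun i _ => ?_
      rw [← Complex.mul_conj', Matrix.conjTranspose_apply, mul_comm]
      rfl
    exact_mod_cast h2
  have h3 : ((‖h k‖ ^ 2 : ℝ) : ℂ) = (gramEig v k : ℝ) := by
    push_cast
    rw [← inner_self_eq_ofReal_norm_sq, hh, if_pos rfl]
  rw [← hhv, hcol, mul_one] at h1
  rw [← Complex.ofReal_inj.1 h3]
  exact h1

/-- Cauchy–Schwarz for the Hilbert–Schmidt pairing; each column of `X` has norm at most `‖X‖`, so
its Hilbert–Schmidt norm costs a factor `√card`. -/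
theorem norm_trace_mul_le (X D : Matrix ι ι ℂ) :
    ‖(X * D).trace‖ ≤ √(Fintype.card ι) * ‖X‖ * √(∑ i, ∑ j, ‖D i j‖ ^ 2) := by
  have h1 : ‖(X * D).trace‖ ≤ ∑ p : ι × ι, ‖X p.2 p.1‖ * ‖D p.1 p.2‖ := by
    rw [Matrix.trace, Fintype.sum_prod_type_right]
    refine (norm_sum_le _ _).trans (Finset.sum_le_sum fun i _ => ?_)
    rw [Matrix.diag_apply, Matrix.mul_apply]
    refine (norm_sum_le _ _).trans (Finset.sum_le_sum fun j _ => ?_)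
    rw [norm_mul]
  have h2 := Real.sum_mul_le_sqrt_mul_sqrt Finset.univ (fun p : ι × ι => ‖X p.2 p.1‖)
    fun p => ‖D p.1 p.2‖
  refine h1.trans (h2.trans ?_)
  rw [Fintype.sum_prod_type (f := fun p : ι × ι => ‖D p.1 p.2‖ ^ 2)]
  gcongr
  have hcol : ∀ i, ∑ j, ‖X j i‖ ^ 2 ≤ ‖X‖ ^ 2 := by
    intro i
    have h3 := Matrix.l2_opNorm_mulVec X (EuclideanSpace.single i (1 : ℂ))
    rw [PiLp.norm_single, norm_one, mul_one] at h3
    have h4 : ‖(WithLp.toLp 2 (X.mulVec (EuclideanSpace.single i (1 : ℂ))) :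
        EuclideanSpace ℂ ι)‖ ^ 2 = ∑ j, ‖X j i‖ ^ 2 := by
      rw [EuclideanSpace.norm_sq_eq]
      simp
    rw [← h4]
    gcongr
    exact h3
  calc √(∑ p : ι × ι, ‖X p.2 p.1‖ ^ 2) ≤ √(Fintype.card ι * ‖X‖ ^ 2) := by
        apply Real.sqrt_le_sqrt
        rw [Fintype.sum_prod_type]
        refine (Finset.sum_le_sum fun i _ => hcol i).trans ?_
        simp
    _ = _ := by
        rw [Real.sqrt_mul (by positivity), Real.sqrt_sq (norm_nonneg _)]

/-- Telescoping of `A ^ k - B ^ k`. The free factor `X` makes the induction close: a trailing `B` is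
moved cyclically to the front and absorbed into it. -/
theorem norm_trace_mul_pow_sub_pow_le {A B : Matrix ι ι ℂ} {R : ℝ} (hA : ‖A‖ ≤ R) (hB : ‖B‖ ≤ R)
    (k : ℕ) (X : Matrix ι ι ℂ) :
    ‖(X * (A ^ k - B ^ k)).trace‖ ≤
      √(Fintype.card ι) * (‖X‖ * (k * R ^ (k - 1))) * √(∑ i, ∑ j, ‖(A - B) i j‖ ^ 2) := by
  have hR : 0 ≤ R := (norm_nonneg _).trans hA
  induction k generalizing X with
  | zero => simp
  | succ k ih =>
    set d := √(∑ i, ∑ j, ‖(A - B) i j‖ ^ 2)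
    set s := √(Fintype.card ι : ℝ)
    have hs : 0 ≤ s := Real.sqrt_nonneg _
    have hd : 0 ≤ d := Real.sqrt_nonneg _
    have e : X * (A ^ (k + 1) - B ^ (k + 1)) = X * A ^ k * (A - B) + X * (A ^ k - B ^ k) * B := by
      rw [pow_succ, pow_succ]
      noncomm_ring
    have e2 : (X * (A ^ k - B ^ k) * B).trace = (B * X * (A ^ k - B ^ k)).trace := by
      rw [Matrix.trace_mul_comm, Matrix.mul_assoc]
    rw [e, Matrix.trace_add, e2]
    refine (norm_add_le _ _).trans ?_
    have hAk : ‖X * A ^ k‖ ≤ ‖X‖ * R ^ k := by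
      clear ih e e2
      induction k with
      | zero => simp
      | succ k ih =>
        rw [pow_succ, ← mul_assoc, pow_succ, ← mul_assoc]
        exact (norm_mul_le _ _).trans (mul_le_mul ih hA (norm_nonneg _) (by positivity))
    have hBX : ‖B * X‖ ≤ R * ‖X‖ :=
      (norm_mul_le _ _).trans (mul_le_mul_of_nonneg_right hB (norm_nonneg _))
    have t1 := norm_trace_mul_le (X * A ^ k) (A - B)
    have t2 := ih (B * X)
    calc _ ≤ s * (‖X‖ * R ^ k) * d + s * (R * ‖X‖ * (k * R ^ (k - 1))) * d := by
          refine add_le_add (t1.trans ?_) (t2.trans ?_)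
          · gcongr
          · gcongr
      _ = s * (‖X‖ * (((k + 1 : ℕ) : ℝ) * R ^ (k + 1 - 1))) * d := by
          rcases k with _ | k
          · simp
          · simp only [Nat.add_sub_cancel]
            push_cast
            ring

/-- The two families may live in different spaces because only their Gram matrices are compared.
This is what allows a comparison with a decoupled family in a direct sum. -/
theorem abs_sum_gramEig_pow_sub_le {v : ι → H} {w : ι → H'} {R : ℝ} (hR : 0 ≤ R)
    (hv : IsBesselBound v R) (hw : IsBesselBound w R) (k : ℕ) :
    |∑ i, gramEig v i ^ k - ∑ i, gramEig w i ^ k| ≤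
      √(Fintype.card ι) * (k * R ^ (k - 1)) *
        √(∑ i, ∑ j, ‖inner ℂ (v i) (v j) - inner ℂ (w i) (w j)‖ ^ 2) := by
  rcases isEmpty_or_nonempty ι with h | h
  · simp
  have h1 := norm_trace_mul_pow_sub_pow_le (l2_opNorm_gram_le hR hv) (l2_opNorm_gram_le hR hw) k 1
  rw [one_mul, Matrix.trace_sub, trace_gram_pow, trace_gram_pow, norm_one, one_mul] at h1
  have h2 : (∑ i, (gramEig v i : ℂ) ^ k - ∑ i, (gramEig w i : ℂ) ^ k) =
      ((∑ i, gramEig v i ^ k - ∑ i, gramEig w i ^ k : ℝ) : ℂ) := by push_cast; rfl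
  rw [h2, Complex.norm_real, Real.norm_eq_abs] at h1
  exact h1

omit [DecidableEq ι] in
theorem sum_extend_zero {κ M : Type*} [Fintype κ] [AddCommMonoid M] {f : κ → ι}
    (hf : Function.Injective f) (x : κ → ℂ) (g : ι → ℂ → M) (hg : ∀ i, g i 0 = 0) :
    ∑ i, g i (Function.extend f x 0 i) = ∑ i, g (f i) (x i) := by
  have h1 : ∑ i, g (f i) (x i) =
      ∑ i ∈ Finset.univ.map ⟨f, hf⟩, g i (Function.extend f x 0 i) := by
    rw [Finset.sum_map]
    simp [hf.extend_apply]
  rw [h1]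
  refine (Finset.sum_subset (Finset.subset_univ _) fun i _ hi => ?_).symm
  rw [Function.extend_apply', Pi.zero_apply, hg]
  rintro ⟨a, ha⟩
  exact hi (by simp [← ha])

omit [DecidableEq ι] in
theorem IsBesselBound.comp {κ : Type*} [Fintype κ] {v : ι → H} {R : ℝ} (hv : IsBesselBound v R)
    {f : κ → ι} (hf : Function.Injective f) : IsBesselBound (v ∘ f) R := by
  intro x
  have h2 := hv (Function.extend f x 0)
  rwa [sum_extend_zero hf x (fun i c => c • v i) (by simp),
    sum_extend_zero hf x (fun i c => ‖c‖ ^ 2) (by simp)] at h2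

/-- Decoupling the blocks of a family indexed by a product. -/
theorem exists_blockFamily {β : Type*} [Fintype β] [DecidableEq β] (v : ι × β → H) {R : ℝ}
    (hv : IsBesselBound v R) :
    ∃ w : ι × β → PiLp 2 (fun _ : β => H), IsBesselBound w R ∧
      (∀ p q, inner ℂ (w p) (w q) = if p.2 = q.2 then inner ℂ (v p) (v q) else 0) ∧
      ∀ k : ℕ, ∑ p, gramEig w p ^ k = ∑ b, ∑ i, gramEig (fun i => v (i, b)) i ^ k := by
  have hin : ∀ p q : ι × β, inner ℂ (WithLp.toLp 2 (Pi.single p.2 (v p)) : PiLp 2 (fun _ : β => H))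
      (WithLp.toLp 2 (Pi.single q.2 (v q)) : PiLp 2 (fun _ : β => H)) =
      if p.2 = q.2 then inner ℂ (v p) (v q) else 0 := by
    intro p q
    rw [PiLp.inner_apply, Finset.sum_eq_single p.2]
    · simp only [Pi.single_eq_same]
      split_ifs with h
      · rw [h, Pi.single_eq_same]
      · rw [Pi.single_eq_of_ne h, inner_zero_right]
    · intro b _ hb
      simp [Pi.single_eq_of_ne hb]
    · simp
  -- Each block is placed in its own copy of `H`, so different blocks become orthogonal and the Gram
  -- matrix becomes block diagonal.
  refine ⟨fun p => WithLp.toLp 2 (Pi.single p.2 (v p)), ?_, hin, ?_⟩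
  · intro x
    rw [PiLp.norm_sq_eq_of_L2, Fintype.sum_prod_type_right (f := fun p => ‖x p‖ ^ 2), Finset.mul_sum]
    refine Finset.sum_le_sum fun b _ => ?_
    have h1 : (∑ p : ι × β, x p • (WithLp.toLp 2 (Pi.single p.2 (v p)) :
        PiLp 2 (fun _ : β => H))) b = ∑ i, x (i, b) • v (i, b) := by
      rw [WithLp.ofLp_sum, Finset.sum_apply, Fintype.sum_prod_type]
      refine Finset.sum_congr rfl fun i _ => ?_
      rw [Finset.sum_eq_single b]
      · simp
      · intro c _ hc
        simp [hc.symm]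
      · simp
    rw [h1]
    exact (hv.comp (f := fun i => (i, b)) (Prod.mk_left_injective b)) fun i => x (i, b)
  · intro k
    have hgram : Matrix.gram ℂ (fun p : ι × β => (WithLp.toLp 2 (Pi.single p.2 (v p)) :
        PiLp 2 (fun _ : β => H))) = Matrix.blockDiagonal fun b => Matrix.gram ℂ fun i => v (i, b) := by
      ext ⟨i, b⟩ ⟨j, c⟩
      rw [Matrix.gram_apply, hin, Matrix.blockDiagonal_apply]
      dsimp only
      split_ifs with h
      · subst h; rfl
      · rfl
    have h2 := trace_gram_pow (fun p : ι × β => (WithLp.toLp 2 (Pi.single p.2 (v p)) :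
        PiLp 2 (fun _ : β => H))) k
    rw [hgram, ← Matrix.blockDiagonal_pow, Matrix.trace_blockDiagonal] at h2
    simp only [Pi.pow_apply, trace_gram_pow] at h2
    exact_mod_cast h2.symm

end TraceComparison

end RankOneSum

namespace RankOneSum

/-! ### Bessel bounds, shift invariance and linear independence -/

section Admissible

variable {H : Type*} [NormedAddCommGroup H] [InnerProductSpace ℂ H] {ψ : ℤ → H}

theorem gramEntry_add (hψ : IsAdmissible ψ) (n m k : ℤ) :
    gramEntry ψ (n + k) (m + k) = gramEntry ψ n m := by
  induction k using Int.induction_on with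
  | zero => simp
  | succ k ih => rw [← add_assoc, ← add_assoc, hψ.shift, ih]
  | pred k ih => rw [← ih, ← hψ.shift]; congr 1 <;> ring

theorem inner_eq_gramEntry_sub (hψ : IsAdmissible ψ) (m n : ℤ) :
    inner ℂ (ψ m) (ψ n) = gramEntry ψ (n - m) 0 := by
  rw [← gramEntry_add hψ _ _ m, sub_add_cancel, zero_add]
  rfl

/-- The zeroth column of a bounded matrix is the image of a basis vector, hence in `ℓ²`. -/
theorem summable_sq_gramEntry (hψ : IsAdmissible ψ) :
    Summable fun n => ‖gramEntry ψ n 0‖ ^ 2 := by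
  obtain ⟨T, hT⟩ := hψ.bounded
  have h := lp.memℓp (T (lp.single 2 0 (1 : ℂ)))
  have h2 := h.summable (by norm_num)
  refine h2.congr fun n => ?_
  rw [hT]
  norm_num

/-- The vectors form a Bessel sequence. -/
theorem exists_norm_sq_sum_le (hψ : IsAdmissible ψ) :
    ∃ R : ℝ, 0 < R ∧ ∀ (s : Finset ℤ) (c : ℤ → ℂ),
      ‖∑ n ∈ s, c n • ψ n‖ ^ 2 ≤ R * ∑ n ∈ s, ‖c n‖ ^ 2 := by
  obtain ⟨T, hT⟩ := hψ.bounded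
  refine ⟨‖T‖ + 1, by positivity, fun s c => ?_⟩
  -- Conjugated coefficients, because `gramEntry` is linear in its first vector while `inner` is
  -- linear in its second; with them `inner ℂ w (T w)` is the square norm of the sum.
  set w : L2Z := ∑ n ∈ s, lp.single 2 n (starRingEnd ℂ (c n)) with hw
  have hwn : ‖w‖ ^ 2 = ∑ n ∈ s, ‖c n‖ ^ 2 := by
    have := lp.norm_sum_single (p := 2) (by norm_num) (fun n : ℤ => starRingEnd ℂ (c n)) s
    simpa using this
  have hTw : ∀ n, (T w) n = ∑ m ∈ s, starRingEnd ℂ (c m) * inner ℂ (ψ m) (ψ n) := by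
    intro n
    have h1 : w = ∑ m ∈ s, starRingEnd ℂ (c m) • lp.single 2 m (1 : ℂ) := by
      rw [hw]
      refine Finset.sum_congr rfl fun m _ => ?_
      rw [← lp.single_smul, smul_eq_mul, mul_one]
    rw [h1, map_sum, lp.coeFn_sum, Finset.sum_apply]
    refine Finset.sum_congr rfl fun m _ => ?_
    rw [map_smul, lp.coeFn_smul, Pi.smul_apply, hT, smul_eq_mul]
    rfl
  have key : ((‖∑ n ∈ s, c n • ψ n‖ ^ 2 : ℝ) : ℂ) = inner ℂ w (T w) := by
    push_cast
    rw [← inner_self_eq_ofReal_norm_sq, inner_sum]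
    have h3 : inner ℂ w (T w) =
        ∑ n ∈ s, inner ℂ (lp.single 2 n (starRingEnd ℂ (c n)) : L2Z) (T w) := by
      conv_lhs => rw [hw, sum_inner, ← hw]
    rw [h3]
    refine Finset.sum_congr rfl fun n _ => ?_
    rw [lp.inner_single_left, hTw, inner_smul_right, sum_inner]
    simp only [inner_smul_left, RCLike.inner_apply, RingHomCompTriple.comp_apply, RingHom.id_apply]
    rw [mul_comm]
  have h2 : ‖∑ n ∈ s, c n • ψ n‖ ^ 2 = ‖inner ℂ w (T w)‖ := by
    rw [← key, Complex.norm_real, Real.norm_eq_abs, abs_of_nonneg (by positivity)]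
  rw [h2, ← hwn]
  calc _ ≤ ‖w‖ * ‖T w‖ := norm_inner_le_norm _ _
    _ ≤ ‖w‖ * (‖T‖ * ‖w‖) := by gcongr; exact T.le_opNorm w
    _ ≤ _ := by nlinarith [sq_nonneg ‖w‖]

/-- The analysis map is adjoint to synthesis and inherits its bound: the sum `S` is an inner product
of a synthesised vector with `x`, so `S² ≤ R S ‖x‖²`. -/
theorem sum_norm_inner_sq_le {R : ℝ} (hR : 0 < R)
    (hb : ∀ (s : Finset ℤ) (c : ℤ → ℂ), ‖∑ n ∈ s, c n • ψ n‖ ^ 2 ≤ R * ∑ n ∈ s, ‖c n‖ ^ 2)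
    (s : Finset ℤ) (x : H) : ∑ n ∈ s, ‖inner ℂ (ψ n) x‖ ^ 2 ≤ R * ‖x‖ ^ 2 := by
  set S := ∑ n ∈ s, ‖inner ℂ (ψ n) x‖ ^ 2 with hS
  have hS0 : 0 ≤ S := Finset.sum_nonneg fun n _ => by positivity
  have h1 := hb s fun n => inner ℂ (ψ n) x
  have h2 : (S : ℂ) = inner ℂ (∑ n ∈ s, inner ℂ (ψ n) x • ψ n) x := by
    rw [sum_inner, hS]
    push_cast
    refine Finset.sum_congr rfl fun n _ => ?_
    rw [inner_smul_left, ← Complex.mul_conj', mul_comm]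
  have h3 : S ≤ ‖∑ n ∈ s, inner ℂ (ψ n) x • ψ n‖ * ‖x‖ := by
    have := norm_inner_le_norm (𝕜 := ℂ) (∑ n ∈ s, inner ℂ (ψ n) x • ψ n) x
    rwa [← h2, Complex.norm_real, Real.norm_eq_abs, abs_of_nonneg hS0] at this
  rcases hS0.eq_or_lt with h0 | h0
  · rw [← h0]; positivity
  · have h4 : S * S ≤ S * (R * ‖x‖ ^ 2) := by
      calc S * S ≤ (‖∑ n ∈ s, inner ℂ (ψ n) x • ψ n‖ * ‖x‖) *
            (‖∑ n ∈ s, inner ℂ (ψ n) x • ψ n‖ * ‖x‖) := mul_le_mul h3 h3 hS0 (by positivity)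
        _ = ‖∑ n ∈ s, inner ℂ (ψ n) x • ψ n‖ ^ 2 * ‖x‖ ^ 2 := by ring
        _ ≤ (R * S) * ‖x‖ ^ 2 := by gcongr
        _ = _ := by ring
    exact le_of_mul_le_mul_left h4 h0

theorem norm_sum_shift (hψ : IsAdmissible ψ) {ι : Type*} (s : Finset ι) (c : ι → ℂ) (f : ι → ℤ)
    (k : ℤ) : ‖∑ n ∈ s, c n • ψ (f n + k)‖ = ‖∑ n ∈ s, c n • ψ (f n)‖ := by
  have h : inner ℂ (∑ n ∈ s, c n • ψ (f n + k)) (∑ n ∈ s, c n • ψ (f n + k)) =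
      inner ℂ (∑ n ∈ s, c n • ψ (f n)) (∑ n ∈ s, c n • ψ (f n)) := by
    simp_rw [sum_inner, inner_sum, inner_smul_left, inner_smul_right, inner_eq_gramEntry_sub hψ]
    simp
  rw [inner_self_eq_ofReal_norm_sq, inner_self_eq_ofReal_norm_sq] at h
  have h' : ‖∑ n ∈ s, c n • ψ (f n + k)‖ ^ 2 = ‖∑ n ∈ s, c n • ψ (f n)‖ ^ 2 := by exact_mod_cast h
  exact (pow_left_inj₀ (norm_nonneg _) (norm_nonneg _) two_ne_zero).1 h'

/-- Sum `|⟨ψ_n, e_j⟩|²` over an orthonormal basis of `E` in both orders: Parseval gives `1` for each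
`n`, the Bessel bound at most `R` for each `j`. -/
theorem card_le_of_mem_finiteDimensional (hψ : IsAdmissible ψ) {R : ℝ} (hR : 0 < R)
    (hb : ∀ (s : Finset ℤ) (c : ℤ → ℂ), ‖∑ n ∈ s, c n • ψ n‖ ^ 2 ≤ R * ∑ n ∈ s, ‖c n‖ ^ 2)
    (E : Submodule ℂ H) [FiniteDimensional ℂ E] (s : Finset ℤ) (hs : ∀ n ∈ s, ψ n ∈ E) :
    (s.card : ℝ) ≤ R * Module.finrank ℂ E := by
  let e := stdOrthonormalBasis ℂ E
  have h1 : ∀ n ∈ s, ∑ j, ‖inner ℂ (ψ n) (e j : H)‖ ^ 2 = 1 := by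
    intro n hn
    have := e.sum_sq_norm_inner_left (⟨ψ n, hs n hn⟩ : E)
    simp only [Submodule.coe_inner] at this
    rw [this]
    change ‖ψ n‖ ^ 2 = 1
    rw [hψ.norm_eq_one, one_pow]
  calc (s.card : ℝ) = ∑ n ∈ s, ∑ j, ‖inner ℂ (ψ n) (e j : H)‖ ^ 2 := by
        rw [Finset.sum_congr rfl h1]; simp
    _ = ∑ j, ∑ n ∈ s, ‖inner ℂ (ψ n) (e j : H)‖ ^ 2 := Finset.sum_comm
    _ ≤ ∑ j, R * ‖(e j : H)‖ ^ 2 := Finset.sum_le_sum fun j _ => sum_norm_inner_sq_le hR hb s _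
    _ = _ := by
        have : ∀ j, ‖(e j : H)‖ = 1 := fun j => e.orthonormal.1 j
        simp [this, mul_comm]

/-- A linear relation can be translated. Solving its translates for the last vector puts all later
`ψ_n` into the span of finitely many, which contradicts the bound on the number of vectors in a
finite-dimensional subspace. -/
theorem IsAdmissible.linearIndependent (hψ : IsAdmissible ψ) : LinearIndependent ℂ ψ := by
  classical
  obtain ⟨R, hR, hb⟩ := exists_norm_sq_sum_le hψ
  rw [linearIndependent_iff']
  intro s c hc
  by_contra! hne
  obtain ⟨i₀, hi₀, hci₀⟩ := hne
  set t := s.filter fun i => c i ≠ 0 with ht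
  have htne : t.Nonempty := ⟨i₀, by simp [ht, hi₀, hci₀]⟩
  have hct : ∑ n ∈ t, c n • ψ n = 0 := by
    rw [← hc]
    refine Finset.sum_subset (Finset.filter_subset _ _) fun i hi hit => ?_
    have : c i = 0 := by
      by_contra h
      exact hit (by simp [ht, hi, h])
    rw [this, zero_smul]
  set a := t.min' htne
  set b := t.max' htne
  have hb' : c b ≠ 0 := (Finset.mem_filter.1 (t.max'_mem htne)).2
  set E := Submodule.span ℂ ((Finset.image ψ (Finset.Ico a b) : Finset H) : Set H) with hE
  have hmem : ∀ k : ℕ, ψ (a + k) ∈ E := by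
    intro k
    induction k using Nat.strong_induction_on with
    | _ k ih =>
      rcases lt_or_ge (a + k) b with hlt | hge
      · refine Submodule.subset_span ?_
        rw [Finset.coe_image]
        exact ⟨a + k, by simp [hlt], rfl⟩
      · have h0 : ∑ n ∈ t, c n • ψ (n + (a + k - b)) = 0 := by
          rw [← norm_eq_zero, norm_sum_shift hψ t c (fun n => n), hct, norm_zero]
        rw [← Finset.add_sum_erase _ _ (t.max'_mem htne)] at h0
        have h1 : c b • ψ (a + k) ∈ E := by
          have h2 := eq_neg_of_add_eq_zero_left h0
          rw [show t.max' htne + (a + k - b) = a + k by simp only [b]; ring] at h2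
          rw [h2]
          refine E.neg_mem (E.sum_mem fun n hn => E.smul_mem _ ?_)
          have hn1 : a ≤ n := t.min'_le n (Finset.mem_of_mem_erase hn)
          have hn2 : n < b := lt_of_le_of_ne (t.le_max' n (Finset.mem_of_mem_erase hn))
            (Finset.ne_of_mem_erase hn)
          have h3 := ih (n + (a + k - b) - a).toNat (by omega)
          rwa [show a + ((n + (a + k - b) - a).toNat : ℤ) = n + (a + k - b) by omega] at h3
        have := E.smul_mem (c b)⁻¹ h1
        rwa [inv_smul_smul₀ hb'] at this
  have : FiniteDimensional ℂ E := FiniteDimensional.span_finset ℂ _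
  obtain ⟨K, hK⟩ := exists_nat_gt (R * Module.finrank ℂ E)
  have h1 := card_le_of_mem_finiteDimensional hψ hR hb E
    ((Finset.range K).image fun k : ℕ => a + k) (by
      intro n hn
      obtain ⟨k, -, rfl⟩ := Finset.mem_image.1 hn
      exact hmem k)
  rw [Finset.card_image_of_injective _ (fun x y h => by simpa using h), Finset.card_range] at h1
  linarith

theorem isBesselBound_smul {R : ℝ} (hR : 0 < R)
    (hb : ∀ (s : Finset ℤ) (c : ℤ → ℂ), ‖∑ n ∈ s, c n • ψ n‖ ^ 2 ≤ R * ∑ n ∈ s, ‖c n‖ ^ 2)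
    {ι : Type*} [Fintype ι] {f : ι → ℤ} (hf : Function.Injective f) {a : ι → ℂ} {κ : ℝ}
    (ha : ∀ i, ‖a i‖ ^ 2 ≤ κ) : IsBesselBound (fun i => a i • ψ (f i)) (κ * R) := by
  classical
  intro x
  have h1 := hb (Finset.univ.map ⟨f, hf⟩) (Function.extend f (fun i => x i * a i) 0)
  rw [Finset.sum_map, Finset.sum_map] at h1
  simp only [Function.Embedding.coeFn_mk, hf.extend_apply, mul_smul, norm_mul, mul_pow] at h1
  refine h1.trans ?_
  rw [mul_comm κ R, mul_assoc]
  refine mul_le_mul_of_nonneg_left ?_ hR.le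
  rw [Finset.mul_sum]
  refine Finset.sum_le_sum fun i _ => ?_
  rw [mul_comm]
  exact mul_le_mul_of_nonneg_right (ha i) (by positivity)

end Admissible

end RankOneSum

namespace RankOneSum

/-! ### Decoupling the sites into blocks -/

section Blocks

variable {H : Type*} [NormedAddCommGroup H] [InnerProductSpace ℂ H] {ψ : ℤ → H}

/-- Integrals against the eigenvalue counting measure of `frameOp v`. -/
theorem integral_sum_finrank_frameOp {ι : Type*} [Fintype ι] [DecidableEq ι] (v : ι → H)
    (f : ℝ → ℝ) :
    ∫ x, f x ∂(Measure.sum fun x : {x : ℝ // x ≠ 0} =>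
      (Module.finrank ℂ
        (Module.End.eigenspace (frameOp v : H →ₗ[ℂ] H) ((x : ℝ) : ℂ)) : ℝ≥0∞) •
          Measure.dirac (x : ℝ)) =
      ∑ i, if gramEig v i = 0 then 0 else f (gramEig v i) := by
  rw [sum_finrank_dirac_frameOp, integral_finsetSum_measure]
  · refine Finset.sum_congr rfl fun i _ => ?_
    split_ifs
    · simp
    · rw [integral_dirac]
  · intro i _
    split_ifs
    · simp
    · exact integrable_dirac (by simp)

/-- The frame operator determines the non-zero Gram eigenvalues; the number of zero ones depends on
the index set but does not matter when `k ≠ 0`. -/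
theorem sum_gramEig_pow_eq_of_frameOp_eq {ι κ : Type*} [Fintype ι] [DecidableEq ι] [Fintype κ]
    [DecidableEq κ] {v : ι → H} {w : κ → H} (h : frameOp v = frameOp w) {k : ℕ} (hk : k ≠ 0) :
    ∑ i, gramEig v i ^ k = ∑ i, gramEig w i ^ k := by
  have h1 := integral_sum_finrank_frameOp v fun x => x ^ k
  have h2 := integral_sum_finrank_frameOp w fun x => x ^ k
  rw [← h] at h2
  have e : ∀ x : ℝ, (if x = 0 then 0 else x ^ k) = x ^ k := by
    intro x
    split_ifs with hx
    · rw [hx, zero_pow hk]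
    · rfl
  simp only [e] at h1 h2
  rw [← h1, ← h2]

/-- The vector `√ϰ_n ψ_n`. -/
noncomputable def weighted (ψ : ℤ → H) (ϰ : ℤ → ℝ) (n : ℤ) : H := ((√(ϰ n) : ℝ) : ℂ) • ψ n

theorem rankOne_weighted {ϰ : ℤ → ℝ} {n : ℤ} (h : 0 ≤ ϰ n) :
    InnerProductSpace.rankOne ℂ (weighted ψ ϰ n) (weighted ψ ϰ n) =
      (ϰ n : ℂ) • InnerProductSpace.rankOne ℂ (ψ n) (ψ n) := by
  have h2 : ((√(ϰ n) : ℝ) : ℂ) * ((√(ϰ n) : ℝ) : ℂ) = (ϰ n : ℂ) := by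
    rw [← Complex.ofReal_mul, Real.mul_self_sqrt h]
  ext x
  simp only [InnerProductSpace.rankOne_apply, smul_apply, weighted,
    inner_smul_left, smul_smul, Complex.conj_ofReal, ← h2]
  congr 1
  ring

theorem truncated_eq_frameOp {ϰ : ℤ → ℝ} (h : ∀ n, 0 ≤ ϰ n) (N : ℕ) :
    truncated ψ ϰ N = frameOp fun n : ↥(Finset.Icc (-(N : ℤ)) N) => weighted ψ ϰ n := by
  rw [truncated, frameOp, ← Finset.sum_coe_sort]
  exact Finset.sum_congr rfl fun n _ => (rankOne_weighted (h n)).symm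

theorem norm_inner_weighted_sq (hψ : IsAdmissible ψ) {ϰ : ℤ → ℝ} (h : ∀ n, 0 ≤ ϰ n) (m n : ℤ) :
    ‖inner ℂ (weighted ψ ϰ m) (weighted ψ ϰ n)‖ ^ 2 =
      ϰ m * ϰ n * ‖gramEntry ψ (n - m) 0‖ ^ 2 := by
  rw [weighted, weighted, inner_smul_left, inner_smul_right, inner_eq_gramEntry_sub hψ, norm_mul,
    norm_mul, Complex.conj_ofReal, Complex.norm_real, Complex.norm_real, Real.norm_of_nonneg
    (Real.sqrt_nonneg _), Real.norm_of_nonneg (Real.sqrt_nonneg _), mul_pow, mul_pow,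
    Real.sq_sqrt (h m), Real.sq_sqrt (h n), mul_assoc]

theorem norm_inner_weighted_sq_le (hψ : IsAdmissible ψ) {ϰ : ℤ → ℝ} {κ : ℝ} (h : ∀ n, 0 ≤ ϰ n)
    (hκ : ∀ n, ϰ n ≤ κ) (m n : ℤ) :
    ‖inner ℂ (weighted ψ ϰ m) (weighted ψ ϰ n)‖ ^ 2 ≤ κ ^ 2 * ‖gramEntry ψ (n - m) 0‖ ^ 2 := by
  rw [norm_inner_weighted_sq hψ h, sq κ]
  have := (h 0).trans (hκ 0)
  gcongr <;> apply_assumption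

theorem isBesselBound_weighted {R : ℝ} (hR : 0 < R)
    (hb : ∀ (s : Finset ℤ) (c : ℤ → ℂ), ‖∑ n ∈ s, c n • ψ n‖ ^ 2 ≤ R * ∑ n ∈ s, ‖c n‖ ^ 2)
    {ϰ : ℤ → ℝ} {κ : ℝ} (h : ∀ n, 0 ≤ ϰ n) (hκ : ∀ n, ϰ n ≤ κ)
    {ι : Type*} [Fintype ι] {f : ι → ℤ} (hf : Function.Injective f) :
    IsBesselBound (fun i => weighted ψ ϰ (f i)) (κ * R) := by
  refine isBesselBound_smul hR hb hf fun i => ?_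
  rw [Complex.norm_real, Real.norm_of_nonneg (Real.sqrt_nonneg _), Real.sq_sqrt (h _)]
  exact hκ _

/-- The tail of the square sum of the Gram entries. -/
noncomputable def gramTail (ψ : ℤ → H) (a : ℕ) : ℝ :=
  ∑' n : ℤ, if (a : ℤ) ≤ |n| then ‖gramEntry ψ n 0‖ ^ 2 else 0

theorem summable_gramTail (hψ : IsAdmissible ψ) (a : ℕ) :
    Summable fun n : ℤ => if (a : ℤ) ≤ |n| then ‖gramEntry ψ n 0‖ ^ 2 else 0 := by
  refine Summable.of_nonneg_of_le (fun n => ?_) (fun n => ?_) (summable_sq_gramEntry hψ)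
  · split_ifs <;> positivity
  · split_ifs
    · rfl
    · positivity

theorem gramTail_nonneg (a : ℕ) : 0 ≤ gramTail ψ a :=
  tsum_nonneg fun n => by split_ifs <;> positivity

theorem tendsto_gramTail (hψ : IsAdmissible ψ) : Tendsto (gramTail ψ) atTop (𝓝 0) := by
  have h := tendsto_tsum_of_dominated_convergence (𝓕 := (atTop : Filter ℕ))
    (f := fun (a : ℕ) (n : ℤ) => if (a : ℤ) ≤ |n| then ‖gramEntry ψ n 0‖ ^ 2 else 0)
    (g := fun _ => (0 : ℝ)) (summable_sq_gramEntry hψ) ?_ ?_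
  · rw [tsum_zero] at h
    exact h
  · intro n
    refine tendsto_const_nhds.congr' ?_
    filter_upwards [eventually_gt_atTop n.natAbs] with a ha
    rw [if_neg]
    rw [Int.abs_eq_natAbs]
    omega
  · refine Eventually.of_forall fun a n => ?_
    split_ifs
    · rw [Real.norm_of_nonneg (by positivity)]
    · rw [norm_zero]; positivity

theorem sum_le_gramTail (hψ : IsAdmissible ψ) {ι : Type*} [Fintype ι] {f : ι → ℤ}
    (hf : Function.Injective f) (a : ℕ) :
    ∑ i, (if (a : ℤ) ≤ |f i| then ‖gramEntry ψ (f i) 0‖ ^ 2 else 0) ≤ gramTail ψ a := by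
  have := (summable_gramTail hψ a).sum_le_tsum (Finset.univ.map ⟨f, hf⟩)
    (fun n _ => by split_ifs <;> positivity)
  rwa [Finset.sum_map] at this

/-- The site in position `p.1` of the block `p.2`. -/
def site {L : ℕ} {m : ℕ} (p : Fin L × ↥(Finset.Ico (-(m : ℤ)) m)) : ℤ := p.2 * L + (p.1 : ℕ)

theorem site_injective {L m : ℕ} :
    Function.Injective (site : Fin L × ↥(Finset.Ico (-(m : ℤ)) m) → ℤ) := by
  rintro ⟨i, b, hb⟩ ⟨j, c, hc⟩ h
  simp only [site] at h
  have hi : ((i : ℕ) : ℤ) < L := by exact_mod_cast i.2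
  have hj : ((j : ℕ) : ℤ) < L := by exact_mod_cast j.2
  have hbc : b = c := by
    rcases lt_trichotomy b c with hlt | heq | hgt
    · nlinarith
    · exact heq
    · nlinarith
  subst hbc
  have hij : i = j := Fin.ext (by omega)
  subst hij
  rfl

theorem site_mem {L m : ℕ} (p : Fin L × ↥(Finset.Ico (-(m : ℤ)) m)) :
    site p ∈ Finset.Ico (-((m * L : ℕ) : ℤ)) (m * L : ℕ) := by
  obtain ⟨i, b, hb⟩ := p
  rw [Finset.mem_Ico] at hb ⊢
  have hi : ((i : ℕ) : ℤ) < L := by exact_mod_cast i.2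
  simp only [site]
  push_cast
  constructor <;> nlinarith

theorem exists_site_eq {L m : ℕ} (hL : 0 < L) {n : ℤ} (hn : -((m * L : ℕ) : ℤ) ≤ n)
    (hn' : n < (m * L : ℕ)) : ∃ p : Fin L × ↥(Finset.Ico (-(m : ℤ)) m), site p = n := by
  have hL' : (0 : ℤ) < L := by exact_mod_cast hL
  push_cast at hn hn'
  have h1 := Int.emod_nonneg n hL'.ne'
  have h2 := Int.emod_lt_of_pos n hL'
  have h3 := Int.mul_ediv_add_emod n L
  refine ⟨(⟨(n % L).toNat, by omega⟩, ⟨n / L, ?_⟩), ?_⟩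
  · rw [Finset.mem_Ico]
    constructor
    · rw [Int.le_ediv_iff_mul_le hL']; linarith
    · exact Int.ediv_lt_of_lt_mul hL' hn'
  · simp only [site]
    rw [Int.toNat_of_nonneg h1, mul_comm]
    exact h3

/-- The blocks overshoot the interval by at most `L` sites on either side. -/
theorem card_site_not_mem_le {L m N : ℕ} (hm' : m * L ≤ N + L) :
    ((Finset.univ.filter fun p : Fin L × ↥(Finset.Ico (-(m : ℤ)) m) =>
      site p ∉ Finset.Icc (-(N : ℤ)) N).card : ℝ) ≤ 2 * L := by
  have h1 : (Finset.univ.filter fun p : Fin L × ↥(Finset.Ico (-(m : ℤ)) m) =>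
      site p ∉ Finset.Icc (-(N : ℤ)) N).card ≤
      (Finset.Ico (-((N + L : ℕ) : ℤ)) (-N) ∪ Finset.Ico ((N : ℤ) + 1) (N + 1 + L)).card := by
    refine Finset.card_le_card_of_injOn site ?_ site_injective.injOn
    intro p hp
    have h2 := site_mem p
    simp only [Finset.coe_filter, Finset.mem_univ, true_and, Set.mem_ofPred_eq, Finset.mem_Icc,
      Finset.mem_Ico, Finset.coe_union, Finset.coe_Ico, Set.mem_union, Set.mem_Ico] at hp h2 ⊢
    have h3 : ((m * L : ℕ) : ℤ) ≤ ((N + L : ℕ) : ℤ) := by exact_mod_cast hm'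
    push_cast at *
    omega
  have h2 := h1.trans (Finset.card_union_le _ _)
  rw [Int.card_Ico, Int.card_Ico] at h2
  have h3 : (Finset.univ.filter fun p : Fin L × ↥(Finset.Ico (-(m : ℤ)) m) =>
      site p ∉ Finset.Icc (-(N : ℤ)) N).card ≤ 2 * L := by omega
  exact_mod_cast h3

/-- The contribution of a block of length `L` to the trace of the `k`-th power. -/
noncomputable def blockTrace (ψ : ℤ → H) (L k : ℕ) (ϰ : ℤ → ℝ) (b : ℤ) : ℝ :=
  ∑ i, gramEig (fun i : Fin L => weighted ψ ϰ (b * L + (i : ℕ))) i ^ k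

/-- The weighted family on the blocks, cut off outside `[-N, N]`. -/
noncomputable def cutoff (ψ : ℤ → H) (ϰ : ℤ → ℝ) (N L m : ℕ)
    (p : Fin L × ↥(Finset.Ico (-(m : ℤ)) m)) : H :=
  if site p ∈ Finset.Icc (-(N : ℤ)) N then weighted ψ ϰ (site p) else 0

/-- Zero vectors do not change a frame operator, so the interval may be padded to a union of
complete blocks. -/
theorem frameOp_cutoff (ψ : ℤ → H) (ϰ : ℤ → ℝ) {N L m : ℕ} (hL : 0 < L) (hm : N < m * L) :
    frameOp (cutoff ψ ϰ N L m) =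
      frameOp fun n : ↥(Finset.Icc (-(N : ℤ)) N) => weighted ψ ϰ n := by
  have h1 : frameOp (cutoff ψ ϰ N L m) =
      ∑ p ∈ Finset.univ.filter fun p : Fin L × ↥(Finset.Ico (-(m : ℤ)) m) =>
        site p ∈ Finset.Icc (-(N : ℤ)) N,
        InnerProductSpace.rankOne ℂ (weighted ψ ϰ (site p)) (weighted ψ ϰ (site p)) := by
    rw [frameOp, Finset.sum_filter]
    refine Finset.sum_congr rfl fun p _ => ?_
    unfold cutoff
    split_ifs
    · rfl
    · simp
  rw [h1, frameOp, Finset.sum_coe_sort (Finset.Icc (-(N : ℤ)) N) fun n =>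
    InnerProductSpace.rankOne ℂ (weighted ψ ϰ n) (weighted ψ ϰ n)]
  refine Finset.sum_nbij site (fun p hp => (Finset.mem_filter.1 hp).2) site_injective.injOn ?_
    fun _ _ => rfl
  intro n hn
  have hn' := Finset.mem_Icc.1 hn
  have hm2 : (N : ℤ) < (m * L : ℕ) := by exact_mod_cast hm
  obtain ⟨p, hp⟩ := exists_site_eq (m := m) (n := n) hL (by omega) (by omega)
  exact ⟨p, by simpa [hp] using hn', hp⟩

/-- A site at position `i` of its block is at distance at least `i + 1` from earlier blocks and at
least `L - i` from later ones, so its row of deleted entries is controlled by two tails. Since tails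
tend to zero, their sum over a block is `o(L)`. -/
theorem sum_norm_inner_sub_block_le (hψ : IsAdmissible ψ) {ϰ : ℤ → ℝ} {κ : ℝ} (h : ∀ n, 0 ≤ ϰ n)
    (hκ : ∀ n, ϰ n ≤ κ) (L m : ℕ) :
    ∑ p : Fin L × ↥(Finset.Ico (-(m : ℤ)) m), ∑ q : Fin L × ↥(Finset.Ico (-(m : ℤ)) m),
      ‖inner ℂ (weighted ψ ϰ (site p)) (weighted ψ ϰ (site q)) -
        (if p.2 = q.2 then inner ℂ (weighted ψ ϰ (site p)) (weighted ψ ϰ (site q)) else 0)‖ ^ 2 ≤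
      2 * m * (κ ^ 2 * (2 * ∑ i ∈ Finset.range L, gramTail ψ (i + 1))) := by
  have hp : ∀ p : Fin L × ↥(Finset.Ico (-(m : ℤ)) m), ∑ q : Fin L × ↥(Finset.Ico (-(m : ℤ)) m),
      ‖inner ℂ (weighted ψ ϰ (site p)) (weighted ψ ϰ (site q)) -
        (if p.2 = q.2 then inner ℂ (weighted ψ ϰ (site p)) (weighted ψ ϰ (site q)) else 0)‖ ^ 2 ≤
      κ ^ 2 * (gramTail ψ ((p.1 : ℕ) + 1) + gramTail ψ (L - (p.1 : ℕ))) := by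
    intro p
    have hinj : Function.Injective fun q : Fin L × ↥(Finset.Ico (-(m : ℤ)) m) =>
        site q - site p := fun q q' hq => site_injective (by simpa using hq)
    calc _ ≤ ∑ q : Fin L × ↥(Finset.Ico (-(m : ℤ)) m), κ ^ 2 *
          ((if (((p.1 : ℕ) + 1 : ℕ) : ℤ) ≤ |site q - site p| then
            ‖gramEntry ψ (site q - site p) 0‖ ^ 2 else 0) +
          (if ((L - (p.1 : ℕ) : ℕ) : ℤ) ≤ |site q - site p| then
            ‖gramEntry ψ (site q - site p) 0‖ ^ 2 else 0)) := by
          refine Finset.sum_le_sum fun q _ => ?_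
          have hnn : ∀ P : Prop, [Decidable P] → 0 ≤ (if P then
            ‖gramEntry ψ (site q - site p) 0‖ ^ 2 else 0) := by
            intro P _
            split_ifs <;> positivity
          by_cases hpq : p.2 = q.2
          · rw [if_pos hpq, sub_self, norm_zero]
            have h1 := hnn ((((p.1 : ℕ) + 1 : ℕ) : ℤ) ≤ |site q - site p|)
            have h2 := hnn (((L - (p.1 : ℕ) : ℕ) : ℤ) ≤ |site q - site p|)
            rw [zero_pow two_ne_zero]
            exact mul_nonneg (sq_nonneg _) (add_nonneg h1 h2)
          · rw [if_neg hpq, sub_zero]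
            refine (norm_inner_weighted_sq_le hψ h hκ _ _).trans ?_
            refine mul_le_mul_of_nonneg_left ?_ (sq_nonneg _)
            have hi := p.1.2
            have hj := q.1.2
            rcases lt_or_gt_of_ne fun h0 => hpq (Subtype.ext h0) with hlt | hgt
            · have hd : ((L - (p.1 : ℕ) : ℕ) : ℤ) ≤ |site q - site p| := by
                refine le_trans ?_ (le_abs_self _)
                simp only [site]
                have : (p.2 : ℤ) * L + L ≤ q.2 * L := by nlinarith
                omega
              rw [if_pos hd]
              linarith [hnn ((((p.1 : ℕ) + 1 : ℕ) : ℤ) ≤ |site q - site p|)]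
            · have hd : (((p.1 : ℕ) + 1 : ℕ) : ℤ) ≤ |site q - site p| := by
                refine le_trans ?_ (neg_le_abs _)
                simp only [site]
                have : (q.2 : ℤ) * L + L ≤ p.2 * L := by nlinarith
                omega
              rw [if_pos hd]
              linarith [hnn (((L - (p.1 : ℕ) : ℕ) : ℤ) ≤ |site q - site p|)]
      _ ≤ _ := by
          rw [← Finset.mul_sum, Finset.sum_add_distrib]
          exact mul_le_mul_of_nonneg_left (add_le_add (sum_le_gramTail hψ hinj _)
            (sum_le_gramTail hψ hinj _)) (sq_nonneg _)
  refine (Finset.sum_le_sum fun p _ => hp p).trans (le_of_eq ?_)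
  rw [Fintype.sum_prod_type_right]
  simp only [Finset.sum_const, Finset.card_univ, Fintype.card_coe, Int.card_Ico]
  rw [nsmul_eq_mul, ← Finset.mul_sum, Finset.sum_add_distrib,
    Fin.sum_univ_eq_sum_range (fun i => gramTail ψ (i + 1)),
    Fin.sum_univ_eq_sum_range (fun i => gramTail ψ (L - i)),
    ← Finset.sum_range_reflect (fun i => gramTail ψ (L - i))]
  have e : ∑ j ∈ Finset.range L, gramTail ψ (L - (L - 1 - j)) =
      ∑ j ∈ Finset.range L, gramTail ψ (j + 1) := by
    refine Finset.sum_congr rfl fun j hj => ?_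
    rw [Finset.mem_range] at hj
    congr 1
    omega
  rw [e, show ((m : ℤ) - -m).toNat = 2 * m by omega]
  push_cast
  ring

/-- Only rows and columns of the at most `2 L` cut-off sites change, and each has bounded square
sum; the bound does not grow with `N`. -/
theorem sum_norm_inner_cutoff_sub_le (hψ : IsAdmissible ψ) {ϰ : ℤ → ℝ} {κ : ℝ}
    (h : ∀ n, 0 ≤ ϰ n) (hκ : ∀ n, ϰ n ≤ κ) {N L m : ℕ} (hm' : m * L ≤ N + L) :
    ∑ p : Fin L × ↥(Finset.Ico (-(m : ℤ)) m), ∑ q : Fin L × ↥(Finset.Ico (-(m : ℤ)) m),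
      ‖inner ℂ (cutoff ψ ϰ N L m p) (cutoff ψ ϰ N L m q) -
        inner ℂ (weighted ψ ϰ (site p)) (weighted ψ ϰ (site q))‖ ^ 2 ≤
      4 * L * (κ ^ 2 * gramTail ψ 0) := by
  set c : Fin L × ↥(Finset.Ico (-(m : ℤ)) m) → ℝ := fun p =>
    if site p ∉ Finset.Icc (-(N : ℤ)) N then 1 else 0 with hc
  set g : Fin L × ↥(Finset.Ico (-(m : ℤ)) m) → Fin L × ↥(Finset.Ico (-(m : ℤ)) m) → ℝ :=
    fun p q => κ ^ 2 * ‖gramEntry ψ (site q - site p) 0‖ ^ 2 with hg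
  have hg0 : ∀ p q, 0 ≤ g p q := fun p q => by positivity
  have hcsum : ∑ p, c p ≤ 2 * L := by
    rw [hc, Finset.sum_boole]
    exact card_site_not_mem_le hm'
  have hc0 : ∀ p, 0 ≤ c p := fun p => by simp only [hc]; split_ifs <;> norm_num
  have hterm : ∀ p q, ‖inner ℂ (cutoff ψ ϰ N L m p) (cutoff ψ ϰ N L m q) -
        inner ℂ (weighted ψ ϰ (site p)) (weighted ψ ϰ (site q))‖ ^ 2 ≤
      c p * g p q + c q * g p q := by
    intro p q
    have h1 := norm_inner_weighted_sq_le hψ h hκ (site p) (site q)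
    have h2 := hg0 p q
    by_cases hpN : site p ∈ Finset.Icc (-(N : ℤ)) N <;>
    by_cases hqN : site q ∈ Finset.Icc (-(N : ℤ)) N <;>
    simp only [cutoff, hc, if_pos, hpN, hqN, if_false, not_true_eq_false, not_false_eq_true,
      inner_zero_left, inner_zero_right, zero_sub, norm_neg, sub_self, norm_zero, zero_mul,
      one_mul, add_zero, zero_add] <;>
    simp only [hg] at * <;> linarith
  have hrow : ∀ p, ∑ q, g p q ≤ κ ^ 2 * gramTail ψ 0 := by
    intro p
    rw [hg, ← Finset.mul_sum]
    refine mul_le_mul_of_nonneg_left ?_ (sq_nonneg _)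
    have := sum_le_gramTail hψ (f := fun q : Fin L × ↥(Finset.Ico (-(m : ℤ)) m) =>
        site q - site p) (fun q q' hq => site_injective (by simpa using hq)) 0
    simpa using this
  have hcol : ∀ q, ∑ p, g p q ≤ κ ^ 2 * gramTail ψ 0 := by
    intro p
    rw [hg, ← Finset.mul_sum]
    refine mul_le_mul_of_nonneg_left ?_ (sq_nonneg _)
    have := sum_le_gramTail hψ (f := fun q : Fin L × ↥(Finset.Ico (-(m : ℤ)) m) =>
        site p - site q) (fun q q' hq => site_injective (by simpa using hq)) 0
    simpa using this
  have hT : 0 ≤ κ ^ 2 * gramTail ψ 0 := mul_nonneg (sq_nonneg _) (gramTail_nonneg 0)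
  calc _ ≤ ∑ p, ∑ q, (c p * g p q + c q * g p q) :=
        Finset.sum_le_sum fun p _ => Finset.sum_le_sum fun q _ => hterm p q
    _ = ∑ p, c p * ∑ q, g p q + ∑ q, c q * ∑ p, g p q := by
        simp_rw [Finset.sum_add_distrib, Finset.mul_sum]
        congr 1
        rw [Finset.sum_comm]
    _ ≤ ∑ p, c p * (κ ^ 2 * gramTail ψ 0) + ∑ q, c q * (κ ^ 2 * gramTail ψ 0) := by
        exact add_le_add
          (Finset.sum_le_sum fun p _ => mul_le_mul_of_nonneg_left (hrow p) (hc0 p))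
          (Finset.sum_le_sum fun q _ => mul_le_mul_of_nonneg_left (hcol q) (hc0 q))
    _ = 2 * ((∑ p, c p) * (κ ^ 2 * gramTail ψ 0)) := by rw [Finset.sum_mul]; ring
    _ ≤ 2 * ((2 * L) * (κ ^ 2 * gramTail ψ 0)) := by gcongr
    _ = _ := by ring

/-- Comparison of the traces of the truncated operator with sums over blocks. -/
theorem abs_sum_gramEig_pow_sub_blockTrace_le (hψ : IsAdmissible ψ) {R : ℝ} (hR : 0 < R)
    (hb : ∀ (s : Finset ℤ) (c : ℤ → ℂ), ‖∑ n ∈ s, c n • ψ n‖ ^ 2 ≤ R * ∑ n ∈ s, ‖c n‖ ^ 2)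
    {ϰ : ℤ → ℝ} {κ : ℝ} (h : ∀ n, 0 ≤ ϰ n) (hκ : ∀ n, ϰ n ≤ κ) {N L m k : ℕ} (hL : 0 < L)
    (hk : k ≠ 0) (hm : N < m * L) (hm' : m * L ≤ N + L) :
    |∑ n, gramEig (fun n : ↥(Finset.Icc (-(N : ℤ)) N) => weighted ψ ϰ n) n ^ k -
      ∑ b ∈ Finset.Ico (-(m : ℤ)) m, blockTrace ψ L k ϰ b| ≤
      √(2 * m * L) * (k * (κ * R) ^ (k - 1)) *
        (√(4 * L * (κ ^ 2 * gramTail ψ 0)) +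
          √(2 * m * (κ ^ 2 * (2 * ∑ i ∈ Finset.range L, gramTail ψ (i + 1))))) := by
  have hκ0 : 0 ≤ κ := (h 0).trans (hκ 0)
  have hv : IsBesselBound (fun p : Fin L × ↥(Finset.Ico (-(m : ℤ)) m) => weighted ψ ϰ (site p))
      (κ * R) := isBesselBound_weighted hR hb h hκ site_injective
  have hcut : IsBesselBound (cutoff ψ ϰ N L m) (κ * R) := by
    have e : cutoff ψ ϰ N L m = fun p => (if site p ∈ Finset.Icc (-(N : ℤ)) N then
        ((√(ϰ (site p)) : ℝ) : ℂ) else 0) • ψ (site p) := by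
      ext p
      simp only [cutoff, weighted]
      split_ifs <;> simp
    rw [e]
    refine isBesselBound_smul hR hb site_injective fun p => ?_
    split_ifs
    · rw [Complex.norm_real, Real.norm_of_nonneg (Real.sqrt_nonneg _), Real.sq_sqrt (h _)]
      exact hκ _
    · simpa using hκ0
  obtain ⟨w, hw, hwin, hwk⟩ := exists_blockFamily _ hv
  -- Two comparisons: cut-off family with complete blocks, then complete blocks with decoupled ones.
  have h1 := abs_sum_gramEig_pow_sub_le (by positivity) hcut hv k
  have h2 := abs_sum_gramEig_pow_sub_le (by positivity) hv hw k
  rw [sum_gramEig_pow_eq_of_frameOp_eq (frameOp_cutoff ψ ϰ hL hm) hk] at h1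
  rw [hwk] at h2
  have e : ∑ b : ↥(Finset.Ico (-(m : ℤ)) m), ∑ i, gramEig (fun i : Fin L =>
      weighted ψ ϰ (site (i, b))) i ^ k = ∑ b ∈ Finset.Ico (-(m : ℤ)) m, blockTrace ψ L k ϰ b := by
    rw [← Finset.sum_coe_sort (Finset.Ico (-(m : ℤ)) m) (blockTrace ψ L k ϰ)]
    rfl
  rw [e] at h2
  simp_rw [hwin] at h2
  have hcard : (Fintype.card (Fin L × ↥(Finset.Ico (-(m : ℤ)) m)) : ℝ) = 2 * m * L := by
    rw [Fintype.card_prod, Fintype.card_fin, Fintype.card_coe, Int.card_Ico,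
      show ((m : ℤ) - -m).toNat = 2 * m by omega]
    push_cast
    ring
  rw [hcard] at h1 h2
  refine (abs_sub_le _ _ _).trans ((add_le_add h1 h2).trans ?_)
  rw [← mul_add]
  refine mul_le_mul_of_nonneg_left (add_le_add ?_ ?_) (by positivity)
  · exact Real.sqrt_le_sqrt (sum_norm_inner_cutoff_sub_le hψ h hκ hm')
  · exact Real.sqrt_le_sqrt (sum_norm_inner_sub_block_le hψ h hκ L m)

end Blocks

end RankOneSum

namespace RankOneSum

open ProbabilityTheory

/-! ### Almost sure convergence of the moments -/

section Moments

variable {H : Type*} [NormedAddCommGroup H] [InnerProductSpace ℂ H] {ψ : ℤ → H}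

/-- `blockTrace` as a function of the variables in the block. -/
noncomputable def blockFun (ψ : ℤ → H) (L k : ℕ) (y : Fin L → ℝ) : ℝ :=
  ((Matrix.of fun i j : Fin L => ((√(y i) : ℝ) : ℂ) * ((√(y j) : ℝ) : ℂ) *
    gramEntry ψ ((j : ℕ) - (i : ℕ) : ℤ) 0) ^ k).trace.re

/-- Writing the block trace as a matrix trace rather than through eigenvalues makes its
measurability immediate. -/
theorem continuous_blockFun (ψ : ℤ → H) (L k : ℕ) : Continuous (blockFun ψ L k) := by
  unfold blockFun
  refine Complex.continuous_re.comp (Continuous.matrix_trace (Continuous.pow ?_ k))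
  refine continuous_matrix fun i j => ?_
  simp only [Matrix.of_apply]
  fun_prop

theorem blockTrace_eq (hψ : IsAdmissible ψ) (L k : ℕ) (ϰ : ℤ → ℝ) (b : ℤ) :
    blockTrace ψ L k ϰ b = blockFun ψ L k fun i => ϰ (b * L + (i : ℕ)) := by
  have h1 := trace_gram_pow (fun i : Fin L => weighted ψ ϰ (b * L + (i : ℕ))) k
  have h2 : Matrix.gram ℂ (fun i : Fin L => weighted ψ ϰ (b * L + (i : ℕ))) =
      Matrix.of fun i j : Fin L => ((√(ϰ (b * L + (i : ℕ))) : ℝ) : ℂ) *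
        ((√(ϰ (b * L + (j : ℕ))) : ℝ) : ℂ) * gramEntry ψ ((j : ℕ) - (i : ℕ) : ℤ) 0 := by
    ext i j
    rw [Matrix.gram_apply, weighted, weighted, inner_smul_left, inner_smul_right,
      inner_eq_gramEntry_sub hψ, Complex.conj_ofReal, Matrix.of_apply, mul_assoc,
      add_sub_add_left_eq_sub]
  rw [blockFun, ← h2, h1, blockTrace]
  have h3 : (∑ i, (gramEig (fun i : Fin L => weighted ψ ϰ (b * L + (i : ℕ))) i : ℂ) ^ k) =
      ((∑ i, gramEig (fun i : Fin L => weighted ψ ϰ (b * L + (i : ℕ))) i ^ k : ℝ) : ℂ) := by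
    push_cast; rfl
  rw [h3, Complex.ofReal_re]

theorem block_injective {L : ℕ} (b : ℤ) :
    Function.Injective fun i : Fin L => b * L + ((i : ℕ) : ℤ) := by
  intro i j h
  have : ((i : ℕ) : ℤ) = (j : ℕ) := by simpa using h
  exact Fin.ext (by exact_mod_cast this)

theorem block_disjoint {L : ℕ} {b c : ℤ} (hbc : b ≠ c) (i j : Fin L) :
    b * L + ((i : ℕ) : ℤ) ≠ c * L + ((j : ℕ) : ℤ) := by
  intro h
  have hi : ((i : ℕ) : ℤ) < L := by exact_mod_cast i.2
  have hj : ((j : ℕ) : ℤ) < L := by exact_mod_cast j.2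
  rcases lt_or_gt_of_ne hbc with hlt | hgt <;> nlinarith

variable (P₀ : Measure ℝ) [IsProbabilityMeasure P₀]

theorem ae_infinitePi_forall {p : ℝ → Prop} (hp : ∀ᵐ x ∂P₀, p x) :
    ∀ᵐ ϰ ∂(Measure.infinitePi fun _ : ℤ => P₀), ∀ n, p (ϰ n) :=
  ae_all_iff.2 fun n =>
    (measurePreserving_eval_infinitePi (fun _ : ℤ => P₀) n).quasiMeasurePreserving.ae hp

theorem abs_blockTrace_le {R : ℝ} (hR : 0 < R)
    (hb : ∀ (s : Finset ℤ) (c : ℤ → ℂ), ‖∑ n ∈ s, c n • ψ n‖ ^ 2 ≤ R * ∑ n ∈ s, ‖c n‖ ^ 2)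
    {ϰ : ℤ → ℝ} {κ : ℝ} (h : ∀ n, 0 ≤ ϰ n) (hκ : ∀ n, ϰ n ≤ κ) (L k : ℕ) (b : ℤ) :
    |blockTrace ψ L k ϰ b| ≤ L * (κ * R) ^ k := by
  refine (Finset.abs_sum_le_sum_abs _ _).trans ?_
  calc _ ≤ ∑ _i : Fin L, (κ * R) ^ k := by
        refine Finset.sum_le_sum fun i _ => ?_
        rw [abs_pow, abs_of_nonneg (gramEig_nonneg _ _)]
        exact pow_le_pow_left₀ (gramEig_nonneg _ _)
          (gramEig_le (isBesselBound_weighted hR hb h hκ (block_injective b)) i) k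
    _ = _ := by simp

/-- Distinct blocks read disjoint coordinates, and shift invariance makes every block trace the same
function of its variables: the strong law applies to any enumeration of distinct blocks. -/
theorem ae_tendsto_sum_blockTrace (hψ : IsAdmissible ψ) {κ : ℝ}
    (hP : ∀ᵐ x ∂P₀, 0 ≤ x ∧ x ≤ κ) (L k : ℕ) {e : ℕ → ℤ} (he : Function.Injective e) :
    ∀ᵐ ϰ ∂(Measure.infinitePi fun _ : ℤ => P₀),
      Tendsto (fun m : ℕ => (∑ j ∈ Finset.range m, blockTrace ψ L k ϰ (e j)) / m) atTop
        (𝓝 (∫ y, blockFun ψ L k y ∂(Measure.infinitePi fun _ : Fin L => P₀))) := by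
  obtain ⟨R, hR, hb⟩ := exists_norm_sq_sum_le hψ
  set μ := Measure.infinitePi fun _ : ℤ => P₀ with hμ
  have hmB : ∀ b : ℤ, Measurable fun (ϰ : ℤ → ℝ) (i : Fin L) => ϰ (b * L + (i : ℕ)) :=
    fun b => by fun_prop
  have hX : ∀ b, (fun ϰ => blockTrace ψ L k ϰ b) =
      blockFun ψ L k ∘ fun (ϰ : ℤ → ℝ) (i : Fin L) => ϰ (b * L + (i : ℕ)) :=
    fun b => funext fun ϰ => blockTrace_eq hψ L k ϰ b
  have hF := (continuous_blockFun ψ L k).measurable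
  have hXm : ∀ b, Measurable fun ϰ => blockTrace ψ L k ϰ b := fun b => by
    rw [hX]; exact hF.comp (hmB b)
  have hlaw : ∀ b : ℤ, μ.map (fun (ϰ : ℤ → ℝ) (i : Fin L) => ϰ (b * L + (i : ℕ))) =
      Measure.infinitePi fun _ : Fin L => P₀ := fun b =>
    Measure.map_infinitePi_infinitePi_of_inj (P := fun _ : ℤ => P₀) (block_injective (L := L) b)
  have hint : Integrable (fun ϰ => blockTrace ψ L k ϰ (e 0)) μ := by
    refine Integrable.of_bound (hXm _).aestronglyMeasurable (L * (κ * R) ^ k) ?_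
    filter_upwards [ae_infinitePi_forall P₀ hP] with ϰ hϰ
    exact abs_blockTrace_le hR hb (fun n => (hϰ n).1) (fun n => (hϰ n).2) L k _
  have hmean : ∫ ϰ, blockTrace ψ L k ϰ (e 0) ∂μ =
      ∫ y, blockFun ψ L k y ∂(Measure.infinitePi fun _ : Fin L => P₀) := by
    rw [← hlaw (e 0), integral_map (hmB _).aemeasurable hF.aestronglyMeasurable, hX]
    rfl
  rw [← hmean]
  refine strong_law_ae_real (fun j ϰ => blockTrace ψ L k ϰ (e j)) hint ?_ ?_
  · intro i j hij
    have hI : iIndepFun (fun (n : ℤ) (ϰ : ℤ → ℝ) => ϰ n) μ :=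
      iIndepFun_infinitePi (P := fun _ : ℤ => P₀) (X := fun _ x => x) (fun _ => measurable_id)
    set S : ℤ → Finset ℤ := fun b => Finset.univ.image fun i : Fin L => b * L + ((i : ℕ) : ℤ)
    have hmem : ∀ (b : ℤ) (i : Fin L), b * L + ((i : ℕ) : ℤ) ∈ S b := fun b i =>
      Finset.mem_image_of_mem _ (Finset.mem_univ i)
    have hd : Disjoint (S (e i)) (S (e j)) := by
      rw [Finset.disjoint_left]
      intro n hn hn'
      obtain ⟨a, -, rfl⟩ := Finset.mem_image.1 hn
      obtain ⟨c, -, hc⟩ := Finset.mem_image.1 hn'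
      exact block_disjoint (he.ne hij) _ _ hc.symm
    have h1 := hI.indepFun_finset (S (e i)) (S (e j)) hd fun n => measurable_pi_apply n
    have h2 := h1.comp
      (φ := fun y : S (e i) → ℝ => blockFun ψ L k fun a => y ⟨e i * L + ((a : ℕ) : ℤ), hmem _ a⟩)
      (ψ := fun y : S (e j) → ℝ => blockFun ψ L k fun a => y ⟨e j * L + ((a : ℕ) : ℤ), hmem _ a⟩)
      (hF.comp (by fun_prop)) (hF.comp (by fun_prop))
    change IndepFun (fun ϰ => blockTrace ψ L k ϰ (e i)) (fun ϰ => blockTrace ψ L k ϰ (e j)) μ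
    rw [hX, hX]
    exact h2
  · intro i
    refine ⟨(hXm _).aemeasurable, (hXm _).aemeasurable, ?_⟩
    rw [hX, hX, ← Measure.map_map hF (hmB _), ← Measure.map_map hF (hmB _), hlaw, hlaw]

/-- Splits the blocks into two half-lines, since the strong law is for sequences indexed by `ℕ`. -/
theorem sum_Ico_neg_eq (f : ℤ → ℝ) (m : ℕ) :
    ∑ b ∈ Finset.Ico (-(m : ℤ)) m, f b =
      ∑ j ∈ Finset.range m, f j + ∑ j ∈ Finset.range m, f (-1 - j) := by
  induction m with
  | zero => simp
  | succ m ih =>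
    have h : Finset.Ico (-((m + 1 : ℕ) : ℤ)) (m + 1 : ℕ) =
        insert (-1 - (m : ℤ)) (insert (m : ℤ) (Finset.Ico (-(m : ℤ)) m)) := by
      ext x
      simp only [Finset.mem_Ico, Finset.mem_insert]
      push_cast
      omega
    rw [h, Finset.sum_insert (by simp only [Finset.mem_Ico, Finset.mem_insert]; omega),
      Finset.sum_insert (by simp), ih, Finset.sum_range_succ, Finset.sum_range_succ]
    ring

/-- The normalised trace of the `k`-th power of the truncated operator. -/
noncomputable def traceMoment (ψ : ℤ → H) (ϰ : ℤ → ℝ) (N k : ℕ) : ℝ :=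
  (2 * N + 1 : ℝ)⁻¹ *
    ∑ n, gramEig (fun n : ↥(Finset.Icc (-(N : ℤ)) N) => weighted ψ ϰ n) n ^ k

theorem tendsto_avg_gramTail (hψ : IsAdmissible ψ) :
    Tendsto (fun L : ℕ => (∑ i ∈ Finset.range L, gramTail ψ (i + 1)) / L) atTop (𝓝 0) := by
  have h := ((tendsto_add_atTop_iff_nat 1).2 (tendsto_gramTail hψ)).cesaro
  refine h.congr fun L => ?_
  rw [div_eq_inv_mul]

theorem tendsto_div_block {L : ℕ} (hL : 0 < L) :
    Tendsto (fun N : ℕ => ((N / L + 1 : ℕ) : ℝ) / (2 * N + 1)) atTop (𝓝 (1 / (2 * L))) := by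
  have hL' : (0 : ℝ) < L := by exact_mod_cast hL
  rw [tendsto_iff_norm_sub_tendsto_zero]
  refine squeeze_zero (g := fun N : ℕ => 1 / ((N : ℝ) + 1)) (fun _ => norm_nonneg _) ?_
    tendsto_one_div_add_atTop_nhds_zero_nat
  intro N
  have h1 : (N : ℝ) + 1 ≤ ((N / L + 1 : ℕ) : ℝ) * L := by
    have : N < (N / L + 1) * L := by
      rw [mul_comm]; exact Nat.lt_mul_div_succ N hL
    exact_mod_cast this
  have h2 : ((N / L + 1 : ℕ) : ℝ) * L ≤ N + L := by
    have : (N / L + 1) * L ≤ N + L := by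
      rw [add_mul, one_mul]; exact Nat.add_le_add_right (Nat.div_mul_le_self N L) L
    exact_mod_cast this
  have hL1 : (1 : ℝ) ≤ L := by exact_mod_cast hL
  set m : ℝ := ((N / L + 1 : ℕ) : ℝ)
  have hN : (0 : ℝ) ≤ N := N.cast_nonneg
  rw [Real.norm_eq_abs, div_sub_div _ _ (by positivity) (by positivity), abs_div,
    abs_of_pos (show (0 : ℝ) < (2 * N + 1) * (2 * L) by positivity),
    div_le_div_iff₀ (by positivity) (by positivity)]
  have h3 : |m * (2 * L) - (2 * N + 1) * 1| ≤ 2 * L := by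
    rw [abs_le]
    constructor <;> linarith
  calc _ ≤ (2 * L : ℝ) * (N + 1) := by gcongr
    _ ≤ _ := by nlinarith

/-- Per site, the boundary error vanishes as `N → ∞` for fixed `L`, while the decoupling error is
bounded by `2 A √(τ L / L)`, which is small once `L` is large. `L` is fixed first, and the strong
law then supplies the constant. -/
theorem ae_eventually_abs_traceMoment_sub_le (hψ : IsAdmissible ψ) {κ : ℝ}
    (hP : ∀ᵐ x ∂P₀, 0 ≤ x ∧ x ≤ κ) {k : ℕ} (hk : k ≠ 0) {ε : ℝ} (hε : 0 < ε) :
    ∃ c : ℝ, ∀ᵐ ϰ ∂(Measure.infinitePi fun _ : ℤ => P₀),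
      ∀ᶠ N in atTop, |traceMoment ψ ϰ N k - c| ≤ ε := by
  obtain ⟨R, hR, hb⟩ := exists_norm_sq_sum_le hψ
  set A : ℝ := k * (κ * R) ^ (k - 1) with hA
  set τ : ℕ → ℝ := fun L => κ ^ 2 * (2 * ∑ i ∈ Finset.range L, gramTail ψ (i + 1)) with hτ
  have hτ0 : ∀ L, 0 ≤ τ L := fun L => mul_nonneg (sq_nonneg _)
    (mul_nonneg two_pos.le (Finset.sum_nonneg fun i _ => gramTail_nonneg _))
  have h1 : Tendsto (fun L : ℕ => 2 * A * √(τ L / L)) atTop (𝓝 0) := by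
    have h := ((tendsto_avg_gramTail hψ).const_mul (κ ^ 2 * 2)).sqrt.const_mul (2 * A)
    rw [mul_zero, Real.sqrt_zero, mul_zero] at h
    refine h.congr fun L => ?_
    rw [hτ]
    congr 2
    ring
  obtain ⟨L, hLε, hL⟩ := ((h1.eventually (gt_mem_nhds (half_pos hε))).and
    (eventually_gt_atTop 0)).exists
  have hL' : (0 : ℝ) < L := by exact_mod_cast hL
  set E := ∫ y, blockFun ψ L k y ∂(Measure.infinitePi fun _ : Fin L => P₀) with hE
  -- The two copies of `E` come from the two half-lines; `1 / (2 L)` is the limiting number of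
  -- blocks on one side per site.
  refine ⟨1 / (2 * L) * (E + E), ?_⟩
  filter_upwards [ae_infinitePi_forall P₀ hP,
    ae_tendsto_sum_blockTrace P₀ hψ hP L k (e := fun j : ℕ => (j : ℤ)) Nat.cast_injective,
    ae_tendsto_sum_blockTrace P₀ hψ hP L k (e := fun j : ℕ => -1 - (j : ℤ))
      (fun i j h => by simpa using h)] with ϰ hϰ h2 h3
  have hm : Tendsto (fun N : ℕ => N / L + 1) atTop atTop :=
    (tendsto_add_atTop_nat 1).comp (Nat.tendsto_div_const_atTop hL.ne')
  have h4 := (tendsto_div_block hL).mul ((h2.add h3).comp hm)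
  have h5 : Tendsto (fun N : ℕ => A * √(8 * L * (κ ^ 2 * gramTail ψ 0) / (2 * N + 1))) atTop
      (𝓝 0) := by
    have h6 : Tendsto (fun N : ℕ => 8 * L * (κ ^ 2 * gramTail ψ 0) / (2 * (N : ℝ) + 1)) atTop
        (𝓝 0) := by
      refine Tendsto.div_atTop tendsto_const_nhds ?_
      exact tendsto_atTop_add_const_right _ _
        (tendsto_natCast_atTop_atTop.const_mul_atTop two_pos)
    have h7 := h6.sqrt.const_mul A
    rwa [Real.sqrt_zero, mul_zero] at h7
  have h8 := (h4.sub_const (1 / (2 * L) * (E + E))).abs.add h5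
  rw [sub_self, abs_zero, add_zero] at h8
  filter_upwards [h8.eventually (gt_mem_nhds (half_pos hε)), eventually_ge_atTop L] with N hN hNL
  set m := N / L + 1 with hm_def
  have hm1 : N < m * L := by
    rw [mul_comm]; exact Nat.lt_mul_div_succ N hL
  have hm2 : m * L ≤ N + L := by
    rw [add_mul, one_mul]; exact Nat.add_le_add_right (Nat.div_mul_le_self N L) L
  have hmain := abs_sum_gramEig_pow_sub_blockTrace_le hψ hR hb (fun n => (hϰ n).1)
    (fun n => (hϰ n).2) hL hk hm1 hm2
  have hκ0 : 0 ≤ κ := (hϰ 0).1.trans (hϰ 0).2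
  have hA0 : 0 ≤ A := by positivity
  set D : ℝ := 2 * N + 1 with hD
  have hD0 : 0 < D := by positivity
  -- Uses `N ≥ L`, so that the overshoot at most doubles the interval.
  have hmL : 2 * m * L ≤ 2 * D := by
    have : ((m * L : ℕ) : ℝ) ≤ ((N + L : ℕ) : ℝ) := by exact_mod_cast hm2
    have hNL' : (L : ℝ) ≤ N := by exact_mod_cast hNL
    push_cast at this
    rw [hD]
    nlinarith
  have hG0 : 0 ≤ κ ^ 2 * gramTail ψ 0 := mul_nonneg (sq_nonneg _) (gramTail_nonneg 0)
  set G0 := κ ^ 2 * gramTail ψ 0 with hG0_def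
  have hbound : √(2 * m * L) * A * (√(4 * L * G0) + √(2 * m * τ L)) ≤
      D * (A * √(8 * L * G0 / D) + 2 * A * √(τ L / L)) := by
    have e1 : √(2 * m * L) * √(4 * L * G0) ≤ D * √(8 * L * G0 / D) := by
      calc _ ≤ √(2 * D) * √(4 * L * G0) := by gcongr
        _ = √(D ^ 2 * (8 * L * G0 / D)) := by
            rw [← Real.sqrt_mul (by positivity)]
            congr 1
            field_simp
            ring
        _ = _ := by rw [Real.sqrt_mul (by positivity), Real.sqrt_sq hD0.le]
    have e2 : √(2 * m * L) * √(2 * m * τ L) ≤ D * (2 * √(τ L / L)) := by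
      have : 2 * m * τ L = 2 * m * L * (τ L / L) := by field_simp
      rw [this, Real.sqrt_mul (show (0 : ℝ) ≤ 2 * m * L by positivity) (τ L / L), ← mul_assoc,
        Real.mul_self_sqrt (by positivity), ← mul_assoc, mul_comm D]
      gcongr
    calc _ = A * (√(2 * m * L) * √(4 * L * G0)) + A * (√(2 * m * L) * √(2 * m * τ L)) := by ring
      _ ≤ A * (D * √(8 * L * G0 / D)) + A * (D * (2 * √(τ L / L))) := by gcongr
      _ = _ := by ring
  have h9 := hmain.trans hbound
  set T := ∑ n, gramEig (fun n : ↥(Finset.Icc (-(N : ℤ)) N) => weighted ψ ϰ n) n ^ k with hT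
  set S := ∑ b ∈ Finset.Ico (-(m : ℤ)) m, blockTrace ψ L k ϰ b with hS
  have h10 : |D⁻¹ * T - D⁻¹ * S| ≤ A * √(8 * L * G0 / D) + 2 * A * √(τ L / L) := by
    rw [← mul_sub, abs_mul, abs_of_pos (inv_pos.2 hD0), inv_mul_le_iff₀ hD0]
    exact h9
  have h11 : (m : ℝ) / D * ((∑ j ∈ Finset.range m, blockTrace ψ L k ϰ j) / m +
      (∑ j ∈ Finset.range m, blockTrace ψ L k ϰ (-1 - j)) / m) = D⁻¹ * S := by
    have hm0 : (m : ℝ) ≠ 0 := by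
      rw [hm_def]; positivity
    rw [hS, sum_Ico_neg_eq]
    field_simp
  simp only [Function.comp_apply] at hN
  rw [← hm_def, h11] at hN
  have h12 : traceMoment ψ ϰ N k = D⁻¹ * T := rfl
  rw [h12]
  have h13 := abs_sub_le (D⁻¹ * T) (D⁻¹ * S) (1 / (2 * L) * (E + E))
  linarith

/-- Almost every sequence is Cauchy, and its limit is within `1 / (j + 1)` of the non-random `c j`
for every `j`; this determines the limit, so one sample point may be used to name it. -/
theorem exists_forall_ae_tendsto {Ω : Type*} [MeasurableSpace Ω] {μ : Measure Ω} [NeZero μ]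
    {a : Ω → ℕ → ℝ}
    (h : ∀ ε : ℝ, 0 < ε → ∃ c : ℝ, ∀ᵐ ω ∂μ, ∀ᶠ N in atTop, |a ω N - c| ≤ ε) :
    ∃ l : ℝ, ∀ᵐ ω ∂μ, Tendsto (a ω) atTop (𝓝 l) := by
  have hpos : ∀ j : ℕ, (0 : ℝ) < 1 / (j + 1) := fun j => by positivity
  choose c hc using fun j : ℕ => h (1 / (j + 1)) (hpos j)
  have hall := ae_all_iff.2 hc
  have hcau : ∀ ω, (∀ j, ∀ᶠ N in atTop, |a ω N - c j| ≤ 1 / ((j : ℝ) + 1)) →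
      CauchySeq (a ω) := by
    intro ω hω
    rw [Metric.cauchySeq_iff]
    intro ε hε
    obtain ⟨j, hj⟩ := exists_nat_one_div_lt (half_pos hε)
    obtain ⟨N₀, hN₀⟩ := eventually_atTop.1 (hω j)
    refine ⟨N₀, fun m hm n hn => ?_⟩
    rw [Real.dist_eq]
    have h1 := hN₀ m hm
    have h2 := hN₀ n hn
    rw [abs_sub_comm] at h2
    have h3 := abs_sub_le (a ω m) (c j) (a ω n)
    linarith
  obtain ⟨ω₀, hω₀⟩ := hall.exists
  obtain ⟨l, hl⟩ := cauchySeq_tendsto_of_complete (hcau ω₀ hω₀)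
  refine ⟨l, ?_⟩
  filter_upwards [hall] with ω hω
  rw [Metric.tendsto_atTop]
  intro ε hε
  obtain ⟨j, hj⟩ := exists_nat_one_div_lt (half_pos hε)
  have hlj : |l - c j| ≤ 1 / ((j : ℝ) + 1) :=
    le_of_tendsto (hl.sub_const (c j)).abs (hω₀ j)
  obtain ⟨N₀, hN₀⟩ := eventually_atTop.1 (hω j)
  refine ⟨N₀, fun n hn => ?_⟩
  rw [Real.dist_eq]
  have h1 := hN₀ n hn
  have h2 := abs_sub_le (a ω n) (c j) l
  rw [abs_sub_comm] at hlj
  linarith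

theorem exists_ae_tendsto_traceMoment (hψ : IsAdmissible ψ) {κ : ℝ}
    (hP : ∀ᵐ x ∂P₀, 0 ≤ x ∧ x ≤ κ) {k : ℕ} (hk : k ≠ 0) :
    ∃ l : ℝ, ∀ᵐ ϰ ∂(Measure.infinitePi fun _ : ℤ => P₀),
      Tendsto (fun N => traceMoment ψ ϰ N k) atTop (𝓝 l) :=
  exists_forall_ae_tendsto fun _ hε => ae_eventually_abs_traceMoment_sub_le P₀ hψ hP hk hε

end Moments

end RankOneSum

namespace RankOneSum

/-! ### Moments and weak convergence on a compact interval -/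

section WeakLimits

/-- Weak limits of measures supported in a closed set are supported in it. -/
theorem ae_mem_of_tendsto_integral {α : Type*} {l : Filter α} [l.NeBot] {μs : α → Measure ℝ}
    {ν : Measure ℝ} [IsProbabilityMeasure ν] {F : Set ℝ} (hF : IsClosed F) (hne : F.Nonempty)
    (hμ : ∀ᶠ a in l, ∀ᵐ x ∂(μs a), x ∈ F)
    (h : ∀ f : ℝ →ᵇ ℝ, Tendsto (fun a => ∫ x, f x ∂(μs a)) l (𝓝 (∫ x, f x ∂ν))) :
    ∀ᵐ x ∂ν, x ∈ F := by
  let g : ℝ →ᵇ ℝ := BoundedContinuousFunction.ofNormedAddCommGroup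
    (fun x => min 1 (Metric.infDist x F)) (by fun_prop) 1 (fun x => by
      rw [Real.norm_of_nonneg (le_min zero_le_one Metric.infDist_nonneg)]
      exact min_le_left _ _)
  have hg0 : ∀ x, 0 ≤ g x := fun x => le_min zero_le_one Metric.infDist_nonneg
  have hgF : ∀ x ∈ F, g x = 0 := fun x hx => by
    change min 1 (Metric.infDist x F) = 0
    rw [Metric.infDist_zero_of_mem hx]
    exact min_eq_right zero_le_one
  have h1 : (fun a => ∫ x, g x ∂(μs a)) =ᶠ[l] fun _ => 0 := by
    filter_upwards [hμ] with a ha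
    refine integral_eq_zero_of_ae ?_
    filter_upwards [ha] with x hx using hgF x hx
  have h2 : ∫ x, g x ∂ν = 0 := tendsto_nhds_unique ((h g).congr' h1) tendsto_const_nhds
  rw [integral_eq_zero_iff_of_nonneg hg0 (g.integrable ν)] at h2
  filter_upwards [h2] with x hx
  rw [hF.mem_iff_infDist_zero hne]
  have hx' : min 1 (Metric.infDist x F) = 0 := hx
  rcases min_choice 1 (Metric.infDist x F) with h3 | h3
  · rw [h3] at hx'; norm_num at hx'
  · rwa [h3] at hx'

theorem integrable_of_ae_mem_Icc {μ : Measure ℝ} [IsProbabilityMeasure μ] {B : ℝ}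
    (hμ : ∀ᵐ x ∂μ, x ∈ Set.Icc 0 B) {f : ℝ → ℝ} (hf : Continuous f) : Integrable f μ := by
  obtain ⟨C, hC⟩ := (isCompact_Icc (a := (0 : ℝ)) (b := B)).exists_bound_of_continuousOn
    hf.continuousOn
  refine Integrable.of_bound hf.aestronglyMeasurable C ?_
  filter_upwards [hμ] with x hx using hC x hx

/-- On a compact interval, convergence of moments implies weak convergence. -/
theorem tendsto_integral_of_tendsto_moments {α : Type*} {l : Filter α} {μs : α → Measure ℝ}
    {ν : Measure ℝ} [hp : ∀ a, IsProbabilityMeasure (μs a)] [IsProbabilityMeasure ν] {B : ℝ}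
    (hμ : ∀ a, ∀ᵐ x ∂(μs a), x ∈ Set.Icc 0 B) (hν : ∀ᵐ x ∂ν, x ∈ Set.Icc 0 B)
    (h : ∀ k : ℕ, Tendsto (fun a => ∫ x, x ^ k ∂(μs a)) l (𝓝 (∫ x, x ^ k ∂ν)))
    {f : ℝ → ℝ} (hf : Continuous f) :
    Tendsto (fun a => ∫ x, f x ∂(μs a)) l (𝓝 (∫ x, f x ∂ν)) := by
  have hpoly : ∀ (p : Polynomial ℝ) (μ : Measure ℝ) [IsProbabilityMeasure μ],
      (∀ᵐ x ∂μ, x ∈ Set.Icc 0 B) → ∫ x, p.eval x ∂μ =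
        ∑ i ∈ Finset.range (p.natDegree + 1), p.coeff i * ∫ x, x ^ i ∂μ := by
    intro p μ _ hμ
    simp_rw [Polynomial.eval_eq_sum_range]
    rw [integral_finsetSum _ fun i _ => integrable_of_ae_mem_Icc hμ (by fun_prop)]
    exact Finset.sum_congr rfl fun i _ => integral_const_mul _ _
  have hnear : ∀ (p : Polynomial ℝ) (ε : ℝ), (∀ x ∈ Set.Icc 0 B, |p.eval x - f x| < ε) →
      ∀ (μ : Measure ℝ) [IsProbabilityMeasure μ], (∀ᵐ x ∂μ, x ∈ Set.Icc 0 B) →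
      |∫ x, f x ∂μ - ∫ x, p.eval x ∂μ| ≤ ε := by
    intro p ε hpε μ _ hμ
    rw [← integral_sub (integrable_of_ae_mem_Icc hμ hf)
      (integrable_of_ae_mem_Icc hμ p.continuous), ← Real.norm_eq_abs]
    have := norm_integral_le_of_norm_le_const (μ := μ) (f := fun x => f x - p.eval x) (C := ε)
      (by filter_upwards [hμ] with x hx
          rw [Real.norm_eq_abs, abs_sub_comm]
          exact (hpε x hx).le)
    simpa using this
  rw [Metric.tendsto_nhds]
  intro ε hε
  obtain ⟨p, hpε⟩ := exists_polynomial_near_of_continuousOn 0 B f hf.continuousOn (ε / 3)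
    (by positivity)
  have h1 : Tendsto (fun a => ∫ x, p.eval x ∂(μs a)) l (𝓝 (∫ x, p.eval x ∂ν)) := by
    rw [hpoly p ν hν]
    refine Tendsto.congr (fun a => (hpoly p (μs a) (hμ a)).symm) ?_
    exact tendsto_finsetSum _ fun i _ => (h i).const_mul _
  filter_upwards [Metric.tendsto_nhds.1 h1 (ε / 3) (by positivity)] with a ha
  rw [Real.dist_eq] at ha ⊢
  have h2 := hnear p _ hpε (μs a) (hμ a)
  have h3 := hnear p _ hpε ν hν
  rw [abs_sub_comm] at h3
  have h4 := abs_sub_le (∫ x, f x ∂(μs a)) (∫ x, p.eval x ∂(μs a)) (∫ x, f x ∂ν)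
  have h5 := abs_sub_le (∫ x, p.eval x ∂(μs a)) (∫ x, p.eval x ∂ν) (∫ x, f x ∂ν)
  linarith

/-- A common compact support gives tightness, so Prokhorov's theorem provides a cluster point; its
moments are read off along an ultrafilter. -/
theorem exists_measure_of_tendsto_moments {μs : ℕ → Measure ℝ}
    [hp : ∀ a, IsProbabilityMeasure (μs a)] {B : ℝ} (hB : 0 ≤ B)
    (hμ : ∀ a, ∀ᵐ x ∂(μs a), x ∈ Set.Icc 0 B) {m : ℕ → ℝ}
    (h : ∀ k : ℕ, Tendsto (fun a => ∫ x, x ^ k ∂(μs a)) atTop (𝓝 (m k))) :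
    ∃ ν : Measure ℝ, IsProbabilityMeasure ν ∧ (∀ᵐ x ∂ν, x ∈ Set.Icc 0 B) ∧
      ∀ k, ∫ x, x ^ k ∂ν = m k := by
  set P : ℕ → ProbabilityMeasure ℝ := fun n => ⟨μs n, hp n⟩ with hP
  have htight : IsTightMeasureSet {((μ : ProbabilityMeasure ℝ) : Measure ℝ) | μ ∈ Set.range P} := by
    rw [isTightMeasureSet_iff_exists_isCompact_measure_compl_le]
    intro ε _
    refine ⟨Set.Icc 0 B, isCompact_Icc, ?_⟩
    rintro _ ⟨_, ⟨n, rfl⟩, rfl⟩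
    have h0 : μs n (Set.Icc 0 B)ᶜ = 0 := hμ n
    change μs n (Set.Icc 0 B)ᶜ ≤ ε
    rw [h0]
    exact zero_le
  have hcpt := isCompact_closure_of_isTightMeasureSet htight
  obtain ⟨ν, -, hν⟩ := hcpt.exists_mapClusterPt (f := atTop) (u := P)
    (Filter.le_principal_iff.2 (Filter.mem_map.2 (Eventually.of_forall fun n =>
      subset_closure (Set.mem_range_self n))))
  obtain ⟨U, hU, hUν⟩ := mapClusterPt_iff_ultrafilter.1 hν
  rw [ProbabilityMeasure.tendsto_iff_forall_integral_tendsto] at hUν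
  have hsupp : ∀ᵐ x ∂(ν : Measure ℝ), x ∈ Set.Icc 0 B :=
    ae_mem_of_tendsto_integral isClosed_Icc (Set.nonempty_Icc.2 hB)
      (Eventually.of_forall hμ) hUν
  refine ⟨ν, inferInstance, hsupp, fun k => ?_⟩
  -- Clamping to `[0, B]` turns the monomial into an admissible test function without changing it on
  -- the supports.
  let g : ℝ →ᵇ ℝ := BoundedContinuousFunction.ofNormedAddCommGroup
    (fun x => (max 0 (min x B)) ^ k) (by fun_prop) (B ^ k) (fun x => by
      rw [norm_pow, Real.norm_of_nonneg (le_max_left _ _)]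
      exact pow_le_pow_left₀ (le_max_left _ _) (max_le hB (min_le_right _ _)) k)
  have hg : ∀ x ∈ Set.Icc 0 B, g x = x ^ k := fun x hx => by
    change (max 0 (min x B)) ^ k = x ^ k
    rw [min_eq_left hx.2, max_eq_right hx.1]
  have hgi : ∀ (μ : Measure ℝ), (∀ᵐ x ∂μ, x ∈ Set.Icc 0 B) → ∫ x, g x ∂μ = ∫ x, x ^ k ∂μ :=
    fun μ hμ => integral_congr_ae (by filter_upwards [hμ] with x hx using hg x hx)
  have h1 := hUν g
  rw [hgi _ hsupp] at h1
  refine tendsto_nhds_unique h1 (((h k).mono_left hU).congr fun n => ?_)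
  exact (hgi _ (hμ n)).symm

end WeakLimits

/-! ### Existence of the density of states measure -/

section Existence

variable {H : Type*} [NormedAddCommGroup H] [InnerProductSpace ℂ H] {ψ : ℤ → H}

/-- The eigenvalues of the truncated operator on the span of the vectors. -/
noncomputable def eig (ψ : ℤ → H) (ϰ : ℤ → ℝ) (N : ℕ) : ↥(Finset.Icc (-(N : ℤ)) N) → ℝ :=
  gramEig fun n : ↥(Finset.Icc (-(N : ℤ)) N) => weighted ψ ϰ n

/-- No eigenvalue is lost when zero is excluded, which is why the counting measures have total mass
one. -/
theorem eig_pos (hψ : IsAdmissible ψ) {ϰ : ℤ → ℝ} (h : ∀ n, 0 < ϰ n) (N : ℕ)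
    (i : ↥(Finset.Icc (-(N : ℤ)) N)) : 0 < eig ψ ϰ N i := by
  have h1 : LinearIndependent ℂ fun n : ↥(Finset.Icc (-(N : ℤ)) N) => weighted ψ ϰ n := by
    have h2 := hψ.linearIndependent.comp (fun n : ↥(Finset.Icc (-(N : ℤ)) N) => (n : ℤ))
      Subtype.val_injective
    exact h2.units_smul fun n => Units.mk0 ((√(ϰ n) : ℝ) : ℂ)
      (by exact_mod_cast (Real.sqrt_pos.2 (h n)).ne')
  exact (Matrix.posDef_gram_of_linearIndependent h1).eigenvalues_pos i

theorem countingMeasure_eq (hψ : IsAdmissible ψ) {ϰ : ℤ → ℝ} (h : ∀ n, 0 < ϰ n) (N : ℕ) :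
    countingMeasure ψ ϰ N = ((2 * N + 1 : ℕ) : ℝ≥0∞)⁻¹ • ∑ i, Measure.dirac (eig ψ ϰ N i) := by
  rw [countingMeasure, truncated_eq_frameOp fun n => (h n).le, sum_finrank_dirac_frameOp]
  congr 1
  refine Finset.sum_congr rfl fun i _ => ?_
  rw [if_neg]
  · rfl
  · exact (eig_pos hψ h N i).ne'

theorem card_Icc_neg (N : ℕ) : Fintype.card ↥(Finset.Icc (-(N : ℤ)) N) = 2 * N + 1 := by
  rw [Fintype.card_coe, Int.card_Icc]
  omega

theorem integral_countingMeasure (hψ : IsAdmissible ψ) {ϰ : ℤ → ℝ} (h : ∀ n, 0 < ϰ n) (N : ℕ)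
    (f : ℝ → ℝ) :
    ∫ x, f x ∂(countingMeasure ψ ϰ N) = (2 * N + 1 : ℝ)⁻¹ * ∑ i, f (eig ψ ϰ N i) := by
  rw [countingMeasure_eq hψ h, integral_smul_measure, integral_finsetSum_measure
    fun i _ => integrable_dirac (by simp)]
  simp_rw [integral_dirac]
  rw [smul_eq_mul]
  congr 1
  rw [ENNReal.toReal_inv, ENNReal.toReal_natCast]
  push_cast
  rfl

theorem isProbabilityMeasure_countingMeasure (hψ : IsAdmissible ψ) {ϰ : ℤ → ℝ}
    (h : ∀ n, 0 < ϰ n) (N : ℕ) : IsProbabilityMeasure (countingMeasure ψ ϰ N) := by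
  refine ⟨?_⟩
  rw [countingMeasure_eq hψ h, Measure.smul_apply, Measure.finsetSum_apply]
  simp only [measure_univ, Finset.sum_const, Finset.card_univ, card_Icc_neg, nsmul_eq_mul,
    mul_one, smul_eq_mul]
  exact ENNReal.inv_mul_cancel (by simp) (ENNReal.natCast_ne_top _)

theorem ae_countingMeasure (hψ : IsAdmissible ψ) {ϰ : ℤ → ℝ} (h : ∀ n, 0 < ϰ n) (N : ℕ)
    {p : ℝ → Prop} (hp : ∀ i, p (eig ψ ϰ N i)) : ∀ᵐ x ∂(countingMeasure ψ ϰ N), p x := by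
  rw [countingMeasure_eq hψ h]
  refine Measure.ae_smul_measure ?_ _
  rw [← Measure.sum_fintype, Measure.ae_sum_iff]
  intro i
  rw [ae_dirac_eq]
  exact hp i

theorem ae_countingMeasure_mem_Icc (hψ : IsAdmissible ψ) {R : ℝ} (hR : 0 < R)
    (hb : ∀ (s : Finset ℤ) (c : ℤ → ℂ), ‖∑ n ∈ s, c n • ψ n‖ ^ 2 ≤ R * ∑ n ∈ s, ‖c n‖ ^ 2)
    {ϰ : ℤ → ℝ} {κ : ℝ} (h : ∀ n, 0 < ϰ n) (hκ : ∀ n, ϰ n ≤ κ) (N : ℕ) :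
    ∀ᵐ x ∂(countingMeasure ψ ϰ N), x ∈ Set.Icc 0 (κ * R) :=
  ae_countingMeasure hψ h N fun i => ⟨(eig_pos hψ h N i).le,
    gramEig_le (isBesselBound_weighted hR hb (fun n => (h n).le) hκ Subtype.val_injective) i⟩

theorem integral_pow_countingMeasure (hψ : IsAdmissible ψ) {ϰ : ℤ → ℝ} (h : ∀ n, 0 < ϰ n)
    (N k : ℕ) : ∫ x, x ^ k ∂(countingMeasure ψ ϰ N) = traceMoment ψ ϰ N k :=
  integral_countingMeasure hψ h N fun x => x ^ k

theorem exists_isIDSMeasure (hψ : IsAdmissible ψ) (P₀ : Measure ℝ) [IsProbabilityMeasure P₀]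
    {κ : ℝ} (hP : ∀ᵐ x ∂P₀, 0 < x ∧ x ≤ κ) : ∃ ν : Measure ℝ, IsIDSMeasure ψ P₀ ν := by
  obtain ⟨R, hR, hb⟩ := exists_norm_sq_sum_le hψ
  have hmom : ∀ k : ℕ, ∃ l : ℝ, ∀ᵐ ϰ ∂(Measure.infinitePi fun _ : ℤ => P₀),
      Tendsto (fun N => ∫ x, x ^ k ∂(countingMeasure ψ ϰ N)) atTop (𝓝 l) := by
    intro k
    rcases eq_or_ne k 0 with rfl | hk
    · refine ⟨1, ?_⟩
      filter_upwards [ae_infinitePi_forall P₀ hP] with ϰ hϰ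
      refine tendsto_const_nhds.congr fun N => ?_
      have := isProbabilityMeasure_countingMeasure hψ (fun n => (hϰ n).1) N
      simp
    · obtain ⟨l, hl⟩ := exists_ae_tendsto_traceMoment P₀ hψ
        (hP.mono fun x hx => ⟨hx.1.le, hx.2⟩) hk
      refine ⟨l, ?_⟩
      filter_upwards [ae_infinitePi_forall P₀ hP, hl] with ϰ hϰ h
      simpa only [integral_pow_countingMeasure hψ fun n => (hϰ n).1] using h
  choose m hm using hmom
  have hall := (ae_infinitePi_forall P₀ hP).and (ae_all_iff.2 hm)
  -- The measure is built from one typical sequence; as the limiting moments are non-random, it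
  -- serves almost every other sequence.
  obtain ⟨ϰ₀, hϰ₀, hm₀⟩ := hall.exists
  have hprob : ∀ ϰ : ℤ → ℝ, (∀ n, 0 < ϰ n ∧ ϰ n ≤ κ) → ∀ N,
      IsProbabilityMeasure (countingMeasure ψ ϰ N) := fun ϰ hϰ N =>
    isProbabilityMeasure_countingMeasure hψ (fun n => (hϰ n).1) N
  have hsupp : ∀ ϰ : ℤ → ℝ, (∀ n, 0 < ϰ n ∧ ϰ n ≤ κ) → ∀ N,
      ∀ᵐ x ∂(countingMeasure ψ ϰ N), x ∈ Set.Icc 0 (κ * R) := fun ϰ hϰ N =>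
    ae_countingMeasure_mem_Icc hψ hR hb (fun n => (hϰ n).1) (fun n => (hϰ n).2) N
  have hκ : 0 ≤ κ := (hϰ₀ 0).1.le.trans (hϰ₀ 0).2
  have := hprob ϰ₀ hϰ₀
  obtain ⟨ν, hν, hνs, hνm⟩ := exists_measure_of_tendsto_moments (by positivity) (hsupp ϰ₀ hϰ₀) hm₀
  refine ⟨ν, hν, ?_⟩
  filter_upwards [hall] with ϰ hϰ f
  have := hprob ϰ hϰ.1
  refine tendsto_integral_of_tendsto_moments (hsupp ϰ hϰ.1) hνs (fun k => ?_) f.continuous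
  rw [hνm]
  exact hϰ.2 k

end Existence

end RankOneSum

namespace RankOneSum

/-! ### Spectral averaging over one coupling -/

section PoissonKernel

/-- Affine substitution in an integral against the Poisson kernel. -/
theorem lintegral_mul_poisson (a : ℝ) {b : ℝ} (hb : 0 < b) {g : ℝ → ℝ≥0∞} (hg : Measurable g) :
    ∫⁻ t, g t * ENNReal.ofReal (b / ((t + a) ^ 2 + b ^ 2)) =
      ∫⁻ s, g (b * s - a) * ENNReal.ofReal ((1 + s ^ 2)⁻¹) := by
  have h1 := lintegral_add_right_eq_self (μ := (volume : Measure ℝ))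
    (fun t => g (t - a) * ENNReal.ofReal (b / (t ^ 2 + b ^ 2))) a
  simp only [add_sub_cancel_right] at h1
  rw [h1]
  conv_lhs => rw [← Real.smul_map_volume_mul_left hb.ne']
  rw [lintegral_smul_measure, lintegral_map (by fun_prop) (by fun_prop), smul_eq_mul,
    ← lintegral_const_mul _ (by fun_prop)]
  refine lintegral_congr fun s => ?_
  rw [mul_left_comm, ← ENNReal.ofReal_mul (abs_nonneg _), abs_of_pos hb]
  congr 2
  have : (0 : ℝ) < 1 + s ^ 2 := by positivity
  field_simp
  ring

theorem lintegral_inv_one_add_sq :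
    ∫⁻ s : ℝ, ENNReal.ofReal ((1 + s ^ 2)⁻¹) = ENNReal.ofReal Real.pi := by
  rw [← ofReal_integral_eq_lintegral_ofReal integrable_inv_one_add_sq
    (Eventually.of_forall fun s => by positivity), integral_univ_inv_one_add_sq]

theorem lintegral_poisson (a : ℝ) {b : ℝ} (hb : 0 < b) :
    ∫⁻ t, ENNReal.ofReal (b / ((t + a) ^ 2 + b ^ 2)) = ENNReal.ofReal Real.pi := by
  have := lintegral_mul_poisson a hb (g := fun _ => 1) measurable_const
  simpa [lintegral_inv_one_add_sq] using this

/-- The imaginary part of a Möbius transform is a Poisson kernel. -/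
theorem im_div_one_add_mul {w : ℂ} (hw : 0 < w.im) (t : ℝ) :
    (w / (1 + t * w)).im =
      (w.im / Complex.normSq w) / ((t + w.re / Complex.normSq w) ^ 2 +
        (w.im / Complex.normSq w) ^ 2) := by
  -- The formula is the imaginary part of `1 / (t + 1/w)`, with `1/w = conj w / |w|²`.
  have hw0 : w ≠ 0 := fun h => by simp [h] at hw
  have h1 : 0 < Complex.normSq w := Complex.normSq_pos.2 hw0
  have h2 : 1 + (t : ℂ) * w ≠ 0 := by
    intro h
    have him := congrArg Complex.im h
    have hre := congrArg Complex.re h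
    simp at him hre
    rcases him with h3 | h3
    · simp [h3] at hre
    · exact hw.ne' h3
  have h3 : 0 < Complex.normSq (1 + t * w) := Complex.normSq_pos.2 h2
  have h4 : Complex.normSq (1 + t * w) = Complex.normSq w *
      ((t + w.re / Complex.normSq w) ^ 2 + (w.im / Complex.normSq w) ^ 2) * 1 := by
    have e : Complex.normSq (1 + t * w) = (1 + t * w.re) ^ 2 + (t * w.im) ^ 2 := by
      rw [Complex.normSq_apply]; simp; ring
    rw [e]
    field_simp
    rw [Complex.normSq_apply]
    ring
  have h5 : (w / (1 + t * w)).im = w.im / Complex.normSq (1 + t * w) := by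
    rw [Complex.div_im]
    simp only [Complex.add_re, Complex.one_re, Complex.mul_re, Complex.ofReal_re,
      Complex.ofReal_im, zero_mul, sub_zero, Complex.add_im, Complex.one_im, Complex.mul_im,
      add_zero, zero_add]
    field_simp
    ring
  rw [h5, h4, mul_one]
  rw [div_div]

theorem im_div_one_add_mul_nonneg {w : ℂ} (hw : 0 < w.im) (t : ℝ) :
    0 ≤ (w / (1 + t * w)).im := by
  have hw0 : w ≠ 0 := fun h => by simp [h] at hw
  have h1 : 0 < Complex.normSq w := Complex.normSq_pos.2 hw0
  rw [im_div_one_add_mul hw]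
  positivity

/-- Spectral averaging over one coupling constant. -/
theorem lintegral_im_div_one_add_mul_le {P₀ : Measure ℝ} {ρ : ℝ → ℝ} (hρ_meas : Measurable ρ)
    (hρ : P₀ = volume.withDensity fun x => ENNReal.ofReal (ρ x))
    {ρmax : ℝ} (hρmax : ∀ᵐ x ∂(volume : Measure ℝ), ρ x ≤ ρmax) {κ : ℝ} (hκ0 : 0 ≤ κ)
    (hκ : ∀ᵐ x ∂P₀, x ≤ κ) {w : ℂ} (hw : 0 < w.im) :
    ∫⁻ t, ENNReal.ofReal (t * (w / (1 + t * w)).im) ∂P₀ ≤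
      ENNReal.ofReal κ * (ENNReal.ofReal ρmax * ENNReal.ofReal Real.pi) := by
  have hw0 : w ≠ 0 := fun h => by simp [h] at hw
  have h1 : 0 < Complex.normSq w := Complex.normSq_pos.2 hw0
  have hm : Measurable fun t : ℝ => ENNReal.ofReal (w / (1 + t * w)).im := by
    simp_rw [im_div_one_add_mul hw]
    fun_prop
  calc ∫⁻ t, ENNReal.ofReal (t * (w / (1 + t * w)).im) ∂P₀
      ≤ ∫⁻ t, ENNReal.ofReal κ * ENNReal.ofReal (w / (1 + t * w)).im ∂P₀ := by
        refine lintegral_mono_ae ?_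
        filter_upwards [hκ] with t ht
        rw [← ENNReal.ofReal_mul hκ0]
        exact ENNReal.ofReal_le_ofReal
          (mul_le_mul_of_nonneg_right ht (im_div_one_add_mul_nonneg hw t))
    _ = ENNReal.ofReal κ * ∫⁻ t : ℝ, ENNReal.ofReal (ρ t) * ENNReal.ofReal (w / (1 + t * w)).im := by
        rw [lintegral_const_mul _ hm, hρ,
          lintegral_withDensity_eq_lintegral_mul _ (by fun_prop) hm]
        rfl
    _ ≤ ENNReal.ofReal κ * ∫⁻ t : ℝ, ENNReal.ofReal ρmax * ENNReal.ofReal (w / (1 + t * w)).im := by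
        refine mul_le_mul_right ?_ _
        refine lintegral_mono_ae ?_
        filter_upwards [hρmax] with t ht
        gcongr
    _ = _ := by
        rw [lintegral_const_mul _ hm]
        simp_rw [im_div_one_add_mul hw]
        rw [lintegral_poisson _ (by positivity)]

end PoissonKernel

/-! ### Resolvents and rank one perturbations -/

section Resolvent

variable {H : Type*} [NormedAddCommGroup H] [InnerProductSpace ℂ H] [CompleteSpace H]

/-- The resolvent of a bounded operator. -/
noncomputable def res (A : H →L[ℂ] H) (z : ℂ) : H →L[ℂ] H :=
  Ring.inverse (A - algebraMap ℂ (H →L[ℂ] H) z)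

theorem isUnit_sub_algebraMap {A : H →L[ℂ] H} (hA : IsSelfAdjoint A) {z : ℂ} (hz : z.im ≠ 0) :
    IsUnit (A - algebraMap ℂ (H →L[ℂ] H) z) := by
  have h : z ∉ spectrum ℂ A := fun h => hz (hA.im_eq_zero_of_mem_spectrum h)
  rw [spectrum.notMem_iff] at h
  rw [← neg_sub]
  exact h.neg

theorem res_apply_sub {A : H →L[ℂ] H} (hA : IsSelfAdjoint A) {z : ℂ} (hz : z.im ≠ 0) (x : H) :
    res A z (A x - z • x) = x := by
  have h := Ring.inverse_mul_cancel _ (isUnit_sub_algebraMap hA hz)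
  have h2 := congrArg (fun T : H →L[ℂ] H => T x) h
  simpa [res, Algebra.algebraMap_eq_smul_one] using h2

theorem sub_res_apply {A : H →L[ℂ] H} (hA : IsSelfAdjoint A) {z : ℂ} (hz : z.im ≠ 0) (x : H) :
    A (res A z x) - z • res A z x = x := by
  have h := Ring.mul_inverse_cancel _ (isUnit_sub_algebraMap hA hz)
  have h2 := congrArg (fun T : H →L[ℂ] H => T x) h
  simpa [res, Algebra.algebraMap_eq_smul_one] using h2

/-- With `x = (A - z) y` and `⟨A y, y⟩` real, the imaginary part equals `Im z ‖y‖²`. -/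
theorem im_inner_res_pos {A : H →L[ℂ] H} (hA : IsSelfAdjoint A) {z : ℂ} (hz : 0 < z.im) {x : H}
    (hx : x ≠ 0) : 0 < (inner ℂ x (res A z x)).im := by
  set y := res A z x with hy
  have h1 : A y - z • y = x := sub_res_apply hA hz.ne' x
  have hy0 : y ≠ 0 := by
    intro h
    rw [h] at h1
    simp at h1
    exact hx h1.symm
  have h2 : inner ℂ x y = inner ℂ (A y) y - starRingEnd ℂ z * inner ℂ y y := by
    rw [← h1, inner_sub_left, inner_smul_left]
  have h3 : (inner ℂ (A y) y).im = 0 := by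
    rw [← Complex.conj_eq_iff_im, inner_conj_symm]
    exact ((ContinuousLinearMap.isSelfAdjoint_iff_isSymmetric.1 hA) y y).symm
  rw [h2, Complex.sub_im, h3, inner_self_eq_ofReal_norm_sq, ← Complex.ofReal_pow,
    Complex.im_mul_ofReal, Complex.conj_im]
  have : 0 < ‖y‖ := norm_pos_iff.2 hy0
  nlinarith [mul_pos hz (pow_pos this 2)]

/-- The rank one perturbation formula. -/
theorem inner_res_add_rankOne {A : H →L[ℂ] H} (hA : IsSelfAdjoint A) {z : ℂ} (hz : 0 < z.im)
    {x : H} (hx : x ≠ 0) (t : ℝ) (hB : IsSelfAdjoint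
      (A + (t : ℂ) • InnerProductSpace.rankOne ℂ x x)) :
    inner ℂ x (res (A + (t : ℂ) • InnerProductSpace.rankOne ℂ x x) z x) =
      inner ℂ x (res A z x) / (1 + t * inner ℂ x (res A z x)) := by
  set B := A + (t : ℂ) • InnerProductSpace.rankOne ℂ x x with hBdef
  set F := inner ℂ x (res A z x) with hF
  have hF0 : 0 < F.im := im_inner_res_pos hA hz hx
  -- The perturbation maps everything into the line of `x`, so `(B - z) R_A x` is a multiple of `x`;
  -- applying `R_B` then solves for the new entry.
  have h1 : B (res A z x) - z • res A z x = (1 + t * F) • x := by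
    have h2 := sub_res_apply hA hz.ne' x
    rw [hBdef]
    simp only [add_apply, smul_apply, InnerProductSpace.rankOne_apply]
    rw [← hF, smul_smul, add_sub_right_comm, h2, add_smul, one_smul]
  have h3 := res_apply_sub hB hz.ne' (res A z x)
  rw [h1, map_smul] at h3
  have h4 : F = (1 + t * F) * inner ℂ x (res B z x) := by
    rw [← inner_smul_right, h3]
  have hne : 1 + (t : ℂ) * F ≠ 0 := by
    intro h
    rw [h, zero_mul] at h4
    rw [h4] at hF0
    simp at hF0
  rw [eq_div_iff hne, mul_comm]
  exact h4.symm

theorem isSelfAdjoint_sum_rankOne {ι : Type*} (s : Finset ι) (c : ι → ℝ) (v : ι → H) :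
    IsSelfAdjoint (∑ i ∈ s, (c i : ℂ) • InnerProductSpace.rankOne ℂ (v i) (v i)) := by
  rw [ContinuousLinearMap.isSelfAdjoint_iff_isSymmetric]
  intro x y
  simp only [ContinuousLinearMap.coe_coe, sum_apply, smul_apply,
    InnerProductSpace.rankOne_apply, sum_inner, inner_sum, inner_smul_left, inner_smul_right,
    Complex.conj_ofReal, inner_conj_symm]
  exact Finset.sum_congr rfl fun i _ => by ring

theorem continuous_res {α : Type*} [TopologicalSpace α] {A : α → H →L[ℂ] H} (hA : Continuous A)
    (hs : ∀ a, IsSelfAdjoint (A a)) {z : ℂ} (hz : z.im ≠ 0) : Continuous fun a => res (A a) z := by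
  rw [continuous_iff_continuousAt]
  intro a
  obtain ⟨u, hu⟩ := isUnit_sub_algebraMap (hs a) hz
  have h := NormedRing.inverse_continuousAt u
  rw [hu] at h
  exact ContinuousAt.comp (f := fun a => A a - algebraMap ℂ (H →L[ℂ] H) z) h
    (hA.sub continuous_const).continuousAt

end Resolvent

end RankOneSum

namespace RankOneSum

open ProbabilityTheory

/-! ### Wegner estimate -/

section Wegner

variable {H : Type*} [NormedAddCommGroup H] [InnerProductSpace ℂ H] [CompleteSpace H] {ψ : ℤ → H}

/-- The diagonal resolvent entry of the operator with the couplings `y` on the sites of `S`. -/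
noncomputable def diagRes (ψ : ℤ → H) (z : ℂ) (n : ℤ) (S : Finset ℤ) (y : S → ℝ) : ℂ :=
  inner ℂ (ψ n) (res (∑ i, (y i : ℂ) • InnerProductSpace.rankOne ℂ (ψ i) (ψ i)) z (ψ n))

theorem diagRes_im_pos (hψ : IsAdmissible ψ) {z : ℂ} (hz : 0 < z.im) (n : ℤ) (S : Finset ℤ)
    (y : S → ℝ) : 0 < (diagRes ψ z n S y).im :=
  im_inner_res_pos (isSelfAdjoint_sum_rankOne _ y fun i : S => ψ i) hz
    (fun h => by simpa [h] using hψ.norm_eq_one n)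

theorem continuous_diagRes (ψ : ℤ → H) {z : ℂ} (hz : 0 < z.im) (n : ℤ) (S : Finset ℤ) :
    Continuous (diagRes ψ z n S) := by
  have h := continuous_res (A := fun y : S → ℝ =>
    ∑ i, (y i : ℂ) • InnerProductSpace.rankOne ℂ (ψ i) (ψ i)) (by fun_prop)
    (fun y => isSelfAdjoint_sum_rankOne _ y fun i : S => ψ i) hz.ne'
  exact continuous_const.inner (h.clm_apply continuous_const)

/-- Isolates the dependence on `ϰ n`: the `diagRes` factor involves only the other couplings. -/
theorem inner_res_truncated (hψ : IsAdmissible ψ) {z : ℂ} (hz : 0 < z.im) (ϰ : ℤ → ℝ) {N : ℕ}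
    {n : ℤ} (hn : n ∈ Finset.Icc (-(N : ℤ)) N) :
    inner ℂ (ψ n) (res (truncated ψ ϰ N) z (ψ n)) =
      diagRes ψ z n ((Finset.Icc (-(N : ℤ)) N).erase n) (fun i => ϰ i) /
        (1 + ϰ n * diagRes ψ z n ((Finset.Icc (-(N : ℤ)) N).erase n) (fun i => ϰ i)) := by
  have hne : ψ n ≠ 0 := fun h => by simpa [h] using hψ.norm_eq_one n
  have h1 : truncated ψ ϰ N = (∑ i ∈ (Finset.Icc (-(N : ℤ)) N).erase n,
      (ϰ i : ℂ) • InnerProductSpace.rankOne ℂ (ψ i) (ψ i)) +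
      (ϰ n : ℂ) • InnerProductSpace.rankOne ℂ (ψ n) (ψ n) := by
    rw [truncated, ← Finset.sum_erase_add _ _ hn]
  have h2 : IsSelfAdjoint (truncated ψ ϰ N) := isSelfAdjoint_sum_rankOne _ ϰ ψ
  rw [h1] at h2 ⊢
  rw [inner_res_add_rankOne (isSelfAdjoint_sum_rankOne _ ϰ ψ) hz hne (ϰ n) h2]
  generalize (Finset.Icc (-(N : ℤ)) N).erase n = S
  have h3 : inner ℂ (ψ n) (res (∑ i ∈ S, (ϰ i : ℂ) • InnerProductSpace.rankOne ℂ (ψ i) (ψ i)) z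
      (ψ n)) = diagRes ψ z n S fun i => ϰ i := by
    rw [diagRes, Finset.sum_coe_sort S fun i =>
      (ϰ i : ℂ) • InnerProductSpace.rankOne ℂ (ψ i) (ψ i)]
  rw [h3]

/-- The function `λ ↦ Im (λ / (λ - z))` for `z = x + i ε`. -/
noncomputable def kernelFun (x ε t : ℝ) : ℝ := t * (ε / ((t - x) ^ 2 + ε ^ 2))

theorem im_div_sub (x t : ℝ) {ε : ℝ} (hε : 0 < ε) :
    ((t : ℂ) / (t - (⟨x, ε⟩ : ℂ))).im = kernelFun x ε t := by
  have h : (t - x) ^ 2 + ε ^ 2 ≠ 0 := by positivity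
  rw [Complex.div_im, Complex.normSq_apply, kernelFun]
  simp only [Complex.ofReal_im, Complex.sub_re, Complex.ofReal_re, zero_mul, zero_div,
    Complex.sub_im, zero_sub]
  have e : (t - x) * (t - x) + -ε * -ε = (t - x) ^ 2 + ε ^ 2 := by ring
  rw [e]
  field_simp

theorem sum_kernelFun_eig (hψ : IsAdmissible ψ) {ϰ : ℤ → ℝ} (h : ∀ n, 0 ≤ ϰ n) (N : ℕ) (x : ℝ)
    {ε : ℝ} (hε : 0 < ε) :
    ∑ i, kernelFun x ε (eig ψ ϰ N i) =
      ∑ n ∈ Finset.Icc (-(N : ℤ)) N, ϰ n *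
        (diagRes ψ ⟨x, ε⟩ n ((Finset.Icc (-(N : ℤ)) N).erase n) (fun i => ϰ i) /
        (1 + ϰ n * diagRes ψ ⟨x, ε⟩ n ((Finset.Icc (-(N : ℤ)) N).erase n) (fun i => ϰ i))).im := by
  set z : ℂ := ⟨x, ε⟩ with hz
  have hz0 : 0 < z.im := hε
  have hsa : IsSelfAdjoint (truncated ψ ϰ N) := isSelfAdjoint_sum_rankOne _ ϰ ψ
  have h1 := sum_inner_resolvent (fun n : ↥(Finset.Icc (-(N : ℤ)) N) => weighted ψ ϰ n) hz0.ne'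
    (res (truncated ψ ϰ N) z) (by
      rw [← truncated_eq_frameOp h]
      exact res_apply_sub hsa hz0.ne')
  have h2 : ∑ i, kernelFun x ε (eig ψ ϰ N i) =
      (∑ k, (gramEig (fun n : ↥(Finset.Icc (-(N : ℤ)) N) => weighted ψ ϰ n) k : ℂ) /
        (gramEig (fun n : ↥(Finset.Icc (-(N : ℤ)) N) => weighted ψ ϰ n) k - z)).im := by
    rw [Complex.im_sum]
    exact Finset.sum_congr rfl fun i _ => (im_div_sub x _ hε).symm
  rw [h2, ← h1, Complex.im_sum, ← Finset.sum_coe_sort (Finset.Icc (-(N : ℤ)) N)]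
  refine Finset.sum_congr rfl fun n _ => ?_
  rw [← inner_res_truncated hψ hz0 ϰ n.2, weighted, map_smul, inner_smul_left, inner_smul_right,
    Complex.conj_ofReal, ← mul_assoc, ← Complex.ofReal_mul, Real.mul_self_sqrt (h n),
    Complex.im_ofReal_mul]

variable (P₀ : Measure ℝ) [IsProbabilityMeasure P₀]

/-- Allows `ϰ n` to be integrated first with the other couplings frozen. Their joint law is
irrelevant beyond having mass one. -/
theorem map_eval_restrict_infinitePi {n : ℤ} {S : Finset ℤ} (hn : n ∉ S) :
    ∃ ν : Measure (S → ℝ), IsProbabilityMeasure ν ∧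
      (Measure.infinitePi fun _ : ℤ => P₀).map (fun ϰ => (ϰ n, fun i : S => ϰ i)) =
        P₀.prod ν := by
  set μ := Measure.infinitePi fun _ : ℤ => P₀ with hμ
  have hI : iIndepFun (fun (n : ℤ) (ϰ : ℤ → ℝ) => ϰ n) μ :=
    iIndepFun_infinitePi (P := fun _ : ℤ => P₀) (X := fun _ x => x) (fun _ => measurable_id)
  have h1 := hI.indepFun_finset {n} S (by simpa using hn) fun n => measurable_pi_apply n
  have hφ : Measurable fun y : ({n} : Finset ℤ) → ℝ => y ⟨n, by simp⟩ := measurable_pi_apply _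
  have h2 := h1.comp hφ measurable_id
  have hm : Measurable fun (ϰ : ℤ → ℝ) (i : S) => ϰ i := by fun_prop
  have h3 := (indepFun_iff_map_prod_eq_prod_map_map (measurable_pi_apply n).aemeasurable
    hm.aemeasurable).1 h2
  refine ⟨μ.map fun (ϰ : ℤ → ℝ) (i : S) => ϰ i,
    Measure.isProbabilityMeasure_map hm.aemeasurable, ?_⟩
  rw [h3]
  congr 1
  exact Measure.infinitePi_map_eval (fun _ : ℤ => P₀) n

variable {P₀}

/-- A Wegner type estimate for the truncated operator. -/
theorem lintegral_sum_le (hψ : IsAdmissible ψ) {ρ : ℝ → ℝ} (hρ_meas : Measurable ρ)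
    (hρ : P₀ = volume.withDensity fun x => ENNReal.ofReal (ρ x))
    {ρmax : ℝ} (hρmax : ∀ᵐ x ∂(volume : Measure ℝ), ρ x ≤ ρmax) {κ : ℝ} (hκ0 : 0 ≤ κ)
    (hκ : ∀ᵐ x ∂P₀, x ≤ κ) {z : ℂ} (hz : 0 < z.im) {n : ℤ} {S : Finset ℤ} (hn : n ∉ S) :
    ∫⁻ ϰ, ENNReal.ofReal (ϰ n * (diagRes ψ z n S (fun i => ϰ i) /
        (1 + ϰ n * diagRes ψ z n S (fun i => ϰ i))).im) ∂(Measure.infinitePi fun _ : ℤ => P₀) ≤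
      ENNReal.ofReal κ * (ENNReal.ofReal ρmax * ENNReal.ofReal Real.pi) := by
  obtain ⟨ν, hν, hmap⟩ := map_eval_restrict_infinitePi P₀ hn
  have hG := (continuous_diagRes ψ hz n S).measurable
  have hm : Measurable fun p : ℝ × (S → ℝ) => ENNReal.ofReal (p.1 * (diagRes ψ z n S p.2 /
      (1 + p.1 * diagRes ψ z n S p.2)).im) := by
    refine ENNReal.measurable_ofReal.comp (measurable_fst.mul (Complex.measurable_im.comp ?_))
    have h2 : Measurable fun p : ℝ × (S → ℝ) => diagRes ψ z n S p.2 := hG.comp measurable_snd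
    exact h2.div (measurable_const.add ((Complex.measurable_ofReal.comp measurable_fst).mul h2))
  have h1 := lintegral_map (μ := Measure.infinitePi fun _ : ℤ => P₀) hm
    (g := fun ϰ => (ϰ n, fun i : S => ϰ i)) (by fun_prop)
  rw [← h1, hmap, lintegral_prod_symm _ hm.aemeasurable]
  calc _ ≤ ∫⁻ _y, ENNReal.ofReal κ * (ENNReal.ofReal ρmax * ENNReal.ofReal Real.pi) ∂ν :=
        lintegral_mono fun y => lintegral_im_div_one_add_mul_le hρ_meas hρ hρmax hκ0 hκ
          (diagRes_im_pos hψ hz n S y)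
    _ = _ := by simp

/-- Makes the kernel, despite its factor `t`, a legitimate test function for weak convergence. -/
theorem kernelFun_bounded (x : ℝ) {ε : ℝ} (hε : 0 < ε) (t : ℝ) :
    ‖kernelFun x ε t‖ ≤ 1 + |x| / ε := by
  have hd : 0 < (t - x) ^ 2 + ε ^ 2 := by positivity
  rw [kernelFun, Real.norm_eq_abs, abs_mul, abs_of_pos (show 0 < ε / ((t - x) ^ 2 + ε ^ 2) by
    positivity)]
  have h1 : |t| ≤ |t - x| + |x| := by
    have := abs_add_le (t - x) x
    rwa [sub_add_cancel] at this
  have h2 : |t - x| * (ε / ((t - x) ^ 2 + ε ^ 2)) ≤ 1 := by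
    rw [← mul_div_assoc, div_le_one hd, ← sq_abs (t - x)]
    nlinarith [sq_nonneg (|t - x| - ε), abs_nonneg (t - x)]
  have h3 : ε / ((t - x) ^ 2 + ε ^ 2) ≤ 1 / ε := by
    rw [div_le_div_iff₀ hd hε]
    nlinarith [sq_nonneg (t - x)]
  calc _ ≤ (|t - x| + |x|) * (ε / ((t - x) ^ 2 + ε ^ 2)) := by gcongr
    _ = |t - x| * (ε / ((t - x) ^ 2 + ε ^ 2)) + |x| * (ε / ((t - x) ^ 2 + ε ^ 2)) := by ring
    _ ≤ 1 + |x| * (1 / ε) := by gcongr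
    _ = _ := by ring

theorem continuous_kernelFun (x : ℝ) {ε : ℝ} (hε : 0 < ε) : Continuous (kernelFun x ε) := by
  unfold kernelFun
  refine continuous_id.mul (continuous_const.div (by fun_prop) fun t => ?_)
  positivity

/-- The Poisson integrals of the measure `t dν(t)` are bounded. -/
theorem integral_kernelFun_le (hψ : IsAdmissible ψ) {ρ : ℝ → ℝ} (hρ_meas : Measurable ρ)
    (hρ : P₀ = volume.withDensity fun x => ENNReal.ofReal (ρ x))
    {ρmax : ℝ} (hρmax : ∀ᵐ x ∂(volume : Measure ℝ), ρ x ≤ ρmax) {κ : ℝ} (hκ0 : 0 ≤ κ)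
    (hκ : ∀ᵐ x ∂P₀, 0 < x ∧ x ≤ κ) {ν : Measure ℝ} (hν : IsIDSMeasure ψ P₀ ν) (x : ℝ) {ε : ℝ}
    (hε : 0 < ε) :
    ENNReal.ofReal (∫ t, kernelFun x ε t ∂ν) ≤
      ENNReal.ofReal κ * (ENNReal.ofReal ρmax * ENNReal.ofReal Real.pi) := by
  set μ := Measure.infinitePi fun _ : ℤ => P₀ with hμ
  set C := ENNReal.ofReal κ * (ENNReal.ofReal ρmax * ENNReal.ofReal Real.pi) with hC
  let f : ℝ →ᵇ ℝ := BoundedContinuousFunction.ofNormedAddCommGroup (kernelFun x ε)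
    (continuous_kernelFun x hε) _ (kernelFun_bounded x hε)
  set z : ℂ := ⟨x, ε⟩ with hz
  have hz0 : 0 < z.im := hε
  set g : ℕ → (ℤ → ℝ) → ℝ := fun N ϰ => (2 * N + 1 : ℝ)⁻¹ *
    ∑ n ∈ Finset.Icc (-(N : ℤ)) N, ϰ n *
      (diagRes ψ z n ((Finset.Icc (-(N : ℤ)) N).erase n) (fun i => ϰ i) /
      (1 + ϰ n * diagRes ψ z n ((Finset.Icc (-(N : ℤ)) N).erase n) (fun i => ϰ i))).im with hg
  have hterm : ∀ (S : Finset ℤ) (n : ℤ), Measurable fun ϰ : ℤ → ℝ =>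
      ϰ n * (diagRes ψ z n S (fun i => ϰ i) / (1 + ϰ n * diagRes ψ z n S (fun i => ϰ i))).im := by
    intro S n
    have h2 : Measurable fun ϰ : ℤ → ℝ => diagRes ψ z n S (fun i => ϰ i) :=
      (continuous_diagRes ψ hz0 n S).measurable.comp (by fun_prop)
    refine (measurable_pi_apply n).mul (Complex.measurable_im.comp (h2.div
      (measurable_const.add ((Complex.measurable_ofReal.comp (measurable_pi_apply n)).mul h2))))
  have hgm : ∀ N, Measurable (g N) := fun N =>
    measurable_const.mul (Finset.measurable_fun_sum _ fun n _ => hterm _ n)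
  have hpos := ae_infinitePi_forall P₀ hκ
  have hgle : ∀ N, ∫⁻ ϰ, ENNReal.ofReal (g N ϰ) ∂μ ≤ C := by
    intro N
    have h1 : ∀ᵐ ϰ ∂μ, ENNReal.ofReal (g N ϰ) = ENNReal.ofReal ((2 * N + 1 : ℝ)⁻¹) *
        ∑ n ∈ Finset.Icc (-(N : ℤ)) N, ENNReal.ofReal (ϰ n *
        (diagRes ψ z n ((Finset.Icc (-(N : ℤ)) N).erase n) (fun i => ϰ i) /
        (1 + ϰ n * diagRes ψ z n ((Finset.Icc (-(N : ℤ)) N).erase n) (fun i => ϰ i))).im) := by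
      filter_upwards [hpos] with ϰ hϰ
      rw [hg, ENNReal.ofReal_mul (by positivity), ENNReal.ofReal_sum_of_nonneg]
      intro n _
      exact mul_nonneg (hϰ n).1.le (im_div_one_add_mul_nonneg (diagRes_im_pos hψ hz0 n _ _) _)
    rw [lintegral_congr_ae h1, lintegral_const_mul _
      (Finset.measurable_fun_sum _ fun n _ => (hterm _ n).ennreal_ofReal),
      lintegral_finsetSum _ fun n _ => (hterm _ n).ennreal_ofReal]
    calc _ ≤ ENNReal.ofReal ((2 * N + 1 : ℝ)⁻¹) * ∑ n ∈ Finset.Icc (-(N : ℤ)) N, C := by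
          refine mul_le_mul_right (Finset.sum_le_sum fun n _ => ?_) _
          exact lintegral_sum_le hψ hρ_meas hρ hρmax hκ0 (hκ.mono fun x hx => hx.2) hz0
            (Finset.notMem_erase n _)
      _ = C := by
          rw [Finset.sum_const, Int.card_Icc, show ((N : ℤ) + 1 - -N).toNat = 2 * N + 1 by omega,
            nsmul_eq_mul, ← mul_assoc, ← ENNReal.ofReal_natCast, ← ENNReal.ofReal_mul (by positivity)]
          push_cast
          rw [inv_mul_cancel₀ (by positivity), ENNReal.ofReal_one, one_mul]
  have hlim : ∀ᵐ ϰ ∂μ, ENNReal.ofReal (∫ t, kernelFun x ε t ∂ν) =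
      liminf (fun N => ENNReal.ofReal (g N ϰ)) atTop := by
    filter_upwards [hν.tendsto, hpos] with ϰ h1 h2
    have h3 := ENNReal.tendsto_ofReal (h1 f)
    refine (Tendsto.liminf_eq (h3.congr fun N => ?_)).symm
    congr 1
    rw [integral_countingMeasure hψ (fun n => (h2 n).1), hg]
    congr 1
    exact sum_kernelFun_eig hψ (fun n => (h2 n).1.le) N x hε
  -- The limit is non-random, so it equals its expectation, and Fatou's lemma carries over the bound
  -- uniform in `N`.
  calc ENNReal.ofReal (∫ t, kernelFun x ε t ∂ν)
      = ∫⁻ _ϰ, ENNReal.ofReal (∫ t, kernelFun x ε t ∂ν) ∂μ := by simp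
    _ = ∫⁻ ϰ, liminf (fun N => ENNReal.ofReal (g N ϰ)) atTop ∂μ := lintegral_congr_ae hlim
    _ ≤ liminf (fun N => ∫⁻ ϰ, ENNReal.ofReal (g N ϰ) ∂μ) atTop :=
        lintegral_liminf_le' fun N => (hgm N).ennreal_ofReal.aemeasurable
    _ ≤ liminf (fun _ : ℕ => C) atTop := liminf_le_liminf (Eventually.of_forall hgle)
    _ = C := liminf_const C

end Wegner

end RankOneSum

namespace RankOneSum

/-! ### Measures with bounded Poisson integrals -/

section PoissonBound

/-- A measure all of whose Poisson integrals are bounded by `c π` is bounded by `c` times the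
Lebesgue measure on open sets. -/
theorem measure_isOpen_le_of_poisson_le {μ : Measure ℝ} [SFinite μ] {c : ℝ≥0∞}
    (h : ∀ (x ε : ℝ), 0 < ε →
      ∫⁻ t, ENNReal.ofReal (ε / ((t - x) ^ 2 + ε ^ 2)) ∂μ ≤ c * ENNReal.ofReal Real.pi)
    {U : Set ℝ} (hU : IsOpen U) : μ U ≤ c * volume U := by
  set ε : ℕ → ℝ := fun n => 1 / ((n : ℝ) + 1) with hε
  have hε0 : ∀ n, 0 < ε n := fun n => by positivity
  have hεlim : Tendsto ε atTop (𝓝 0) := tendsto_one_div_add_atTop_nhds_zero_nat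
  set g : ℝ → ℝ≥0∞ := U.indicator 1 with hg
  have hgm : Measurable g := measurable_one.indicator hU.measurableSet
  -- `J n` is `π` times the Poisson smoothing of the indicator of `U` at scale `ε n`. Tonelli moves
  -- the kernel onto `μ`, and openness of `U` gives the lower bound for the liminf.
  set J : ℕ → ℝ → ℝ≥0∞ := fun n t =>
    ∫⁻ s, g (ε n * s + t) * ENNReal.ofReal ((1 + s ^ 2)⁻¹) with hJ
  have hJm : ∀ n, Measurable (J n) := fun n =>
    Measurable.lintegral_prod_right' (f := fun p : ℝ × ℝ =>
      g (ε n * p.2 + p.1) * ENNReal.ofReal ((1 + p.2 ^ 2)⁻¹)) (by fun_prop)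
  have hJ_eq : ∀ n t, J n t = ∫⁻ x, g x * ENNReal.ofReal (ε n / ((x - t) ^ 2 + ε n ^ 2)) := by
    intro n t
    have := lintegral_mul_poisson (-t) (hε0 n) hgm
    simp only [sub_neg_eq_add, ← sub_eq_add_neg] at this
    exact this.symm
  have hJint : ∀ n, ∫⁻ t, J n t ∂μ ≤ c * ENNReal.ofReal Real.pi * volume U := by
    intro n
    simp_rw [hJ_eq]
    rw [lintegral_lintegral_swap (by fun_prop)]
    calc _ ≤ ∫⁻ x, g x * (c * ENNReal.ofReal Real.pi) := by
          refine lintegral_mono fun x => ?_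
          rw [lintegral_const_mul _ (by fun_prop)]
          refine mul_le_mul_right ?_ _
          refine le_trans (le_of_eq ?_) (h x (ε n) (hε0 n))
          refine lintegral_congr fun t => ?_
          rw [← neg_sub, neg_sq]
      _ = _ := by
          rw [lintegral_mul_const _ hgm, hg, lintegral_indicator_one hU.measurableSet, mul_comm]
  have hpt : ∀ t, g t * ENNReal.ofReal Real.pi ≤ liminf (fun n => J n t) atTop := by
    intro t
    calc g t * ENNReal.ofReal Real.pi
        = ∫⁻ s : ℝ, g t * ENNReal.ofReal ((1 + s ^ 2)⁻¹) := by
          rw [lintegral_const_mul _ (by fun_prop), lintegral_inv_one_add_sq]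
      _ ≤ ∫⁻ s : ℝ, liminf (fun n => g (ε n * s + t) * ENNReal.ofReal ((1 + s ^ 2)⁻¹)) atTop := by
          refine lintegral_mono fun s => ?_
          by_cases ht : t ∈ U
          · have h1 : Tendsto (fun n => ε n * s + t) atTop (𝓝 t) := by
              have := (hεlim.mul_const s).add_const t
              simpa using this
            have h2 : ∀ᶠ n in atTop, g (ε n * s + t) = g t := by
              filter_upwards [h1.eventually (hU.mem_nhds ht)] with n hn
              rw [hg, Set.indicator_of_mem hn, Set.indicator_of_mem ht]
              rfl
            refine le_of_eq (Tendsto.liminf_eq (tendsto_const_nhds.congr' ?_)).symm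
            filter_upwards [h2] with n hn
            rw [hn]
          · rw [hg, Set.indicator_of_notMem ht, zero_mul]
            exact zero_le
      _ ≤ _ := lintegral_liminf_le fun n => by fun_prop
  have hfin : μ U * ENNReal.ofReal Real.pi ≤ c * volume U * ENNReal.ofReal Real.pi := by
    calc μ U * ENNReal.ofReal Real.pi = ∫⁻ t, g t * ENNReal.ofReal Real.pi ∂μ := by
          rw [lintegral_mul_const _ hgm, hg, lintegral_indicator_one hU.measurableSet]
      _ ≤ ∫⁻ t, liminf (fun n => J n t) atTop ∂μ := lintegral_mono hpt
      _ ≤ liminf (fun n => ∫⁻ t, J n t ∂μ) atTop := lintegral_liminf_le hJm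
      _ ≤ liminf (fun _ : ℕ => c * ENNReal.ofReal Real.pi * volume U) atTop :=
          liminf_le_liminf (Eventually.of_forall hJint)
      _ = _ := by rw [liminf_const]; ring
  exact (ENNReal.mul_le_mul_iff_left (by simpa using Real.pi_pos) ENNReal.ofReal_ne_top).1 hfin

theorem measure_le_of_poisson_le {μ : Measure ℝ} [SFinite μ] {c : ℝ≥0∞} (hc : c ≠ ∞)
    (h : ∀ (x ε : ℝ), 0 < ε →
      ∫⁻ t, ENNReal.ofReal (ε / ((t - x) ^ 2 + ε ^ 2)) ∂μ ≤ c * ENNReal.ofReal Real.pi)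
    (A : Set ℝ) : μ A ≤ c * volume A := by
  have : (c • (volume : Measure ℝ)).OuterRegular := Measure.OuterRegular.smul _ hc
  change μ A ≤ (c • (volume : Measure ℝ)) A
  rw [Set.measure_eq_iInf_isOpen A (c • (volume : Measure ℝ))]
  refine le_iInf fun U => le_iInf fun hAU => le_iInf fun hU => ?_
  exact (measure_mono hAU).trans (measure_isOpen_le_of_poisson_le h hU)

end PoissonBound

/-! ### From the bound on `t dν(t)` to the density of `ν` -/

section Density

variable {ν : Measure ℝ}

theorem withDensity_id_le [IsProbabilityMeasure ν] (hν0 : ∀ᵐ x ∂ν, 0 ≤ x) {c : ℝ≥0∞} (hc : c ≠ ∞)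
    (h : ∀ (x ε : ℝ), 0 < ε →
      ENNReal.ofReal (∫ t, kernelFun x ε t ∂ν) ≤ c * ENNReal.ofReal Real.pi) (A : Set ℝ) :
    ν.withDensity ENNReal.ofReal A ≤ c * volume A := by
  refine measure_le_of_poisson_le hc (fun x ε hε => ?_) A
  refine le_trans (le_of_eq ?_) (h x ε hε)
  rw [lintegral_withDensity_eq_lintegral_mul _ ENNReal.measurable_ofReal (by fun_prop),
    ofReal_integral_eq_lintegral_ofReal]
  · refine lintegral_congr_ae ?_
    filter_upwards [hν0] with t ht
    rw [kernelFun, ENNReal.ofReal_mul ht]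
    rfl
  · exact Integrable.of_bound (continuous_kernelFun x hε).aestronglyMeasurable _
      (Eventually.of_forall (kernelFun_bounded x hε))
  · filter_upwards [hν0] with t ht
    exact mul_nonneg ht (by positivity)

/-- On a Lebesgue null set the integral of `t` against `ν` vanishes, and `t > 0` holds `ν`-almost
everywhere off the origin. -/
theorem restrict_compl_zero_absolutelyContinuous (hν0 : ∀ᵐ x ∂ν, 0 ≤ x) {c : ℝ≥0∞}
    (h : ∀ A : Set ℝ, ν.withDensity ENNReal.ofReal A ≤ c * volume A) :
    ν.restrict {0}ᶜ ≪ volume := by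
  refine Measure.AbsolutelyContinuous.mk fun s hs hs0 => ?_
  have h1 : ν.withDensity ENNReal.ofReal s = 0 := by
    have := h s
    rwa [hs0, mul_zero, nonpos_iff_eq_zero] at this
  rw [withDensity_apply _ hs, lintegral_eq_zero_iff ENNReal.measurable_ofReal,
    EventuallyEq, ae_restrict_iff' hs] at h1
  rw [Measure.restrict_apply hs, measure_eq_zero_iff_ae_notMem]
  filter_upwards [h1, hν0] with x hx hx0 hxs
  have h2 := hx hxs.1
  rw [Pi.zero_apply, ENNReal.ofReal_eq_zero] at h2
  exact hxs.2 (le_antisymm h2 hx0)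

/-- Only the inequality between the absolutely continuous part and `ν` enters, so a possible atom at
zero does no harm. -/
theorem rnDeriv_le {C : ℝ} (h : ∀ A : Set ℝ,
      ν.withDensity ENNReal.ofReal A ≤ ENNReal.ofReal C * volume A) :
    ∀ᵐ t ∂(volume : Measure ℝ), 0 < t → ν.rnDeriv volume t ≤ ENNReal.ofReal (C / t) := by
  have hr := Measure.measurable_rnDeriv ν volume
  have h1 : (fun t => ν.rnDeriv volume t * ENNReal.ofReal t) ≤ᵐ[volume]
      fun _ => ENNReal.ofReal C := by
    refine ae_le_of_forall_setLIntegral_le_of_sigmaFinite (by fun_prop) fun s hs _ => ?_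
    have h2 : ∫⁻ t in s, ν.rnDeriv volume t * ENNReal.ofReal t =
        ∫⁻ t in s, ENNReal.ofReal t ∂(volume.withDensity (ν.rnDeriv volume)) := by
      rw [restrict_withDensity hs,
        lintegral_withDensity_eq_lintegral_mul _ hr ENNReal.measurable_ofReal]
      rfl
    rw [h2, setLIntegral_const]
    calc _ ≤ ∫⁻ t in s, ENNReal.ofReal t ∂ν :=
          lintegral_mono' (Measure.restrict_mono le_rfl (Measure.withDensity_rnDeriv_le ν volume))
            le_rfl
      _ = ν.withDensity ENNReal.ofReal s := (withDensity_apply _ hs).symm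
      _ ≤ _ := h s
  filter_upwards [h1] with t ht ht0
  rw [ENNReal.ofReal_div_of_pos ht0, ENNReal.le_div_iff_mul_le (Or.inl (by simpa using ht0))
    (Or.inl ENNReal.ofReal_ne_top)]
  exact ht

end Density

end RankOneSum

namespace RankOneSum

/-! ### Uniqueness of Fourier coefficients of integrable functions -/

section FourierUniqueness

variable {T : ℝ} [hT : Fact (0 < T)]

theorem integrable_continuousMap_mul {F : AddCircle T → ℂ}
    (hF : Integrable F AddCircle.haarAddCircle) (q : C(AddCircle T, ℂ)) :
    Integrable (fun x => q x * F x) AddCircle.haarAddCircle :=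
  hF.bdd_mul q.continuous.aestronglyMeasurable (Eventually.of_forall q.norm_coe_le_norm)

/-- An integrable function on the circle which is orthogonal to all trigonometric monomials is
orthogonal to all continuous functions. -/
theorem integral_continuousMap_mul_eq_zero {F : AddCircle T → ℂ}
    (hF : Integrable F AddCircle.haarAddCircle)
    (h : ∀ n : ℤ, ∫ x, fourier n x * F x ∂AddCircle.haarAddCircle = 0) (q : C(AddCircle T, ℂ)) :
    ∫ x, q x * F x ∂AddCircle.haarAddCircle = 0 := by
  let L : C(AddCircle T, ℂ) →L[ℂ] ℂ := LinearMap.mkContinuous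
    { toFun := fun q => ∫ x, q x * F x ∂AddCircle.haarAddCircle
      map_add' := fun p q => by
        rw [← integral_add (integrable_continuousMap_mul hF p) (integrable_continuousMap_mul hF q)]
        simp only [ContinuousMap.add_apply, add_mul]
      map_smul' := fun c q => by
        simp only [ContinuousMap.smul_apply, smul_eq_mul, mul_assoc, integral_const_mul,
          RingHom.id_apply] }
    (∫ x, ‖F x‖ ∂AddCircle.haarAddCircle) (fun q => by
      rw [mul_comm, ← integral_const_mul]
      refine norm_integral_le_of_norm_le (hF.norm.const_mul _) (Eventually.of_forall fun x => ?_)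
      rw [norm_mul]
      exact mul_le_mul_of_nonneg_right (q.norm_coe_le_norm x) (norm_nonneg _))
  have h1 : (Submodule.span ℂ (Set.range (fourier (T := T)))).topologicalClosure ≤
      L.toLinearMap.ker := by
    refine Submodule.topologicalClosure_minimal _ ?_ L.isClosed_ker
    rw [Submodule.span_le]
    rintro _ ⟨n, rfl⟩
    exact h n
  rw [span_fourier_closure_eq_top] at h1
  exact h1 (Submodule.mem_top (x := q))

/-- An integrable function on the circle is determined by its Fourier coefficients. -/
theorem ae_eq_zero_of_integral_fourier_mul_eq_zero {F : AddCircle T → ℂ}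
    (hF : Integrable F AddCircle.haarAddCircle)
    (h : ∀ n : ℤ, ∫ x, fourier n x * F x ∂AddCircle.haarAddCircle = 0) :
    F =ᵐ[AddCircle.haarAddCircle] 0 := by
  refine ae_eq_zero_of_forall_setIntegral_isClosed_eq_zero hF fun s hs => ?_
  have h1 : Tendsto
      (fun n => ∫ x, ((hs.apprSeq n x : ℝ) : ℂ) * F x ∂AddCircle.haarAddCircle)
      atTop (𝓝 (∫ x, s.indicator F x ∂AddCircle.haarAddCircle)) := by
    refine tendsto_integral_of_dominated_convergence (fun x => ‖F x‖) (fun n => ?_) hF.norm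
      (fun n => Eventually.of_forall fun x => ?_) (Eventually.of_forall fun x => ?_)
    · refine AEStronglyMeasurable.mul ?_ hF.aestronglyMeasurable
      exact (Complex.continuous_ofReal.comp
        (NNReal.continuous_coe.comp (hs.apprSeq n).continuous)).aestronglyMeasurable
    · rw [norm_mul, Complex.norm_real, NNReal.norm_eq]
      exact mul_le_of_le_one_left (norm_nonneg _)
        (HasOuterApproxClosed.apprSeq_apply_le_one hs n x)
    · have h2 := (tendsto_pi_nhds.1 (HasOuterApproxClosed.tendsto_apprSeq hs)) x
      have h3 := ((Complex.continuous_ofReal.comp NNReal.continuous_coe).tendsto _).comp h2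
      have h4 : s.indicator F x =
          (Complex.ofReal ∘ NNReal.toReal) (s.indicator (fun _ => 1) x) * F x := by
        by_cases hx : x ∈ s <;> simp [hx]
      rw [h4]
      exact h3.mul_const (F x)
  have h2 : ∀ n, ∫ x, ((hs.apprSeq n x : ℝ) : ℂ) * F x ∂AddCircle.haarAddCircle = 0 := fun n =>
    integral_continuousMap_mul_eq_zero hF h ⟨fun x => ((hs.apprSeq n x : ℝ) : ℂ),
      Complex.continuous_ofReal.comp (NNReal.continuous_coe.comp (hs.apprSeq n).continuous)⟩
  simp_rw [h2] at h1
  rw [← integral_indicator hs.measurableSet]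
  exact tendsto_nhds_unique h1 tendsto_const_nhds

end FourierUniqueness

/-! ### Cyclic vectors for multiplication by characters -/

section Modulation

variable {T : ℝ} [hT : Fact (0 < T)]

theorem memLp_fourier_mul (φ : Lp ℂ 2 (AddCircle.haarAddCircle (T := T))) (m : ℤ) :
    MemLp (fun x => fourier m x * φ x) 2 (AddCircle.haarAddCircle (T := T)) := by
  refine (Lp.memLp φ).of_le ?_ (Eventually.of_forall fun x => ?_)
  · exact (fourier m).continuous.aestronglyMeasurable.mul (Lp.aestronglyMeasurable φ)
  · rw [norm_mul, fourier_apply, Circle.norm_coe, one_mul]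

/-- The function `e_m φ` as an element of `L²`. -/
noncomputable def modulation (φ : Lp ℂ 2 (AddCircle.haarAddCircle (T := T))) (m : ℤ) :
    Lp ℂ 2 (AddCircle.haarAddCircle (T := T)) :=
  (memLp_fourier_mul φ m).toLp _

theorem coeFn_modulation (φ : Lp ℂ 2 (AddCircle.haarAddCircle (T := T))) (m : ℤ) :
    modulation φ m =ᵐ[AddCircle.haarAddCircle] fun x => fourier m x * φ x :=
  MemLp.coeFn_toLp _

theorem inner_fourierLp_modulation (φ : Lp ℂ 2 (AddCircle.haarAddCircle (T := T))) (n m : ℤ) :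
    inner ℂ (fourierLp 2 n) (modulation φ m) = fourierCoeff φ (n - m) := by
  rw [← coe_fourierBasis, ← fourierBasis.repr_apply_apply, fourierBasis_repr,
    fourierCoeff_congr_ae (coeFn_modulation φ m)]
  refine integral_congr_ae (Eventually.of_forall fun x => ?_)
  simp only [smul_eq_mul]
  rw [← mul_assoc, ← fourier_add]
  congr 3
  ring

/-- Wiener's theorem on cyclic vectors: the modulations of an almost everywhere non-zero function
span a dense subspace of `L²`. -/
theorem topologicalClosure_span_modulation {φ : Lp ℂ 2 (AddCircle.haarAddCircle (T := T))}
    (hφ : ∀ᵐ x ∂(AddCircle.haarAddCircle (T := T)), φ x ≠ 0) :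
    (Submodule.span ℂ (Set.range (modulation φ))).topologicalClosure = ⊤ := by
  rw [Submodule.topologicalClosure_eq_top_iff, Submodule.eq_bot_iff]
  intro f hf
  -- Orthogonality to all modulations says that the integrable function `conj φ · f` has vanishing
  -- Fourier coefficients.
  have h0 : ∀ n : ℤ, ∫ x, fourier n x * inner ℂ (φ x) (f x) ∂AddCircle.haarAddCircle = 0 := by
    intro n
    have h1 := (Submodule.mem_orthogonal _ _).1 hf (modulation φ (-n))
      (Submodule.subset_span ⟨-n, rfl⟩)
    rw [L2.inner_def] at h1
    rw [← h1]
    refine integral_congr_ae ?_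
    filter_upwards [coeFn_modulation φ (-n)] with x hx
    rw [hx, RCLike.inner_apply', RCLike.inner_apply', map_mul, ← fourier_neg, neg_neg, mul_assoc]
  have h1 := ae_eq_zero_of_integral_fourier_mul_eq_zero (L2.integrable_inner φ f) h0
  rw [Lp.eq_zero_iff_ae_eq_zero]
  filter_upwards [h1, hφ] with x hx hx'
  rw [RCLike.inner_apply'] at hx
  simpa [hx'] using hx

end Modulation

/-! ### The symbol and the dual resolvent bound -/

section Symbol

variable {H : Type*} [NormedAddCommGroup H] [InnerProductSpace ℂ H] {ψ : ℤ → H}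

theorem fourierCoeff_symbol (hψ : IsAdmissible ψ) (n : ℤ) :
    fourierCoeff (symbol ψ) n = gramEntry ψ n 0 := by
  have hmem : Memℓp (fun n => gramEntry ψ n 0) 2 := by
    refine memℓp_gen ?_
    refine (summable_sq_gramEntry hψ).congr fun n => ?_
    norm_num
  have h1 := HilbertBasis.hasSum_repr_symm (fourierBasis (T := (1 : ℝ))) ⟨_, hmem⟩
  rw [coe_fourierBasis] at h1
  have h2 : symbol ψ = (fourierBasis (T := (1 : ℝ))).repr.symm ⟨_, hmem⟩ := h1.tsum_eq
  rw [← fourierBasis_repr, h2, LinearIsometryEquiv.apply_symm_apply]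

/-- The bridge between the circle and `H`: approximation by modulations of the symbol becomes a
pairing with a finite combination of the `ψ m`. -/
theorem inner_fourierLp_modulation_symbol (hψ : IsAdmissible ψ) (n m : ℤ) :
    inner ℂ (fourierLp 2 n) (modulation (symbol ψ) m) = inner ℂ (ψ m) (ψ n) := by
  rw [inner_fourierLp_modulation, fourierCoeff_symbol hψ, inner_eq_gramEntry_sub hψ]

/-- If the symbol is almost everywhere non-zero, `e_0` is approximated by finite linear combinations
of the modulated symbol. -/
theorem exists_norm_sub_sum_modulation_lt
    (h0 : ∀ᵐ k ∂(AddCircle.haarAddCircle (T := (1 : ℝ))), symbol ψ k ≠ 0) {η : ℝ} (hη : 0 < η) :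
    ∃ c : ℤ →₀ ℂ, ‖fourierLp 2 0 - c.sum fun m a => a • modulation (symbol ψ) m‖ < η := by
  have h1 : fourierLp (T := (1 : ℝ)) 2 0 ∈
      (Submodule.span ℂ (Set.range (modulation (symbol ψ)))).topologicalClosure := by
    rw [topologicalClosure_span_modulation h0]
    trivial
  obtain ⟨u, hu, hu'⟩ := Metric.mem_closure_iff.1 h1 η hη
  obtain ⟨c, rfl⟩ := Finsupp.mem_span_range_iff_exists_finsupp.1 hu
  exact ⟨c, by rwa [dist_eq_norm] at hu'⟩

/-- A dual, regularised form of: the distance of a vector `ψ (f j)` to the span of the others is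
controlled from below, when the symbol is almost everywhere non-zero. -/
theorem exists_two_mul_re_le (hψ : IsAdmissible ψ)
    (h0 : ∀ᵐ k ∂(AddCircle.haarAddCircle (T := (1 : ℝ))), symbol ψ k ≠ 0) {η : ℝ} (hη : 0 < η) :
    ∃ K : ℝ, ∀ (δ : ℝ), 0 < δ → ∀ {ι : Type} [Fintype ι] (f : ι → ℤ),
      Function.Injective f → ∀ (j : ι) (x : ι → ℂ),
      2 * (x j).re - ‖∑ i, x i • ψ (f i)‖ ^ 2 - δ * ∑ i, ‖x i‖ ^ 2 ≤ K + η ^ 2 / δ := by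
  obtain ⟨c, hc⟩ := exists_norm_sub_sum_modulation_lt h0 hη
  set U := c.sum fun m a => a • modulation (symbol ψ) m with hU
  set Y : H := c.sum fun m a => starRingEnd ℂ a • ψ m with hY
  refine ⟨‖Y‖ ^ 2, fun δ hδ ι _ f hf j x => ?_⟩
  -- Translating by `-f j` moves the distinguished index to `0`, so one approximation of `e_0`, and
  -- hence one `K`, serves every `j` and every family.
  set Z : H := ∑ i, x i • ψ (f i + -f j) with hZ
  have hZn : ‖Z‖ = ‖∑ i, x i • ψ (f i)‖ := norm_sum_shift hψ Finset.univ x f (-f j)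
  have hfj : Function.Injective fun i => f i + -f j := (add_left_injective _).comp hf
  set X : Lp ℂ 2 (AddCircle.haarAddCircle (T := (1 : ℝ))) :=
    ∑ i, starRingEnd ℂ (x i) • fourierLp 2 (f i + -f j) with hX
  have hon : Orthonormal ℂ fun i => fourierLp (T := (1 : ℝ)) 2 (f i + -f j) :=
    orthonormal_fourier.comp _ hfj
  have hXn : ‖X‖ ^ 2 = ∑ i, ‖x i‖ ^ 2 := by
    have h1 := hon.inner_sum (fun i => starRingEnd ℂ (x i)) (fun i => starRingEnd ℂ (x i))
      Finset.univ
    rw [← hX, inner_self_eq_ofReal_norm_sq] at h1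
    simp only [RingHomCompTriple.comp_apply, RingHom.id_apply, Complex.mul_conj'] at h1
    exact_mod_cast h1
  have hX0 : inner ℂ X (fourierLp 2 0) = x j := by
    have h1 := hon.inner_left_fintype (fun i => starRingEnd ℂ (x i)) j
    simp only [add_neg_cancel, RingHomCompTriple.comp_apply, RingHom.id_apply] at h1
    exact h1
  have hXU : inner ℂ X U = inner ℂ Y Z := by
    rw [hX, hU, hY, hZ, Finsupp.sum, Finsupp.sum, sum_inner, sum_inner]
    simp_rw [inner_sum]
    rw [Finset.sum_comm]
    simp_rw [inner_smul_left, inner_smul_right, inner_fourierLp_modulation_symbol hψ]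
    refine Finset.sum_congr rfl fun m _ => Finset.sum_congr rfl fun i _ => ?_
    simp only [RingHomCompTriple.comp_apply, RingHom.id_apply]
    ring
  have h2 : x j = inner ℂ Y Z + inner ℂ X (fourierLp 2 0 - U) := by
    rw [inner_sub_right, hX0, hXU]; ring
  have h3 : (x j).re ≤ ‖Y‖ * ‖Z‖ + ‖X‖ * η := by
    rw [h2, Complex.add_re]
    refine add_le_add ((Complex.re_le_norm _).trans (norm_inner_le_norm _ _))
      ((Complex.re_le_norm _).trans ((norm_inner_le_norm _ _).trans ?_))
    exact mul_le_mul_of_nonneg_left hc.le (norm_nonneg _)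
  have h4 : 2 * (‖X‖ * η) ≤ δ * ‖X‖ ^ 2 + η ^ 2 / δ := by
    have h5 : δ * ‖X‖ ^ 2 + η ^ 2 / δ - 2 * (‖X‖ * η) = (δ * ‖X‖ - η) ^ 2 / δ := by
      field_simp
      ring
    have h6 : 0 ≤ (δ * ‖X‖ - η) ^ 2 / δ := by positivity
    linarith
  rw [← hZn, ← hXn]
  nlinarith [sq_nonneg (‖Y‖ - ‖Z‖)]

end Symbol

end RankOneSum

namespace RankOneSum

/-! ### Absence of an atom at the origin -/

section Atom

variable {H : Type*} [NormedAddCommGroup H] [InnerProductSpace ℂ H] {ψ : ℤ → H}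

theorem sum_inv_eig_add_le {a κ δ η K : ℝ} (ha : 0 < a) (hδ : 0 < δ)
    (hK : ∀ (δ : ℝ), 0 < δ → ∀ {ι : Type} [Fintype ι] (f : ι → ℤ),
      Function.Injective f → ∀ (j : ι) (x : ι → ℂ),
      2 * (x j).re - ‖∑ i, x i • ψ (f i)‖ ^ 2 - δ * ∑ i, ‖x i‖ ^ 2 ≤ K + η ^ 2 / δ)
    {ϰ : ℤ → ℝ} (h : ∀ n, a ≤ ϰ n ∧ ϰ n ≤ κ) (N : ℕ) :
    ∑ k, (eig ψ ϰ N k + δ)⁻¹ ≤ (2 * N + 1) * ((K + η ^ 2 / (δ / κ)) / a) := by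
  have hκ : 0 < κ := ha.trans_le ((h 0).1.trans (h 0).2)
  have hϰ : ∀ n, 0 < ϰ n := fun n => ha.trans_le (h n).1
  have h1 := sum_inv_gramEig_add_le (fun n : ↥(Finset.Icc (-(N : ℤ)) N) => weighted ψ ϰ n)
    (C := (K + η ^ 2 / (δ / κ)) / a) hδ fun x j => ?_
  · rw [card_Icc_neg] at h1
    push_cast at h1
    exact h1
  have hK' := hK (δ / κ) (by positivity) (fun i : ↥(Finset.Icc (-(N : ℤ)) N) => (i : ℤ))
    Subtype.val_injective j
  have hM : 0 ≤ K + η ^ 2 / (δ / κ) := by simpa using hK' 0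
  set s : ℤ → ℂ := fun n => ((√(ϰ n) : ℝ) : ℂ) with hs
  have hsn : ∀ n, ‖s n‖ ^ 2 = ϰ n := fun n => by
    rw [hs, Complex.norm_real, Real.norm_eq_abs, sq_abs, Real.sq_sqrt (hϰ n).le]
  -- The factor `s i` turns `ψ i` into the weighted vector, and the extra `s j` makes every term
  -- carry the common factor `ϰ j ≥ a`. The choice `δ / κ` compensates `ϰ i ≤ κ` in the penalty
  -- term.
  have hy := hK' fun i => s j * (s i * x i)
  have e1 : (s j * (s j * x j)).re = ϰ j * (x j).re := by
    rw [← mul_assoc, hs, ← Complex.ofReal_mul, Real.mul_self_sqrt (hϰ j).le, Complex.re_ofReal_mul]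
  have e2 : ∑ i : ↥(Finset.Icc (-(N : ℤ)) N), (s j * (s i * x i)) • ψ i =
      s j • ∑ i : ↥(Finset.Icc (-(N : ℤ)) N), x i • weighted ψ ϰ i := by
    rw [Finset.smul_sum]
    refine Finset.sum_congr rfl fun i _ => ?_
    rw [weighted, smul_smul, smul_smul, mul_comm (s i), mul_assoc]
  have e3 : δ / κ * ∑ i : ↥(Finset.Icc (-(N : ℤ)) N), ‖s j * (s i * x i)‖ ^ 2 ≤
      ϰ j * (δ * ∑ i, ‖x i‖ ^ 2) := by
    rw [Finset.mul_sum, Finset.mul_sum, Finset.mul_sum]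
    refine Finset.sum_le_sum fun i _ => ?_
    rw [norm_mul, norm_mul, mul_pow, mul_pow, hsn, hsn]
    have : ϰ i / κ ≤ 1 := (div_le_one hκ).2 (h i).2
    calc _ = (ϰ i / κ) * (ϰ j * (δ * ‖x i‖ ^ 2)) := by ring
      _ ≤ 1 * (ϰ j * (δ * ‖x i‖ ^ 2)) := by
          have := hϰ j
          gcongr
      _ = _ := one_mul _
  rw [e1, e2, norm_smul, mul_pow, hsn] at hy
  rw [le_div_iff₀ ha]
  set Q := 2 * (x j).re - ‖∑ i : ↥(Finset.Icc (-(N : ℤ)) N), x i • weighted ψ ϰ i‖ ^ 2 -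
    δ * ∑ i, ‖x i‖ ^ 2 with hQ
  have e4 : Q * ϰ j ≤ K + η ^ 2 / (δ / κ) := by
    rw [hQ]
    linarith
  rcases le_or_gt Q 0 with hQ0 | hQ0
  · exact (mul_nonpos_of_nonpos_of_nonneg hQ0 ha.le).trans hM
  · exact (mul_le_mul_of_nonneg_left (h j).1 hQ0.le).trans e4

/-- The function `δ / (|t| + δ)`. -/
noncomputable def atomFun (δ : ℝ) (hδ : 0 < δ) : ℝ →ᵇ ℝ :=
  BoundedContinuousFunction.ofNormedAddCommGroup (fun t => δ / (|t| + δ))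
    (by
      refine continuous_const.div (by fun_prop) fun t => ?_
      positivity) 1
    fun t => by
      rw [Real.norm_of_nonneg (by positivity)]
      exact div_le_one_of_le₀ (by linarith [abs_nonneg t]) (by positivity)

variable {P₀ : Measure ℝ} [IsProbabilityMeasure P₀] {ν : Measure ℝ}

theorem ae_good_sequence {p : ℝ → Prop} (hP : ∀ᵐ x ∂P₀, p x) (hν : IsIDSMeasure ψ P₀ ν) :
    ∃ ϰ : ℤ → ℝ, (∀ n, p (ϰ n)) ∧ ∀ f : ℝ →ᵇ ℝ,
      Tendsto (fun N : ℕ => ∫ x, f x ∂(countingMeasure ψ ϰ N)) atTop (𝓝 (∫ x, f x ∂ν)) :=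
  ((ae_infinitePi_forall P₀ hP).and hν.tendsto).exists

theorem ae_nonneg_of_isIDSMeasure (hψ : IsAdmissible ψ) (hP : ∀ᵐ x ∂P₀, 0 < x)
    (hν : IsIDSMeasure ψ P₀ ν) : ∀ᵐ x ∂ν, 0 ≤ x := by
  have := hν.isProbabilityMeasure
  obtain ⟨ϰ, hϰ, hlim⟩ := ae_good_sequence hP hν
  exact ae_mem_of_tendsto_integral isClosed_Ici Set.nonempty_Ici (Eventually.of_forall fun N =>
    ae_countingMeasure hψ hϰ N (p := fun x => x ∈ Set.Ici 0) fun i => (eig_pos hψ hϰ N i).le) hlim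

/-- If the symbol is almost everywhere non-zero, the integrated density of states measure has no
atom at the origin. -/
theorem measure_singleton_zero_eq_zero (hψ : IsAdmissible ψ) {a κ : ℝ} (ha : 0 < a)
    (hP : ∀ᵐ x ∂P₀, a ≤ x ∧ x ≤ κ)
    (h0 : ∀ᵐ k ∂(AddCircle.haarAddCircle (T := (1 : ℝ))), symbol ψ k ≠ 0)
    (hν : IsIDSMeasure ψ P₀ ν) : ν {0} = 0 := by
  have := hν.isProbabilityMeasure
  obtain ⟨ϰ, hϰ, hlim⟩ := ae_good_sequence hP hν
  have hpos : ∀ n, 0 < ϰ n := fun n => ha.trans_le (hϰ n).1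
  have key : ∀ η : ℝ, 0 < η → ν.real {0} ≤ η ^ 2 * κ / a := by
    intro η hη
    obtain ⟨K, hK⟩ := exists_two_mul_re_le hψ h0 hη
    -- The function `δ / (|t| + δ)` dominates the indicator of `{0}`. Since `K` depends on `η`, the
    -- limit `δ → 0` must be taken before `η → 0`.
    have h1 : ∀ δ : ℝ, 0 < δ → ν.real {0} ≤ (δ * K + η ^ 2 * κ) / a := by
      intro δ hδ
      have h2 : ∫ x, atomFun δ hδ x ∂ν ≤ (δ * K + η ^ 2 * κ) / a := by
        refine le_of_tendsto' (hlim (atomFun δ hδ)) fun N => ?_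
        rw [integral_countingMeasure hψ hpos]
        have h3 := sum_inv_eig_add_le ha hδ hK hϰ N
        have h4 : ∑ i, atomFun δ hδ (eig ψ ϰ N i) = δ * ∑ i, (eig ψ ϰ N i + δ)⁻¹ := by
          rw [Finset.mul_sum]
          refine Finset.sum_congr rfl fun i _ => ?_
          change δ / (|eig ψ ϰ N i| + δ) = _
          rw [abs_of_pos (eig_pos hψ hpos N i), div_eq_mul_inv]
        rw [h4, inv_mul_le_iff₀ (by positivity)]
        calc _ ≤ δ * ((2 * N + 1) * ((K + η ^ 2 / (δ / κ)) / a)) := by gcongr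
          _ = _ := by field_simp
      refine le_trans ?_ h2
      rw [← integral_indicator_one (measurableSet_singleton 0)]
      refine integral_mono ((integrable_const 1).indicator (measurableSet_singleton 0))
        ((atomFun δ hδ).integrable ν) fun t => ?_
      change _ ≤ δ / (|t| + δ)
      by_cases ht : t = 0
      · simp [ht, hδ.ne']
      · rw [Set.indicator_of_notMem (s := {0}) ht]
        positivity
    have h5 : Tendsto (fun δ : ℝ => (δ * K + η ^ 2 * κ) / a) (𝓝[>] 0)
        (𝓝 ((0 * K + η ^ 2 * κ) / a)) := by
      refine tendsto_nhdsWithin_of_tendsto_nhds ?_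
      exact (((continuous_id.mul continuous_const).add continuous_const).div_const a).tendsto 0
    rw [zero_mul, zero_add] at h5
    exact ge_of_tendsto h5 (eventually_mem_nhdsWithin.mono fun δ hδ => h1 δ hδ)
  have h6 : Tendsto (fun η : ℝ => η ^ 2 * κ / a) (𝓝[>] 0) (𝓝 (0 ^ 2 * κ / a)) := by
    refine tendsto_nhdsWithin_of_tendsto_nhds ?_
    exact (((continuous_id.pow 2).mul continuous_const).div_const a).tendsto 0
  have h7 : ν.real {0} ≤ 0 ^ 2 * κ / a :=
    ge_of_tendsto h6 (eventually_mem_nhdsWithin.mono fun η hη => key η hη)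
  rw [zero_pow two_ne_zero, zero_mul, zero_div] at h7
  exact (measureReal_eq_zero_iff).1 (le_antisymm h7 measureReal_nonneg)

end Atom

/-! ### Bounds on the couplings -/

section Support

theorem exists_pos_ae_le_and_le_sSup_support {P₀ : Measure ℝ} [IsProbabilityMeasure P₀]
    (hcompact : IsCompact P₀.support) (hpos : P₀.support ⊆ Set.Ioi 0) :
    ∃ a, 0 < a ∧ ∀ᵐ x ∂P₀, a ≤ x ∧ x ≤ sSup P₀.support := by
  have hmem : ∀ᵐ x ∂P₀, x ∈ P₀.support := Measure.support_mem_ae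
  have hne : P₀.support.Nonempty := hmem.exists
  obtain ⟨a, ha, hmin⟩ := hcompact.exists_isLeast hne
  exact ⟨a, hpos ha, hmem.mono fun x hx => ⟨hmin hx, le_csSup hcompact.bddAbove hx⟩⟩

end Support

end RankOneSum

theorem mainTheorem6 {H : Type*} [NormedAddCommGroup H] [InnerProductSpace ℂ H] [CompleteSpace H]
    (ψ : ℤ → H) (hψ : RankOneSum.IsAdmissible ψ)
    (P₀ : Measure ℝ) [IsProbabilityMeasure P₀]
    (hcompact : IsCompact P₀.support) (hpos : P₀.support ⊆ Set.Ioi 0)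
    (ρ : ℝ → ℝ) (hρ_meas : Measurable ρ) (hρ_nonneg : ∀ x, 0 ≤ ρ x)
    (hρ : P₀ = volume.withDensity fun x => ENNReal.ofReal (ρ x))
    (ρmax : ℝ) (hρmax : ∀ᵐ x ∂(volume : Measure ℝ), ρ x ≤ ρmax) :
    (∃ ν : Measure ℝ, RankOneSum.IsIDSMeasure ψ P₀ ν) ∧
    ∀ ν : Measure ℝ, RankOneSum.IsIDSMeasure ψ P₀ ν →
      ν.restrict {0}ᶜ ≪ volume ∧
      (∀ᵐ t ∂(volume : Measure ℝ), 0 < t →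
        ν.rnDeriv volume t ≤ ENNReal.ofReal (ρmax * sSup P₀.support / t)) ∧
      ((∀ᵐ k ∂(AddCircle.haarAddCircle (T := (1 : ℝ))), RankOneSum.symbol ψ k ≠ 0) →
        ν ≪ volume) := by
  obtain ⟨a, ha, hP⟩ := RankOneSum.exists_pos_ae_le_and_le_sSup_support hcompact hpos
  have hP' : ∀ᵐ x ∂P₀, 0 < x ∧ x ≤ sSup P₀.support := hP.mono fun x hx => ⟨ha.trans_le hx.1, hx.2⟩
  have hκ : 0 ≤ sSup P₀.support := by
    obtain ⟨x, hx⟩ := hP'.exists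
    exact hx.1.le.trans hx.2
  refine ⟨RankOneSum.exists_isIDSMeasure hψ P₀ hP', fun ν hν => ?_⟩
  have := hν.isProbabilityMeasure
  have hν0 := RankOneSum.ae_nonneg_of_isIDSMeasure hψ (hP'.mono fun x hx => hx.1) hν
  have hbound : ∀ A, ν.withDensity ENNReal.ofReal A ≤
      ENNReal.ofReal (ρmax * sSup P₀.support) * volume A := by
    refine RankOneSum.withDensity_id_le hν0 ENNReal.ofReal_ne_top fun x ε hε => ?_
    refine (RankOneSum.integral_kernelFun_le hψ hρ_meas hρ hρmax hκ hP' hν x hε).trans_eq ?_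
    rw [mul_comm ρmax, ENNReal.ofReal_mul hκ, mul_assoc]
  have hac := RankOneSum.restrict_compl_zero_absolutelyContinuous hν0 hbound
  refine ⟨hac, RankOneSum.rnDeriv_le hbound, fun h0 => ?_⟩
  have hzero := RankOneSum.measure_singleton_zero_eq_zero hψ ha hP h0 hν
  rwa [Measure.restrict_eq_self_of_ae_mem] at hac
  exact compl_mem_ae_iff.2 hzero
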